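/- Let $\mathbf X$ be an oriented compact cyclic $3$-orbifold with underlying space $X$ and singular locus $S$ (all local groups are cyclic and preserve orientation). Suppose that the connected components of $S$ are the cores of pairwise disjoint tubes: for each component $K$ there are coordinates $(z,r,\theta)\in S^1\times D^2_R$ (where $S^1=\mathbb R/\mathbb Z$, $D^2_R$ is the open disc of radius $R=R_K>0$), compatible with the orbifold charts, that identify a neighbourhood of $K$ in $X$ with the quotient of $S^1\times D^2_R$ by the rotation group generated by $\theta\mapsto\theta+2\pi/n$, $n=n_K\ge 2$, with $K$ the image of $r=0$. Let $\zeta$ be a contact structure on $\mathbf X$ that equals $\ker(dz+r^2\,d\theta)$ in each of these tubes. (This is the form, near the singular link, of the contact structures that arise by taking $\ker(dz+r^2d\theta)$ on the tubes and extending it over the rest of $X$.) Then $X$ carries a smooth $3$-manifold structure for which the orbifold charts are local diffeomorphisms away from $S$ and $(z,r,n\theta)$ are smooth (cylindrical) coordinates on each tube, and $\zeta$ induces a contact structure $\xi$ on this manifold, that is, one that agrees with $\zeta$ off $S$. Moreover, for every component $K$ of $S$ there is a contact structure $\zeta'$ on $\mathbf X$ such that 1. $\zeta$ and $\zeta'$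 are joined by a smooth homotopy of orbifold plane fields; 2. $\zeta'$ induces a contact structure $\xi'$ on the manifold $X$, and $\xi'$ is obtained from $\xi$ by a full Lutz twist along $K$ that is invariant under the rotations of the tube: in the tubular coordinates $(z,\rho,\varphi)=(z,r/\sqrt n,n\theta)$, $\rho<\delta:=R/\sqrt n$, one has $\xi=\ker(dz+\rho^2d\varphi)$ and $\xi'=\ker(h_1(\rho)\,dz+h_2(\rho)\,d\varphi)$, and $\xi'=\xi$ outside the tube. Here $h_1,h_2$ are smooth, $h_1=1$ and $h_2=\rho^2$ on $[0,\varepsilon]\cup[\delta-\varepsilon,\delta]$ for some $\varepsilon>0$, $(h_1,h_2)$ is not parallel to $(h_1',h_2')$ for $0<\rho\le\delta$, and $h_2$ has exactly two zeros in $(0,\delta)$; 3. $\zeta'$ is overtwisted, with an overtwisted disc that meets the singular locus: $(X,\xi')$ contains a smoothly embedded closed disc $D$ with $D\cap K\neq\emptyset$ whose boundary is Legendrian, whose contact framing along $\partial D$ does not twist relative to the surface framing, and whose characteristic foliation has exactly one interior singular point. In particular, if $S\ne\emptyset$, then $\zeta$ is homotopic through orbifold plane fields to an overtwisted contact structure with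 an overtwisted disc intersecting $S$. -/

import Mathlib

open Set Filter
open scoped Topology ContDiff Manifold

noncomputable section

namespace CyclicOrbifold

abbrev E3 := EuclideanSpace ℝ (Fin 3)

abbrev E2 := EuclideanSpace ℝ (Fin 2)

/-! ### Plane fields and contact structures on open subsets of Euclidean space

A plane field on an open set `U` is a function `E3 → Submodule ℝ E3` of which only the values on `U`
matter. -/

/-- Near `p` the field `ζ` is the kernel of the nowhere vanishing smooth one-form `α`. -/
def IsLocalFormAt (α : E3 → (E3 →L[ℝ] ℝ)) (ζ : E3 → Submodule ℝ E3) (p : E3) : Prop :=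
  ContDiffAt ℝ ∞ α p ∧ ∀ᶠ q in 𝓝 p, α q ≠ 0 ∧ ζ q = LinearMap.ker (α q : E3 →ₗ[ℝ] ℝ)

/-- A smooth field of planes on `U`. -/
def IsPlaneFieldOn (U : Set E3) (ζ : E3 → Submodule ℝ E3) : Prop :=
  ∀ p ∈ U, ∃ α, IsLocalFormAt α ζ p

/-- The exterior derivative `dα(v, w)` at `p` of a one-form on Euclidean space. -/
def dForm (α : E3 → (E3 →L[ℝ] ℝ)) (p v w : E3) : ℝ :=
  fderiv ℝ α p v w - fderiv ℝ α p w v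

/-- A contact structure on `U`: locally `ζ = ker α` with `dα` nondegenerate on `ζ`, which is the
condition `α ∧ dα ≠ 0`, that is, `[X, Y] ∉ ζ` for independent fields `X`, `Y` in `ζ`. -/
def IsContactOn (U : Set E3) (ζ : E3 → Submodule ℝ E3) : Prop :=
  ∀ p ∈ U, ∃ α, IsLocalFormAt α ζ p ∧
    ∀ v ∈ ζ p, ∀ w ∈ ζ p, LinearIndependent ℝ ![v, w] → dForm α p v w ≠ 0

/-! ### Orbifolds -/

/-- A three-dimensional (effective) orbifold chart on `X`: a connected open set `dom` in Euclidean
space, a finite group `G` acting effectively on it by diffeomorphisms, and a `G`-invariant map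
`proj` that induces a homeomorphism of `dom / G` onto an open subset of `X`. Values outside `dom`
carry no meaning. -/
structure OrbChart (X : Type*) [TopologicalSpace X] where
  dom : Set E3
  isOpen_dom : IsOpen dom
  isConnected_dom : IsConnected dom
  G : Type
  [group : Group G]
  [finite : Finite G]
  act : G → E3 → E3
  act_mapsTo : ∀ g, MapsTo (act g) dom dom
  act_smooth : ∀ g, ContDiffOn ℝ ∞ (act g) dom
  act_one : ∀ u ∈ dom, act 1 u = u
  act_mul : ∀ g h, ∀ u ∈ dom, act (g * h) u = act g (act h u)
  act_faithful : ∀ g, (∀ u ∈ dom, act g u = u) → g = 1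
  proj : E3 → X
  proj_continuousOn : ContinuousOn proj dom
  proj_act : ∀ g, ∀ u ∈ dom, proj (act g u) = proj u
  exists_act_eq : ∀ u ∈ dom, ∀ v ∈ dom, proj u = proj v → ∃ g, act g u = v
  isOpen_image : ∀ V ⊆ dom, IsOpen V → IsOpen (proj '' V)

attribute [instance] OrbChart.group OrbChart.finite

variable {X : Type*} [TopologicalSpace X]

/-- An embedding of orbifold charts: a smooth embedding `j` of the domains over `X`. (The elements of
the group of a chart are embeddings of the chart into itself.) -/
structure IsChartEmbedding (j : E3 → E3) (c d : OrbChart X) : Prop where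
  mapsTo : MapsTo j c.dom d.dom
  smooth : ContDiffOn ℝ ∞ j c.dom
  injOn : InjOn j c.dom
  det_ne_zero : ∀ p ∈ c.dom, (fderiv ℝ j p).det ≠ 0
  proj_comp : ∀ p ∈ c.dom, d.proj (j p) = c.proj p

/-- An orbifold atlas on `X`. -/
structure OrbAtlas (X : Type*) [TopologicalSpace X] where
  charts : Set (OrbChart X)
  cover : ∀ x, ∃ c ∈ charts, x ∈ c.proj '' c.dom
  compatible : ∀ c ∈ charts, ∀ d ∈ charts, ∀ x ∈ c.proj '' c.dom ∩ d.proj '' d.dom,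
    ∃ (e : OrbChart X) (j₁ j₂ : E3 → E3), x ∈ e.proj '' e.dom ∧
      IsChartEmbedding j₁ e c ∧ IsChartEmbedding j₂ e d

namespace OrbAtlas

/-- The orbifold is cyclic: the local groups are cyclic and preserve orientation. -/
def IsCyclicOrbifold (O : OrbAtlas X) : Prop :=
  ∀ c ∈ O.charts, IsCyclic c.G ∧ ∀ g, ∀ u ∈ c.dom, 0 < (fderiv ℝ (c.act g) u).det

/-- `o` is an orientation of the orbifold: `o c` says whether the chart `c` is positively or
negatively oriented, and the changes of charts respect these signs. -/
def IsOrientation (O : OrbAtlas X) (o : OrbChart X → ℤˣ) : Prop :=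
  ∀ c ∈ O.charts, ∀ d ∈ O.charts, ∀ (e : OrbChart X) (j₁ j₂ : E3 → E3),
    IsChartEmbedding j₁ e c → IsChartEmbedding j₂ e d → ∀ p ∈ e.dom,
      0 < (((o c : ℤ) : ℝ) * (fderiv ℝ j₁ p).det) * (((o d : ℤ) : ℝ) * (fderiv ℝ j₂ p).det)

/-- The singular locus: the points with a nontrivial stabilizer. -/
def singularLocus (O : OrbAtlas X) : Set X :=
  {x | ∃ c ∈ O.charts, ∃ u ∈ c.dom, c.proj u = x ∧ ∃ g : c.G, g ≠ 1 ∧ c.act g u = u}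

/-- The connected components of the singular locus. -/
def singularComponents (O : OrbAtlas X) : Set (Set X) :=
  {K | ∃ x ∈ O.singularLocus, K = connectedComponentIn O.singularLocus x}

/-- A family of plane fields on the charts is invariant under the embeddings of charts, in particular
under the local groups (the case `c = d = e`, `j₁ = id`, `j₂` in the group of `c`). -/
def IsInvariant (O : OrbAtlas X) (ζ : OrbChart X → E3 → Submodule ℝ E3) : Prop :=
  ∀ c ∈ O.charts, ∀ d ∈ O.charts, ∀ (e : OrbChart X) (j₁ j₂ : E3 → E3),
    IsChartEmbedding j₁ e c → IsChartEmbedding j₂ e d → ∀ p ∈ e.dom,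
      (ζ c (j₁ p)).comap (fderiv ℝ j₁ p : E3 →ₗ[ℝ] E3) =
        (ζ d (j₂ p)).comap (fderiv ℝ j₂ p : E3 →ₗ[ℝ] E3)

/-- An orbifold plane field. -/
def IsPlaneField (O : OrbAtlas X) (ζ : OrbChart X → E3 → Submodule ℝ E3) : Prop :=
  (∀ c ∈ O.charts, IsPlaneFieldOn c.dom (ζ c)) ∧ O.IsInvariant ζ

/-- A contact structure on the orbifold. -/
def IsContact (O : OrbAtlas X) (ζ : OrbChart X → E3 → Submodule ℝ E3) : Prop :=
  (∀ c ∈ O.charts, IsContactOn c.dom (ζ c)) ∧ O.IsInvariant ζ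

/-- `ζ` and `ζ'` are homotopic through orbifold plane fields: they are joined by orbifold plane
fields `Z t`, `0 ≤ t ≤ 1`, depending smoothly on `t` and the point together. -/
def IsHomotopic (O : OrbAtlas X) (ζ ζ' : OrbChart X → E3 → Submodule ℝ E3) : Prop :=
  ∃ Z : ℝ → OrbChart X → E3 → Submodule ℝ E3,
    (∀ t ∈ Icc (0 : ℝ) 1, O.IsPlaneField (Z t)) ∧
    (∀ c ∈ O.charts, ∀ t ∈ Icc (0 : ℝ) 1, ∀ p ∈ c.dom, ∃ α : ℝ × E3 → (E3 →L[ℝ] ℝ),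
      ContDiffAt ℝ ∞ α (t, p) ∧
      ∀ᶠ y in 𝓝 (t, p), y.1 ∈ Icc (0 : ℝ) 1 →
        α y ≠ 0 ∧ Z y.1 c y.2 = LinearMap.ker (α y : E3 →ₗ[ℝ] ℝ)) ∧
    (∀ c ∈ O.charts, ∀ p ∈ c.dom, Z 0 c p = ζ c p ∧ Z 1 c p = ζ' c p)

end OrbAtlas

/-! ### Rotation-invariant models

Points of `E3` are `(z, x, y)`, with cylindrical coordinates `(z, r, θ)`. The solid torus
`S¹ × D²` with `S¹ = ℝ / ℤ` is described through its cover `ℝ × D²`, by objects that are periodic in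
`z` with period one. -/

/-- The cylindrical coordinate `r`. -/
def radius (p : E3) : ℝ := Real.sqrt (p 1 ^ 2 + p 2 ^ 2)

/-- The open solid cylinder of radius `R`. -/
def solidTube (R : ℝ) : Set E3 := {p | radius p < R}

/-- The axis `r = 0`. -/
def axis : Set E3 := {p | radius p = 0}

/-- Translation by `m` along the axis and rotation by the angle `a` around it. -/
def screw (m a : ℝ) (p : E3) : E3 :=
  !₂[p 0 + m, Real.cos a * p 1 - Real.sin a * p 2, Real.sin a * p 1 + Real.cos a * p 2]

/-- The one-form `h₁(r) dz + h₂(r) dθ`, where `r² dθ = x dy - y dx`. On the axis it is read as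
`h₁(0) dz`, which is its value there when `h₂(r)` is `r²` near `0`. -/
def rotForm (h₁ h₂ : ℝ → ℝ) (p : E3) : E3 →L[ℝ] ℝ :=
  h₁ (radius p) • EuclideanSpace.proj (0 : Fin 3) +
    (h₂ (radius p) / radius p ^ 2) •
      (p 1 • EuclideanSpace.proj (2 : Fin 3) - p 2 • EuclideanSpace.proj (1 : Fin 3))

/-- The plane field `ker (h₁(r) dz + h₂(r) dθ)`. -/
def rotPlane (h₁ h₂ : ℝ → ℝ) (p : E3) : Submodule ℝ E3 :=
  LinearMap.ker (rotForm h₁ h₂ p : E3 →ₗ[ℝ] ℝ)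

/-- The standard contact structure `ker (dz + r² dθ)` around a transverse knot. -/
def stdPlane (p : E3) : Submodule ℝ E3 := rotPlane (fun _ => 1) (fun r => r ^ 2) p

/-- The point with cylindrical coordinates `(z, s r, θ / n)`, where `(z, r, θ)` are those of `q` and
`θ` is the principal argument. -/
def rootPoint (n : ℕ) (s : ℝ) (q : E3) : E3 :=
  !₂[q 0, s * radius q * Real.cos (Complex.arg ⟨q 1, q 2⟩ / n),
    s * radius q * Real.sin (Complex.arg ⟨q 1, q 2⟩ / n)]

/-! ### Tubes around the components of the singular locus -/

/-- On the open set `V`, the map `f` into `X` lifts through the chart `c` to an open embedding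
`l`. -/
structure IsLift (f : E3 → X) (c : OrbChart X) (l : E3 → E3) (V : Set E3) : Prop where
  isOpen : IsOpen V
  mapsTo : MapsTo l V c.dom
  smooth : ContDiffOn ℝ ∞ l V
  injOn : InjOn l V
  det_ne_zero : ∀ p ∈ V, (fderiv ℝ l p).det ≠ 0
  proj_comp : ∀ p ∈ V, c.proj (l p) = f p

/-- A tube in an orbifold: coordinates, compatible with the orbifold charts, that identify an open
subset of `X` with the quotient of `S¹ × D²` (with `D²` the open disc of radius `R`) by the cyclic
group of order `n ≥ 2` generated by the rotation `θ ↦ θ + 2π / n`. -/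
structure Tube (O : OrbAtlas X) where
  n : ℕ
  two_le : 2 ≤ n
  R : ℝ
  pos : 0 < R
  map : E3 → X
  map_eq_iff : ∀ p ∈ solidTube R, ∀ q ∈ solidTube R,
    map p = map q ↔ ∃ (m : ℤ) (k : ℕ), q = screw m (2 * Real.pi * k / n) p
  exists_lift : ∀ p ∈ solidTube R, ∀ c ∈ O.charts, ∀ u ∈ c.dom, c.proj u = map p →
    ∃ (l : E3 → E3) (V : Set E3), p ∈ V ∧ V ⊆ solidTube R ∧ l p = u ∧ IsLift map c l V

namespace Tube

variable {O : OrbAtlas X}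

/-- The open subset of `X` covered by the tube. -/
def image (T : Tube O) : Set X := T.map '' solidTube T.R

/-- The core circle of the tube. -/
def core (T : Tube O) : Set X := T.map '' axis

/-- Coordinates of the quotient of the tube by rotations, as a manifold: the quotient point of
`(z, s r, θ / n)` gets the cylindrical coordinates `(z, r, θ)`. -/
def quotientCoord (T : Tube O) (s : ℝ) (q : E3) : X := T.map (rootPoint T.n s q)

/-- In the coordinates of the tube, the family `ζ` is `ker (dz + r² dθ)`. -/
def IsStandard (T : Tube O) (ζ : OrbChart X → E3 → Submodule ℝ E3) : Prop :=
  ∀ c ∈ O.charts, ∀ (l : E3 → E3) (V : Set E3), V ⊆ solidTube T.R → IsLift T.map c l V →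
    ∀ p ∈ V, (ζ c (l p)).comap (fderiv ℝ l p : E3 →ₗ[ℝ] E3) = stdPlane p

end Tube

/-- Pairwise disjoint tubes, one around each component of the singular locus. -/
structure TubeSystem (O : OrbAtlas X) where
  tube : O.singularComponents → Tube O
  core_eq : ∀ K, (tube K).core = (K : Set X)
  disjoint : ∀ K L, K ≠ L → Disjoint (tube K).image (tube L).image

/-! ### The underlying manifold, overtwisted discs, Lutz twists -/

section Manifold

variable [ChartedSpace E3 X]

/-- Pullback of a field of tangent subspaces under a map from Euclidean space. -/
def pullback (f : E3 → X) (ξ : ∀ x : X, Submodule ℝ (TangentSpace 𝓘(ℝ, E3) x)) (q : E3) :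
    Submodule ℝ E3 :=
  (ξ (f q)).comap (mfderiv 𝓘(ℝ, E3) 𝓘(ℝ, E3) f q).toLinearMap

/-- A contact structure on a smooth three-manifold. -/
def IsContactManifold (ξ : ∀ x : X, Submodule ℝ (TangentSpace 𝓘(ℝ, E3) x)) : Prop :=
  ∀ x : X, IsContactOn (chartAt E3 x).target (pullback (chartAt E3 x).symm ξ)

/-- The smooth structure on `X` is the one determined by the orbifold structure and the tubes: away
from the singular locus the orbifold charts are local diffeomorphisms, and so are the coordinates
`(z, r, n θ)` on each tube. (There is just one such smooth structure.) -/
def IsUnderlyingManifold {O : OrbAtlas X} (T : TubeSystem O) : Prop :=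
  (∀ c ∈ O.charts, ∀ u ∈ c.dom, c.proj u ∉ O.singularLocus →
    IsLocalDiffeomorphAt 𝓘(ℝ, E3) 𝓘(ℝ, E3) ∞ c.proj u) ∧
  ∀ K, ∀ q ∈ solidTube (T.tube K).R,
    IsLocalDiffeomorphAt 𝓘(ℝ, E3) 𝓘(ℝ, E3) ∞ ((T.tube K).quotientCoord 1) q

/-- The field `ξ` on the underlying manifold agrees with the orbifold field `ζ` away from the singular
locus. (This determines `ξ` if it is continuous.) -/
def Induces (O : OrbAtlas X) (ζ : OrbChart X → E3 → Submodule ℝ E3)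
    (ξ : ∀ x : X, Submodule ℝ (TangentSpace 𝓘(ℝ, E3) x)) : Prop :=
  ∀ c ∈ O.charts, ∀ u ∈ c.dom, c.proj u ∉ O.singularLocus → ζ c u = pullback c.proj ξ u

/-- The positive tangent vector at `u` of the circle around `0` through `u`. -/
def circleTangent (u : E2) : E2 := !₂[-u 1, u 0]

/-- `f` restricted to the closed unit disc is an overtwisted disc of `ξ`. -/
structure IsOvertwistedDisc [IsManifold 𝓘(ℝ, E3) ∞ X]
    (ξ : ∀ x : X, Submodule ℝ (TangentSpace 𝓘(ℝ, E3) x)) (f : E2 → X) : Prop where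
  /-- `f` is a smooth embedding of the closed unit disc. -/
  smooth : ∃ V : Set E2, IsOpen V ∧ Metric.closedBall 0 1 ⊆ V ∧
    ContMDiffOn 𝓘(ℝ, E2) 𝓘(ℝ, E3) ∞ f V
  injOn : InjOn f (Metric.closedBall 0 1)
  immersion : ∀ u ∈ Metric.closedBall (0 : E2) 1,
    Function.Injective (mfderiv 𝓘(ℝ, E2) 𝓘(ℝ, E3) f u)
  /-- The boundary is Legendrian. -/
  legendrian : ∀ u ∈ Metric.sphere (0 : E2) 1,
    mfderiv 𝓘(ℝ, E2) 𝓘(ℝ, E3) f u (circleTangent u) ∈ ξ (f u)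
  /-- The contact framing of the boundary does not twist relative to the surface framing: a
  nowhere vanishing section of the normal bundle of the boundary that is tangent to `ξ` is homotopic,
  through such sections, to one that is tangent to the disc. -/
  framing : ∃ v : ℝ → ∀ u : E2, TangentSpace 𝓘(ℝ, E3) (f u),
    ContinuousOn (fun y : ℝ × E2 => (⟨f y.2, v y.1 y.2⟩ : TangentBundle 𝓘(ℝ, E3) X))
      (Icc (0 : ℝ) 1 ×ˢ Metric.sphere (0 : E2) 1) ∧
    ∀ u ∈ Metric.sphere (0 : E2) 1,
      (∀ t ∈ Icc (0 : ℝ) 1, LinearIndependent ℝ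
        ![mfderiv 𝓘(ℝ, E2) 𝓘(ℝ, E3) f u (circleTangent u), v t u]) ∧
      v 0 u ∈ ξ (f u) ∧
      v 1 u ∈ LinearMap.range (mfderiv 𝓘(ℝ, E2) 𝓘(ℝ, E3) f u).toLinearMap
  /-- The characteristic foliation has exactly one interior singular point. -/
  singular : ∃! u : E2, u ∈ Metric.ball (0 : E2) 1 ∧
    LinearMap.range (mfderiv 𝓘(ℝ, E2) 𝓘(ℝ, E3) f u).toLinearMap = ξ (f u)

/-- The profile `(h₁, h₂)` of a full Lutz twist on a solid torus of radius `R`. As the curve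
`(h₁, h₂)` turns monotonically, having two zeros of `h₂` means that it goes around once. -/
def IsFullLutzProfile (R : ℝ) (h₁ h₂ : ℝ → ℝ) : Prop :=
  ContDiff ℝ ∞ h₁ ∧ ContDiff ℝ ∞ h₂ ∧
  (∃ ε, 0 < ε ∧ ε < R ∧ ∀ r ∈ Icc 0 ε ∪ Icc (R - ε) R, h₁ r = 1 ∧ h₂ r = r ^ 2) ∧
  (∀ r ∈ Ioc 0 R, h₁ r * deriv h₂ r - h₂ r * deriv h₁ r ≠ 0) ∧
  {r | r ∈ Ioo 0 R ∧ h₂ r = 0}.ncard = 2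

/-- `P` gives coordinates `S¹ × D²`, with `D²` the open disc of radius `R`, on a tubular
neighbourhood of the knot `K`. -/
def IsTubularCoord (K : Set X) (R : ℝ) (P : E3 → X) : Prop :=
  0 < R ∧ (∀ q ∈ solidTube R, IsLocalDiffeomorphAt 𝓘(ℝ, E3) 𝓘(ℝ, E3) ∞ P q) ∧
  (∀ p ∈ solidTube R, ∀ q ∈ solidTube R, P p = P q ↔ ∃ m : ℤ, q = screw m 0 p) ∧
  P '' axis = K

/-- `ξ'` results from `ξ` by a full Lutz twist along the knot `K`, carried out in the tubular
coordinates `P` of radius `R`. -/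
def IsFullLutzTwist (K : Set X) (R : ℝ) (P : E3 → X)
    (ξ ξ' : ∀ x : X, Submodule ℝ (TangentSpace 𝓘(ℝ, E3) x)) : Prop :=
  IsTubularCoord K R P ∧
  (∀ q ∈ solidTube R, pullback P ξ q = stdPlane q) ∧
  (∃ h₁ h₂ : ℝ → ℝ, IsFullLutzProfile R h₁ h₂ ∧
    ∀ q ∈ solidTube R, pullback P ξ' q = rotPlane h₁ h₂ q) ∧
  ∀ x ∉ P '' solidTube R, ξ' x = ξ x

end Manifold

end CyclicOrbifold

end

open CyclicOrbifold

/-!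
# Lutz twists along the singular locus of a cyclic 3-orbifold

**The underlying manifold.** Over the nonsingular points the orbifold charts are local homeomorphisms
(`TubeSystem.isParam_iff`), and so are the coordinates `(z, r, n θ)` on the quotient of a tube
(`TubeSystem.isParam_quotientCoord`). The changes between them are smooth with invertible derivative:
between two charts they are made of embeddings of charts and group elements, and between a chart and
a tube the change is a lift followed by the map `powMap`, `θ ↦ n θ`, away from the axis. Thus the
parametrizations define a smooth structure (`TubeSystem.paramFamily`). The relation `GermEquiv` keeps
track of a change of coordinates together with a subspace it preserves; the same argument therefore
shows that an invariant plane field on the charts, with fields on the quotients that correspond to it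
off the axis, descends to `X` (`TubeSystem.exists_induced`). With `φ = n θ` the form `dz + r² dθ` is
`dz + (1 / n) r² dφ`, which is smooth and contact on the axis too.

**The twist.** As a function of `s = r²`, the standard form is given by the curve `(1, s)` in the
plane. Rotate its points by an angle `ψ(s)` that grows from `0` to `2 π` on an interval `(a, b)`; the
result defines the form `A dz + B r² dθ`. The contact condition says that the position and the
velocity of the curve are independent, and their determinant is `1 + ψ' (1 + s²) > 0`
(`twist_turning`). The second coordinate of the curve vanishes where the increasing function
`arctan s + ψ(s)` is `π` or `2 π`, that is, exactly twice for `s > 0` (`exists_zeros`,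
`isFullLutzProfile`).

**Passing to the orbifold.** A rotation-invariant field on a tube gives a plane field on the charts:
two local expressions of a chart in the coordinates of the tube differ, to first order at each point
and in each direction, by a fixed element of the group of the tube (`Tube.exists_screw`,
`Tube.comap_eq`). So the twisted form replaces the standard one inside the tube (`Tube.tubeField`,
`Tube.isContact_tubeField`).

**The homotopy.** Linear interpolation between the two forms vanishes where the twisted one is a
negative multiple of the standard one. Adding `t (1 - t) χ r dr`, with `χ` positive where the twist
takes place, avoids this without destroying rotation invariance (`homotopyForm_ne_zero`,
`Tube.isHomotopic_tubeField`).

**The overtwisted disc.** On the circle where the second coordinate of the curve first vanishes,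
the contact planes are horizontal. A paraboloid over the disc that it bounds meets the axis, has
Legendrian boundary along which the contact planes are transverse to it, and is tangent to the contact
planes at its vertex only (`isOvertwistedDisc_paraboloid`).
-/

noncomputable section

namespace CyclicOrbifold

/-! ### Local diffeomorphisms of Euclidean space and germs of parametrizations -/

theorem injective_of_det_ne_zero {f : E3 →L[ℝ] E3} (h : f.det ≠ 0) : Function.Injective f := by
  have := (f.toContinuousLinearEquivOfDetNeZero h).injective
  rwa [← ContinuousLinearEquiv.coe_coe, f.coe_toContinuousLinearEquivOfDetNeZero h] at this

theorem exists_continuousLinearEquiv {f : E3 →L[ℝ] E3} (h : Function.Injective f) :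
    ∃ e : E3 ≃L[ℝ] E3, (e : E3 →L[ℝ] E3) = f := by
  refine ⟨(LinearEquiv.ofInjectiveEndo (f : E3 →ₗ[ℝ] E3) h).toContinuousLinearEquiv, ?_⟩
  ext v : 1
  rfl

theorem comp_ne_zero_of_injective {α : E3 →L[ℝ] ℝ} {f : E3 →L[ℝ] E3} (hα : α ≠ 0)
    (hf : Function.Injective f) : α.comp f ≠ 0 := by
  obtain ⟨e, rfl⟩ := exists_continuousLinearEquiv hf
  refine fun h0 => hα ?_
  ext1 v
  simpa using congrArg (fun L => L (e.symm v)) h0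

/-- The inverse function theorem, in terms of germs. -/
theorem exists_localInverse {τ : E3 → E3} {p : E3} (h : ContDiffAt ℝ ∞ τ p)
    (hi : Function.Injective (fderiv ℝ τ p)) :
    map τ (𝓝 p) = 𝓝 (τ p) ∧ ∃ ρ : E3 → E3, ContDiffAt ℝ ∞ ρ (τ p) ∧ ρ (τ p) = p ∧
      (∀ᶠ y in 𝓝 p, ρ (τ y) = y) ∧ (∀ᶠ z in 𝓝 (τ p), τ (ρ z) = z) ∧
      Function.Injective (fderiv ℝ ρ (τ p)) := by
  obtain ⟨e, he⟩ := exists_continuousLinearEquiv hi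
  have hd : HasFDerivAt τ (e : E3 →L[ℝ] E3) p := by
    rw [he]; exact (h.differentiableAt (by simp)).hasFDerivAt
  have hs : HasStrictFDerivAt τ (e : E3 →L[ℝ] E3) p := h.hasStrictFDerivAt' hd (by simp)
  have hsm : ContDiffAt ℝ ∞ (hs.localInverse τ e p) (τ p) := h.to_localInverse hd (by simp)
  refine ⟨hs.map_nhds_eq_of_equiv, hs.localInverse τ e p, hsm,
    hs.localInverse_apply_image, hs.eventually_left_inverse, hs.eventually_right_inverse, ?_⟩
  have h1 := hs.to_localInverse.hasFDerivAt.fderiv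
  rw [h1]
  exact e.symm.injective

/-- `(P, p)` and `(Q, q)`, with planes `A` and `B` at `p` and `q`, are related by the germ of a
diffeomorphism over `X`. For `A = B = ⊤` this is a condition on the maps only. -/
def GermEquiv {X : Type*} (P : E3 → X) (p : E3) (A : Submodule ℝ E3)
    (Q : E3 → X) (q : E3) (B : Submodule ℝ E3) : Prop :=
  ∃ τ : E3 → E3, ContDiffAt ℝ ∞ τ p ∧ Function.Injective (fderiv ℝ τ p) ∧ τ p = q ∧
    (∀ᶠ y in 𝓝 p, Q (τ y) = P y) ∧ A = B.comap (fderiv ℝ τ p : E3 →ₗ[ℝ] E3)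

namespace GermEquiv

variable {X : Type*} {P Q S : E3 → X} {p q s : E3} {A B C : Submodule ℝ E3}

theorem top (h : GermEquiv P p A Q q B) : GermEquiv P p ⊤ Q q ⊤ := by
  obtain ⟨τ, h1, h2, h3, h4, -⟩ := h
  exact ⟨τ, h1, h2, h3, h4, by simp⟩

theorem eq (h : GermEquiv P p A Q q B) : P p = Q q := by
  obtain ⟨τ, h1, h2, h3, h4, h5⟩ := h
  rw [← h4.self_of_nhds, h3]

theorem trans (h : GermEquiv P p A Q q B) (h' : GermEquiv Q q B S s C) :
    GermEquiv P p A S s C := by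
  obtain ⟨τ, h1, h2, h3, h4, h5⟩ := h
  obtain ⟨τ', h1', h2', h3', h4', h5'⟩ := h'
  subst h3
  have hd : fderiv ℝ (τ' ∘ τ) p = (fderiv ℝ τ' (τ p)).comp (fderiv ℝ τ p) :=
    fderiv_comp p (h1'.differentiableAt (by simp)) (h1.differentiableAt (by simp))
  refine ⟨τ' ∘ τ, h1'.comp p h1, ?_, h3', ?_, ?_⟩
  · rw [hd]; exact h2'.comp h2
  · filter_upwards [h4, h1.continuousAt.eventually h4'] with y hy hy'
    rw [Function.comp_apply, hy', hy]
  · rw [hd, h5, h5']; rfl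

theorem symm (h : GermEquiv P p A Q q B) : GermEquiv Q q B P p A := by
  obtain ⟨τ, h1, h2, h3, h4, h5⟩ := h
  subst h3
  obtain ⟨hm, ρ, r1, r2, r3, r4, r5⟩ := exists_localInverse h1 h2
  refine ⟨ρ, r1, r5, r2, ?_, ?_⟩
  · have : Tendsto ρ (𝓝 (τ p)) (𝓝 p) := by
      have := r1.continuousAt.tendsto
      rwa [r2] at this
    filter_upwards [r4, this.eventually h4] with z hz hz'
    rw [← hz', hz]
  · have hd : (fderiv ℝ τ p).comp (fderiv ℝ ρ (τ p)) = ContinuousLinearMap.id ℝ E3 := by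
      have h0 : HasFDerivAt (τ ∘ ρ) ((fderiv ℝ τ p).comp (fderiv ℝ ρ (τ p))) (τ p) := by
        refine HasFDerivAt.comp _ ?_ (r1.differentiableAt (by simp)).hasFDerivAt
        rw [r2]
        exact (h1.differentiableAt (by simp)).hasFDerivAt
      have h1 : HasFDerivAt (τ ∘ ρ) (ContinuousLinearMap.id ℝ E3) (τ p) :=
        (hasFDerivAt_id (τ p)).congr_of_eventuallyEq r4
      exact h0.unique h1
    rw [h5]
    ext v
    have := congrArg (fun L => L v) hd
    simp only [ContinuousLinearMap.comp_apply, ContinuousLinearMap.id_apply] at this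
    simp [this]

end GermEquiv

/-- Near `p` the map `P` is a homeomorphism onto an open set, stated with neighbourhood filters. -/
def IsParam {X : Type*} [TopologicalSpace X] (P : E3 → X) (p : E3) : Prop :=
  map P (𝓝 p) = 𝓝 (P p) ∧ ∃ U ∈ 𝓝 p, InjOn P U

theorem GermEquiv.isParam {X : Type*} [TopologicalSpace X] {P Q : E3 → X} {p q : E3}
    {A B : Submodule ℝ E3} (h : GermEquiv P p A Q q B) (hQ : IsParam Q q) : IsParam P p := by
  obtain ⟨τ, h1, h2, h3, h4, h5⟩ := h
  subst h3
  obtain ⟨hm, ρ, r1, r2, r3, r4, r5⟩ := exists_localInverse h1 h2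
  obtain ⟨hQ1, U, hU, hUi⟩ := hQ
  refine ⟨?_, {y | ρ (τ y) = y ∧ Q (τ y) = P y ∧ τ y ∈ U}, ?_, ?_⟩
  · rw [← h4.self_of_nhds, ← hQ1, ← hm, map_map]
    exact (map_congr h4).symm
  · filter_upwards [r3, h4, h1.continuousAt.eventually hU] with y a b c
    exact ⟨a, b, c⟩
  · rintro y ⟨a, b, c⟩ y' ⟨a', b', c'⟩ hy
    rw [← a, ← a', hUi c c' (by rw [b, b', hy])]

/-- Openness and continuity alone are transferred as well. -/
theorem GermEquiv.map_nhds {X : Type*} [TopologicalSpace X] {P Q : E3 → X} {p q : E3}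
    {A B : Submodule ℝ E3} (h : GermEquiv P p A Q q B) (hQ : map Q (𝓝 q) = 𝓝 (Q q)) :
    map P (𝓝 p) = 𝓝 (P p) := by
  obtain ⟨τ, h1, h2, h3, h4, h5⟩ := h
  subst h3
  obtain ⟨hm, -⟩ := exists_localInverse h1 h2
  rw [← h4.self_of_nhds, ← hQ, ← hm, map_map]
  exact (map_congr h4).symm

/-! ### Plane fields and contact structures under pullback -/

/-- The pointwise condition in `IsContactOn`. -/
def IsContactAt (ζ : E3 → Submodule ℝ E3) (p : E3) : Prop :=
  ∃ α, IsLocalFormAt α ζ p ∧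
    ∀ v ∈ ζ p, ∀ w ∈ ζ p, LinearIndependent ℝ ![v, w] → dForm α p v w ≠ 0

theorem IsContactAt.congr {ζ η : E3 → Submodule ℝ E3} {p : E3} (h : IsContactAt ζ p)
    (he : η =ᶠ[𝓝 p] ζ) : IsContactAt η p := by
  obtain ⟨α, ⟨h1, h2⟩, h3⟩ := h
  refine ⟨α, ⟨h1, ?_⟩, ?_⟩
  · filter_upwards [h2, he] with q hq hq'
    rw [hq']; exact hq
  · rw [he.self_of_nhds]; exact h3

/-- Smoothness at a point gives only finite differentiability nearby, so the conclusion is stated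
with differentiability. -/
theorem eventually_injective_fderiv {τ : E3 → E3} {p : E3} (h : ContDiffAt ℝ ∞ τ p)
    (hi : Function.Injective (fderiv ℝ τ p)) :
    ∀ᶠ q in 𝓝 p, DifferentiableAt ℝ τ q ∧ Function.Injective (fderiv ℝ τ q) := by
  have h1 : ContDiffAt ℝ 1 τ p := h.of_le (mod_cast le_top)
  have hc : ContinuousAt (fderiv ℝ τ) p :=
    (h1.fderiv_right (m := 0) (by simp)).continuousAt
  filter_upwards [h1.eventually (by simp),
    hc.eventually (ContinuousLinearMap.isOpen_injective.mem_nhds hi)] with q hq hq'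
  exact ⟨hq.differentiableAt (by simp), hq'⟩

theorem contDiffAt_pullbackForm {α : E3 → (E3 →L[ℝ] ℝ)} {σ : E3 → E3} {p : E3}
    (hα : ContDiffAt ℝ ∞ α (σ p)) (hσ : ContDiffAt ℝ ∞ σ p) :
    ContDiffAt ℝ ∞ (fun q => (α (σ q)).comp (fderiv ℝ σ q)) p :=
  (hα.comp p hσ).clm_comp (hσ.fderiv_right (by simp))

/-- The exterior derivative commutes with pullback. -/
theorem dForm_pullback {α : E3 → (E3 →L[ℝ] ℝ)} {σ : E3 → E3} {p : E3}
    (hα : ContDiffAt ℝ ∞ α (σ p)) (hσ : ContDiffAt ℝ ∞ σ p) (v w : E3) :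
    dForm (fun q => (α (σ q)).comp (fderiv ℝ σ q)) p v w =
      dForm α (σ p) (fderiv ℝ σ p v) (fderiv ℝ σ p w) := by
  have h1 : HasFDerivAt (fun q => α (σ q)) ((fderiv ℝ α (σ p)).comp (fderiv ℝ σ p)) p :=
    (hα.differentiableAt (by simp)).hasFDerivAt.comp p
      (hσ.differentiableAt (by simp)).hasFDerivAt
  have h2 : HasFDerivAt (fderiv ℝ σ) (fderiv ℝ (fderiv ℝ σ) p) p :=
    ((hσ.fderiv_right (m := ∞) (by simp)).differentiableAt (by simp)).hasFDerivAt
  have hs : IsSymmSndFDerivAt ℝ σ p := hσ.isSymmSndFDerivAt (by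
    rw [minSmoothness_of_isRCLikeNormedField]; 
    exact WithTop.coe_le_coe.2 (le_top : (2 : ℕ∞) ≤ ⊤))
  unfold dForm
  rw [(h1.clm_comp h2).fderiv]
  simp [hs.eq v w]

theorem IsContactAt.comap {η : E3 → Submodule ℝ E3} {σ : E3 → E3} {p : E3}
    (h : IsContactAt η (σ p)) (hσ : ContDiffAt ℝ ∞ σ p)
    (hi : Function.Injective (fderiv ℝ σ p)) :
    IsContactAt (fun q => (η (σ q)).comap (fderiv ℝ σ q : E3 →ₗ[ℝ] E3)) p := by
  obtain ⟨α, ⟨h1, h2⟩, h3⟩ := h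
  refine ⟨fun q => (α (σ q)).comp (fderiv ℝ σ q), ⟨contDiffAt_pullbackForm h1 hσ, ?_⟩, ?_⟩
  · filter_upwards [hσ.continuousAt.eventually h2, eventually_injective_fderiv hσ hi]
      with q hq hq'
    refine ⟨comp_ne_zero_of_injective hq.1 hq'.2, ?_⟩
    rw [hq.2]; rfl
  · intro v hv w hw hl
    rw [dForm_pullback h1 hσ]
    refine h3 _ hv _ hw ?_
    have := hl.map' (fderiv ℝ σ p : E3 →ₗ[ℝ] E3) (LinearMap.ker_eq_bot.2 hi)
    have e : ![fderiv ℝ σ p v, fderiv ℝ σ p w] = (fderiv ℝ σ p : E3 →ₗ[ℝ] E3) ∘ ![v, w] := by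
      ext i : 1
      fin_cases i <;> rfl
    exact (e ▸ this : LinearIndependent ℝ ![fderiv ℝ σ p v, fderiv ℝ σ p w])

/-! ### Manifolds from compatible parametrizations -/

/-- A smooth structure on `X` given by maps `P i` from open subsets `U i` of Euclidean space that are
local homeomorphisms with smooth changes of coordinates. -/
structure ParamFamily (X : Type*) [TopologicalSpace X] (ι : Type*) where
  P : ι → E3 → X
  U : ι → Set E3
  isOpen : ∀ i, IsOpen (U i)
  param : ∀ i, ∀ p ∈ U i, IsParam (P i) p
  cover : ∀ x, ∃ i, ∃ p ∈ U i, P i p = x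
  compat : ∀ i, ∀ p ∈ U i, ∀ j, ∀ q ∈ U j, P i p = P j q → GermEquiv (P i) p ⊤ (P j) q ⊤

namespace ParamFamily

variable {X : Type*} [TopologicalSpace X] {ι : Type*} (F : ParamFamily X ι)

/-- The charts are all homeomorphisms whose inverse is a restriction of some `P i`. -/
def chartSet : Set (OpenPartialHomeomorph X E3) :=
  {e | ∃ i, e.target ⊆ F.U i ∧ EqOn e.symm (F.P i) e.target}

theorem exists_chart (i : ι) (p : E3) (hp : p ∈ F.U i) :
    ∃ e : OpenPartialHomeomorph X E3, e.target ⊆ F.U i ∧ EqOn e.symm (F.P i) e.target ∧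
      p ∈ e.target := by
  obtain ⟨V, hV, hVi⟩ := (F.param i p hp).2
  obtain ⟨W, hW, hWo, hpW⟩ := mem_nhds_iff.1 (inter_mem hV ((F.isOpen i).mem_nhds hp))
  have hinj : InjOn (F.P i) W := hVi.mono fun y hy => (hW hy).1
  have hpar : ∀ y ∈ W, map (F.P i) (𝓝 y) = 𝓝 (F.P i y) := fun y hy =>
    (F.param i y (hW hy).2).1
  let e := OpenPartialHomeomorph.ofContinuousOpenRestrict (hinj.toPartialEquiv (F.P i) W)
    (fun y hy => ContinuousAt.continuousWithinAt (hpar y hy).le) (by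
      rw [isOpenMap_iff_nhds_le]
      rintro ⟨y, hy⟩
      replace hy : y ∈ W := hy
      change 𝓝 (F.P i y) ≤ map (F.P i ∘ Subtype.val) (𝓝 (⟨y, hy⟩ : W))
      rw [← map_map, map_nhds_subtype_coe_eq_nhds hy (hWo.mem_nhds hy), hpar y hy]) hWo
  exact ⟨e.symm, fun y hy => (hW hy).2, fun y hy => rfl, hpW⟩

/-- The charted space of a family of parametrizations. -/
abbrev chartedSpace : ChartedSpace E3 X where
  atlas := F.chartSet
  chartAt x := (F.exists_chart _ _ (F.cover x).choose_spec.choose_spec.1).choose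
  mem_chart_source x := by
    have h := (F.exists_chart _ _ (F.cover x).choose_spec.choose_spec.1).choose_spec
    have h2 := (F.cover x).choose_spec.choose_spec.2
    set e := (F.exists_chart _ _ (F.cover x).choose_spec.choose_spec.1).choose
    have h3 := e.symm.map_source h.2.2
    rwa [h.2.1 h.2.2, h2] at h3
  chart_mem_atlas x := by
    have h := (F.exists_chart _ _ (F.cover x).choose_spec.choose_spec.1).choose_spec
    exact ⟨_, h.1, h.2.1⟩

theorem isManifold : @IsManifold ℝ _ E3 _ _ E3 _ 𝓘(ℝ, E3) ∞ X _ F.chartedSpace := by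
  let _ := F.chartedSpace
  refine isManifold_of_contDiffOn _ _ _ ?_
  rintro e e' ⟨i, hi, hie⟩ ⟨j, hj, hje⟩ p hp
  simp only [modelWithCornersSelf_coe_symm, preimage_id_eq, id_eq, range_id,
    modelWithCornersSelf_coe, inter_univ, Function.comp_id, Function.id_comp] at hp ⊢
  refine ContDiffAt.contDiffWithinAt ?_
  have hp1 : p ∈ e.target := hp.1
  have hp2 : e.symm p ∈ e'.source := hp.2
  have hq : e' (e.symm p) ∈ e'.target := e'.map_source hp2
  have hPQ : F.P i p = F.P j (e' (e.symm p)) := by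
    rw [← hje hq, e'.left_inv hp2, hie hp1]
  obtain ⟨τ, t1, t2, t3, t4, -⟩ := F.compat i p (hi hp1) j _ (hj hq) hPQ
  refine t1.congr_of_eventuallyEq ?_
  have := t1.continuousAt.eventually (e'.open_target.mem_nhds (t3 ▸ hq))
  filter_upwards [t4, this, e.open_target.mem_nhds hp1] with y h1 h2 h3
  change e' (e.symm y) = τ y
  rw [hie h3, ← h1, ← hje h2, e'.right_inv h2]

theorem isLocalDiffeomorphAt {i : ι} {p : E3} (hp : p ∈ F.U i) :
    @IsLocalDiffeomorphAt ℝ _ E3 _ _ E3 _ _ E3 _ E3 _ 𝓘(ℝ, E3) 𝓘(ℝ, E3) E3 _ _ X _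
      F.chartedSpace ∞ (F.P i) p := by
  let _ := F.chartedSpace
  have := F.isManifold
  obtain ⟨e, h1, h2, h3⟩ := F.exists_chart i p hp
  have he : e ∈ IsManifold.maximalAtlas 𝓘(ℝ, E3) ∞ X :=
    StructureGroupoid.subset_maximalAtlas _ ⟨i, h1, h2⟩
  exact ⟨⟨e.symm.toPartialEquiv, e.open_target, e.open_source,
    contMDiffOn_symm_of_mem_maximalAtlas he, contMDiffOn_of_mem_maximalAtlas he⟩, h3, h2.symm⟩

end ParamFamily

section Manifold

variable {X : Type*} [TopologicalSpace X] [ChartedSpace E3 X]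

theorem pullback_congr {P Q : E3 → X} {p : E3} (h : P =ᶠ[𝓝 p] Q)
    (ξ : ∀ x : X, Submodule ℝ (TangentSpace 𝓘(ℝ, E3) x)) : pullback P ξ p = pullback Q ξ p := by
  unfold pullback
  rw [h.mfderiv_eq, h.self_of_nhds]

theorem mfderiv_comp_eq {P : E3 → X} {τ : E3 → E3} {p : E3}
    (hP : MDifferentiableAt 𝓘(ℝ, E3) 𝓘(ℝ, E3) P (τ p)) (hτ : DifferentiableAt ℝ τ p) (v : E3) :
    mfderiv 𝓘(ℝ, E3) 𝓘(ℝ, E3) (P ∘ τ) p v =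
      mfderiv 𝓘(ℝ, E3) 𝓘(ℝ, E3) P (τ p) (fderiv ℝ τ p v) := by
  rw [mfderiv_comp p hP hτ.mdifferentiableAt, mfderiv_eq_fderiv]
  rfl

theorem pullback_comp {P : E3 → X} {τ : E3 → E3} {p : E3}
    (hP : MDifferentiableAt 𝓘(ℝ, E3) 𝓘(ℝ, E3) P (τ p)) (hτ : DifferentiableAt ℝ τ p)
    (ξ : ∀ x : X, Submodule ℝ (TangentSpace 𝓘(ℝ, E3) x)) :
    pullback (P ∘ τ) ξ p = (pullback P ξ (τ p)).comap (fderiv ℝ τ p : E3 →ₗ[ℝ] E3) := by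
  unfold pullback
  rw [mfderiv_comp p hP hτ.mdifferentiableAt, mfderiv_eq_fderiv]
  rfl

theorem mfderiv_bijective {P : E3 → X} {p : E3}
    (h : IsLocalDiffeomorphAt 𝓘(ℝ, E3) 𝓘(ℝ, E3) ∞ P p) :
    Function.Bijective (mfderiv 𝓘(ℝ, E3) 𝓘(ℝ, E3) P p) := by
  rw [← h.mfderivToContinuousLinearEquiv_coe (by simp)]
  exact (h.mfderivToContinuousLinearEquiv (by simp)).bijective

/-- A local diffeomorphism from Euclidean space detects a field at its image point. -/
theorem eq_of_pullback_eq {P : E3 → X} {p : E3}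
    (h : IsLocalDiffeomorphAt 𝓘(ℝ, E3) 𝓘(ℝ, E3) ∞ P p)
    {ξ ξ' : ∀ x : X, Submodule ℝ (TangentSpace 𝓘(ℝ, E3) x)}
    (he : pullback P ξ p = pullback P ξ' p) : ξ (P p) = ξ' (P p) :=
  Submodule.comap_injective_of_surjective (mfderiv_bijective h).2 he

end Manifold

namespace ParamFamily

variable {X : Type*} [TopologicalSpace X] {ι : Type*} (F : ParamFamily X ι)

/-- Plane fields on the domains that correspond to each other under the changes of coordinates are
the pullbacks of a field on the manifold. -/
theorem exists_field (η : ι → E3 → Submodule ℝ E3)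
    (hη : ∀ i, ∀ p ∈ F.U i, ∀ j, ∀ q ∈ F.U j, F.P i p = F.P j q →
      GermEquiv (F.P i) p (η i p) (F.P j) q (η j q)) :
    letI := F.chartedSpace
    ∃ ξ : ∀ x : X, Submodule ℝ (TangentSpace 𝓘(ℝ, E3) x),
      ∀ i, ∀ p ∈ F.U i, pullback (F.P i) ξ p = η i p := by
  let _ := F.chartedSpace
  choose i p hp hx using F.cover
  refine ⟨fun x => (η (i x) (p x)).map
    (mfderiv 𝓘(ℝ, E3) 𝓘(ℝ, E3) (F.P (i x)) (p x) : E3 →L[ℝ] E3).toLinearMap, ?_⟩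
  intro k q hq
  obtain ⟨τ, t1, t2, t3, t4, t5⟩ := hη k q hq _ _ (hp (F.P k q)) (hx (F.P k q)).symm
  have hl := F.isLocalDiffeomorphAt (hp (F.P k q))
  have hm := hl.mdifferentiableAt (by simp)
  have hb := (mfderiv_bijective hl).1
  rw [t5]
  unfold pullback
  ext v
  have e : mfderiv 𝓘(ℝ, E3) 𝓘(ℝ, E3) (F.P k) q v =
      mfderiv 𝓘(ℝ, E3) 𝓘(ℝ, E3) (F.P (i (F.P k q))) (p (F.P k q)) (fderiv ℝ τ q v) := by
    have h1 : F.P k =ᶠ[𝓝 q] F.P (i (F.P k q)) ∘ τ := t4.mono fun y hy => hy.symm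
    rw [h1.mfderiv_eq]
    have := mfderiv_comp_eq (P := F.P (i (F.P k q))) (τ := τ) (p := q) (by rw [t3]; exact hm)
      (t1.differentiableAt (by simp)) v
    rw [t3] at this
    exact this
  constructor
  · intro h
    obtain ⟨w, hw, hwv⟩ := h
    have : w = fderiv ℝ τ q v := hb (hwv.trans e)
    rw [this] at hw
    exact hw
  · intro h
    exact ⟨_, h, e.symm⟩

theorem isContactManifold {ξ : letI := F.chartedSpace
      ∀ x : X, Submodule ℝ (TangentSpace 𝓘(ℝ, E3) x)} {η : ι → E3 → Submodule ℝ E3}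
    (hξ : letI := F.chartedSpace; ∀ i, ∀ p ∈ F.U i, pullback (F.P i) ξ p = η i p)
    (hη : ∀ i, ∀ p ∈ F.U i, IsContactAt (η i) p) :
    letI := F.chartedSpace
    IsContactManifold ξ := by
  let _ := F.chartedSpace
  intro x p hp
  obtain ⟨i, h1, h2⟩ : chartAt E3 x ∈ F.chartSet := ChartedSpace.chart_mem_atlas x
  refine (hη i p (h1 hp)).congr ?_
  filter_upwards [(chartAt E3 x).open_target.mem_nhds hp] with q hq
  rw [← hξ i q (h1 hq)]
  exact pullback_congr (h2.eventuallyEq_of_mem ((chartAt E3 x).open_target.mem_nhds hq)) ξ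

end ParamFamily

/-! ### Cylindrical coordinates -/

/-- The square of the radius, a smooth function. -/
def sqRadius (p : E3) : ℝ := p 1 ^ 2 + p 2 ^ 2

/-- The component of a point in the plane of the disc, as a complex number. -/
def cxCoord : E3 →L[ℝ] ℂ :=
  (EuclideanSpace.proj (1 : Fin 3) : E3 →L[ℝ] ℝ).smulRight (1 : ℂ) +
    (EuclideanSpace.proj (2 : Fin 3) : E3 →L[ℝ] ℝ).smulRight Complex.I

theorem cxCoord_apply (p : E3) : cxCoord p = ⟨p 1, p 2⟩ := by
  apply Complex.ext <;> simp [cxCoord]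

theorem E3.ext {p q : E3} (h0 : p 0 = q 0) (h1 : p 1 = q 1) (h2 : p 2 = q 2) : p = q := by
  ext i
  fin_cases i <;> assumption

theorem ext_cxCoord {p q : E3} (h0 : p 0 = q 0) (h : cxCoord p = cxCoord q) : p = q := by
  rw [cxCoord_apply, cxCoord_apply, Complex.mk.injEq] at h
  exact E3.ext h0 h.1 h.2

theorem sqRadius_nonneg (p : E3) : 0 ≤ sqRadius p := by unfold sqRadius; positivity

theorem radius_nonneg (p : E3) : 0 ≤ radius p := Real.sqrt_nonneg _

theorem radius_sq (p : E3) : radius p ^ 2 = sqRadius p := Real.sq_sqrt (sqRadius_nonneg p)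

theorem norm_cxCoord (p : E3) : ‖cxCoord p‖ = radius p := by
  rw [cxCoord_apply, Complex.norm_def, Complex.normSq_mk, radius, sq, sq]

theorem radius_eq_zero {p : E3} : radius p = 0 ↔ cxCoord p = 0 := by
  rw [← norm_cxCoord, norm_eq_zero]

theorem mem_axis {p : E3} : p ∈ axis ↔ radius p = 0 := Iff.rfl

theorem radius_eq_zero' {p : E3} : radius p = 0 ↔ p 1 = 0 ∧ p 2 = 0 := by
  rw [radius_eq_zero, cxCoord_apply, Complex.ext_iff]
  rfl

theorem sqRadius_eq_zero {p : E3} : sqRadius p = 0 ↔ radius p = 0 := by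
  rw [← radius_sq]; simp

theorem mem_solidTube {R : ℝ} {p : E3} : p ∈ solidTube R ↔ radius p < R := Iff.rfl

theorem mem_solidTube_iff_sq {R : ℝ} (hR : 0 < R) {p : E3} :
    p ∈ solidTube R ↔ sqRadius p < R ^ 2 := by
  rw [mem_solidTube, ← radius_sq, sq_lt_sq₀ (radius_nonneg p) hR.le]

theorem continuous_radius : Continuous radius := by
  simp_rw [← funext norm_cxCoord]
  exact cxCoord.continuous.norm

theorem isOpen_solidTube (R : ℝ) : IsOpen (solidTube R) :=
  isOpen_lt continuous_radius continuous_const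

theorem axis_subset_solidTube {R : ℝ} (hR : 0 < R) : axis ⊆ solidTube R := fun p hp => by
  rw [mem_solidTube, mem_axis.1 hp]; exact hR

theorem contDiff_coord (i : Fin 3) : ContDiff ℝ ∞ fun p : E3 => p i :=
  (EuclideanSpace.proj (𝕜 := ℝ) i).contDiff

theorem contDiff_sqRadius : ContDiff ℝ ∞ sqRadius :=
  ((contDiff_coord 1).pow 2).add ((contDiff_coord 2).pow 2)

theorem hasFDerivAt_coord (i : Fin 3) (p : E3) :
    HasFDerivAt (fun p : E3 => p i) (EuclideanSpace.proj i : E3 →L[ℝ] ℝ) p :=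
  (EuclideanSpace.proj (𝕜 := ℝ) i).hasFDerivAt

theorem fderiv_sqRadius (p v : E3) :
    fderiv ℝ sqRadius p v = 2 * (p 1 * v 1 + p 2 * v 2) := by
  have := ((hasFDerivAt_coord 1 p).pow 2).add ((hasFDerivAt_coord 2 p).pow 2)
  have h2 : HasFDerivAt sqRadius _ p := this
  rw [h2.fderiv]
  simp
  ring

/-- The linear part of a screw motion. -/
def rotation (a : ℝ) : E3 →L[ℝ] E3 :=
  LinearMap.toContinuousLinearMap
    { toFun := screw 0 a
      map_add' := fun p q => by apply E3.ext <;> simp [screw] <;> ring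
      map_smul' := fun c p => by apply E3.ext <;> simp [screw] <;> ring }

theorem rotation_apply (a : ℝ) (v : E3) : rotation a v = screw 0 a v := rfl

theorem hasFDerivAt_screw (m a : ℝ) (p : E3) : HasFDerivAt (screw m a) (rotation a) p := by
  have h : screw m a = fun p => rotation a p + !₂[m, 0, 0] := by
    ext1 p
    apply E3.ext <;> simp [rotation_apply, screw]
  rw [h]
  exact (rotation a).hasFDerivAt.add_const _

theorem contDiff_screw (m a : ℝ) : ContDiff ℝ ∞ (screw m a) := by
  have h : screw m a = fun p => rotation a p + !₂[m, 0, 0] := by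
    ext1 p
    apply E3.ext <;> simp [rotation_apply, screw]
  rw [h]
  exact (rotation a).contDiff.add contDiff_const

theorem screw_zero_apply (m a : ℝ) (p : E3) : screw m a p 0 = p 0 + m := by simp [screw]

theorem cxCoord_screw (m a : ℝ) (p : E3) :
    cxCoord (screw m a p) = Complex.exp (a * Complex.I) * cxCoord p := by
  rw [cxCoord_apply, cxCoord_apply, Complex.exp_mul_I]
  apply Complex.ext <;> simp [screw, Complex.cos_ofReal_re, Complex.sin_ofReal_re]
  ring

theorem radius_screw (m a : ℝ) (p : E3) : radius (screw m a p) = radius p := by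
  rw [← norm_cxCoord, ← norm_cxCoord, cxCoord_screw, norm_mul, Complex.norm_exp_ofReal_mul_I,
    one_mul]

theorem sqRadius_screw (m a : ℝ) (p : E3) : sqRadius (screw m a p) = sqRadius p := by
  rw [← radius_sq, ← radius_sq, radius_screw]

theorem rotation_zero (v : E3) : rotation 0 v = v := by
  rw [rotation_apply]; apply E3.ext <;> simp [screw]

theorem screw_zero_zero (p : E3) : screw 0 0 p = p := by
  apply E3.ext <;> simp [screw]

/-! ### Rotation-invariant one-forms -/

/-- The one-form `a dz + b (x dy - y dx) + e (x dx + y dy)` at the point `(z, x, y)`, in other words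
`a dz + b r² dθ + e r dr`. -/
def cylForm (a b e : ℝ) (p : E3) : E3 →L[ℝ] ℝ :=
  a • EuclideanSpace.proj (0 : Fin 3) +
    b • (p 1 • EuclideanSpace.proj (2 : Fin 3) - p 2 • EuclideanSpace.proj (1 : Fin 3)) +
    e • (p 1 • EuclideanSpace.proj (1 : Fin 3) + p 2 • EuclideanSpace.proj (2 : Fin 3))

theorem cylForm_apply (a b e : ℝ) (p v : E3) :
    cylForm a b e p v =
      a * v 0 + b * (p 1 * v 2 - p 2 * v 1) + e * (p 1 * v 1 + p 2 * v 2) := by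
  simp [cylForm, mul_add]

theorem cylForm_screw (a b e m φ : ℝ) (p v : E3) :
    cylForm a b e (screw m φ p) (rotation φ v) = cylForm a b e p v := by
  have h := Real.sin_sq_add_cos_sq φ
  simp only [cylForm_apply, rotation_apply, screw, Matrix.cons_val_zero,
    Matrix.cons_val_one, Matrix.cons_val]
  linear_combination (b * (p 1 * v 2 - p 2 * v 1) + e * (p 1 * v 1 + p 2 * v 2)) * h

/-- The kernel of `cylForm`. -/
def cylPlane (a b e : ℝ) (p : E3) : Submodule ℝ E3 :=
  LinearMap.ker (cylForm a b e p : E3 →ₗ[ℝ] ℝ)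

theorem mem_cylPlane {a b e : ℝ} {p v : E3} : v ∈ cylPlane a b e p ↔ cylForm a b e p v = 0 :=
  Iff.rfl

theorem rotPlane_eq_cylPlane {h₁ h₂ : ℝ → ℝ} {a b : ℝ} {p : E3} (ha : h₁ (radius p) = a)
    (hb : h₂ (radius p) = sqRadius p * b) : rotPlane h₁ h₂ p = cylPlane a b 0 p := by
  unfold rotPlane cylPlane
  congr 2
  ext v
  rw [cylForm_apply]
  simp only [rotForm, ha, hb, radius_sq]
  by_cases h : sqRadius p = 0
  · obtain ⟨h1, h2⟩ := radius_eq_zero'.1 (sqRadius_eq_zero.1 h)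
    simp [h1, h2]
  · simp [mul_div_cancel_left₀ _ h]

theorem stdPlane_eq_cylPlane (p : E3) : stdPlane p = cylPlane 1 1 0 p :=
  rotPlane_eq_cylPlane rfl (by rw [radius_sq, mul_one])

theorem contDiff_cylForm_aux :
    ContDiff ℝ ∞ fun x : (ℝ × ℝ × ℝ) × E3 => cylForm x.1.1 x.1.2.1 x.1.2.2 x.2 := by
  have h (i : Fin 3) : ContDiff ℝ ∞ fun x : (ℝ × ℝ × ℝ) × E3 => x.2 i :=
    (contDiff_coord i).comp contDiff_snd
  unfold cylForm
  have := h 1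
  have := h 2
  fun_prop

theorem contDiffAt_cylForm {Y : Type*} [NormedAddCommGroup Y] [NormedSpace ℝ Y]
    {a b e : Y → ℝ} {f : Y → E3} {y : Y} (ha : ContDiffAt ℝ ∞ a y) (hb : ContDiffAt ℝ ∞ b y)
    (he : ContDiffAt ℝ ∞ e y) (hf : ContDiffAt ℝ ∞ f y) :
    ContDiffAt ℝ ∞ (fun y => cylForm (a y) (b y) (e y) (f y)) y :=
  contDiff_cylForm_aux.contDiffAt.comp y ((ha.prodMk (hb.prodMk he)).prodMk hf)

theorem cylForm_ne_zero {a b e : ℝ} {p : E3} (h : a ≠ 0 ∨ ((b ≠ 0 ∨ e ≠ 0) ∧ sqRadius p ≠ 0)) :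
    cylForm a b e p ≠ 0 := by
  intro h0
  have h1 (v : E3) : cylForm a b e p v = 0 := by rw [h0]; rfl
  simp only [cylForm_apply] at h1
  have e0 := h1 !₂[1, 0, 0]
  have e1 := h1 !₂[0, -p 2, p 1]
  have e2 := h1 !₂[0, p 1, p 2]
  simp at e0 e1 e2
  rcases h with h | ⟨h | h, h'⟩
  · exact h e0
  · refine mul_ne_zero h h' ?_
    unfold sqRadius
    linear_combination e1
  · refine mul_ne_zero h h' ?_
    unfold sqRadius
    linear_combination e2

/-- The plane field of `A(r²) dz + B(r²) r² dθ` is a contact structure where the curve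
`(A(s), s B(s))` turns. -/
theorem isContactAt_cylPlane {A B : ℝ → ℝ} (hA : ContDiff ℝ ∞ A) (hB : ContDiff ℝ ∞ B) {p : E3}
    (h : A (sqRadius p) * B (sqRadius p) + sqRadius p *
      (A (sqRadius p) * deriv B (sqRadius p) - deriv A (sqRadius p) * B (sqRadius p)) ≠ 0) :
    IsContactAt (fun q => cylPlane (A (sqRadius q)) (B (sqRadius q)) 0 q) p := by
  set α : E3 → E3 →L[ℝ] ℝ := fun q => cylForm (A (sqRadius q)) (B (sqRadius q)) 0 q with hα
  have hsq := contDiff_sqRadius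
  have hsm : ContDiff ℝ ∞ α := by
    rw [contDiff_iff_contDiffAt]
    intro q
    exact contDiffAt_cylForm (hA.comp hsq).contDiffAt (hB.comp hsq).contDiffAt
      contDiffAt_const contDiffAt_id
  have hα0 : α p ≠ 0 := by
    refine cylForm_ne_zero ?_
    by_contra! hc
    obtain ⟨h1, h2⟩ := hc
    rcases eq_or_ne (sqRadius p) 0 with h3 | h3
    · rw [h1, h3] at h; simp at h
    · have : B (sqRadius p) = 0 := by
        by_contra h4; exact h3 (h2 (Or.inl h4))
      rw [h1, this] at h; simp at h
  have hd (v w : E3) : dForm α p v w =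
      deriv A (sqRadius p) * (fderiv ℝ sqRadius p v * w 0 - fderiv ℝ sqRadius p w * v 0) +
      (2 * B (sqRadius p) + 2 * sqRadius p * deriv B (sqRadius p)) *
        (v 1 * w 2 - v 2 * w 1) := by
    have key (v w : E3) : fderiv ℝ α p v w =
        deriv A (sqRadius p) * fderiv ℝ sqRadius p v * w 0 +
        deriv B (sqRadius p) * fderiv ℝ sqRadius p v * (p 1 * w 2 - p 2 * w 1) +
        B (sqRadius p) * (v 1 * w 2 - v 2 * w 1) := by
      have hs := (hsq.differentiable (by simp) p).hasFDerivAt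
      have hA' : HasFDerivAt (fun q => A (sqRadius q))
          (deriv A (sqRadius p) • fderiv ℝ sqRadius p) p :=
        (hA.differentiable (by simp) _).hasDerivAt.comp_hasFDerivAt p hs
      have hB' : HasFDerivAt (fun q => B (sqRadius q))
          (deriv B (sqRadius p) • fderiv ℝ sqRadius p) p :=
        (hB.differentiable (by simp) _).hasDerivAt.comp_hasFDerivAt p hs
      have h1 : HasFDerivAt (fun q => α q w) ((ContinuousLinearMap.apply ℝ ℝ w).comp
          (fderiv ℝ α p)) p :=
        (ContinuousLinearMap.apply ℝ ℝ w).hasFDerivAt.comp p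
          (hsm.differentiable (by simp) p).hasFDerivAt
      have h2 := (hA'.mul_const (w 0)).add (hB'.mul (((hasFDerivAt_coord 1 p).mul_const (w 2)).sub
        ((hasFDerivAt_coord 2 p).mul_const (w 1))))
      have e : (fun q => α q w) = fun q => A (sqRadius q) * w 0 +
          B (sqRadius q) * (q 1 * w 2 - q 2 * w 1) := by
        ext q; simp [hα, cylForm_apply]
      rw [e] at h1
      have := congrArg (fun L => L v) (h1.unique h2)
      simp at this
      rw [this]
      ring
    unfold dForm
    rw [key v w, key w v, fderiv_sqRadius, fderiv_sqRadius, sqRadius]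
    ring
  refine ⟨α, ⟨hsm.contDiffAt, ?_⟩, ?_⟩
  · filter_upwards [hsm.continuous.continuousAt.eventually_ne hα0] with q hq
    exact ⟨hq, rfl⟩
  · intro v hv w hw hl h0
    rw [hd, fderiv_sqRadius, fderiv_sqRadius] at h0
    rw [mem_cylPlane, cylForm_apply] at hv hw
    rw [LinearIndependent.pair_iff] at hl
    set a := A (sqRadius p)
    set b := B (sqRadius p)
    set a' := deriv A (sqRadius p)
    set b' := deriv B (sqRadius p)
    have hs : sqRadius p = p 1 ^ 2 + p 2 ^ 2 := rfl
    rw [hs] at h h0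
    -- The cross product of `v` and `w` is parallel to the covector `α p`, and `dα` pairs with the
    -- latter to twice the quantity in `h`.
    have c0 : v 1 * w 2 - v 2 * w 1 = 0 := by
      refine (mul_eq_zero.1 ?_).resolve_left h
      linear_combination a * h0 / 2 + (a' * p 1 * w 1 + a' * p 2 * w 2) * hv -
        (a' * p 1 * v 1 + a' * p 2 * v 2) * hw
    have c1 : v 2 * w 0 - v 0 * w 2 = 0 := by
      refine (mul_eq_zero.1 ?_).resolve_left h
      linear_combination (-b * p 2) * h0 / 2 -
        ((b + (p 1 ^ 2 + p 2 ^ 2) * b') * w 2 + a' * p 1 * w 0) * hv +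
        ((b + (p 1 ^ 2 + p 2 ^ 2) * b') * v 2 + a' * p 1 * v 0) * hw
    have c2 : v 0 * w 1 - v 1 * w 0 = 0 := by
      refine (mul_eq_zero.1 ?_).resolve_left h
      linear_combination (b * p 1) * h0 / 2 +
        ((b + (p 1 ^ 2 + p 2 ^ 2) * b') * w 1 - a' * p 2 * w 0) * hv -
        ((b + (p 1 ^ 2 + p 2 ^ 2) * b') * v 1 - a' * p 2 * v 0) * hw
    have hz (i : Fin 3) : v i = 0 := by
      have : w i • v + (-v i) • w = 0 := by
        apply E3.ext <;> fin_cases i <;> simp <;> linarith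
      simpa using (hl _ _ this).2
    have hv0 : v = 0 := by ext i; exact hz i
    have := (hl 1 0 (by simp [hv0])).1
    norm_num at this

/-! ### The quotient of the disc by rotations -/

/-- The quotient map `(z, r, θ) ↦ (z, r, n θ)`. -/
def powMap (n : ℕ) (p : E3) : E3 :=
  !₂[p 0, (radius p ^ (n - 1))⁻¹ * (cxCoord p ^ n).re, (radius p ^ (n - 1))⁻¹ * (cxCoord p ^ n).im]

theorem powMap_zero_apply (n : ℕ) (p : E3) : powMap n p 0 = p 0 := rfl

theorem cxCoord_powMap (n : ℕ) (p : E3) :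
    cxCoord (powMap n p) = ((radius p ^ (n - 1))⁻¹ : ℝ) * cxCoord p ^ n := by
  rw [cxCoord_apply]
  apply Complex.ext
  · rw [Complex.re_ofReal_mul]; rfl
  · rw [Complex.im_ofReal_mul]; rfl

theorem radius_powMap {n : ℕ} (hn : n ≠ 0) (p : E3) : radius (powMap n p) = radius p := by
  rw [← norm_cxCoord, cxCoord_powMap, norm_mul, norm_pow, norm_cxCoord, Complex.norm_real,
    norm_inv, norm_pow, Real.norm_of_nonneg (radius_nonneg p)]
  rcases eq_or_ne (radius p) 0 with h | h
  · simp [h, hn]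
  · obtain ⟨k, rfl⟩ := Nat.exists_eq_succ_of_ne_zero hn
    simp only [Nat.succ_eq_add_one, Nat.add_sub_cancel, pow_succ]
    field_simp

theorem sqRadius_powMap {n : ℕ} (hn : n ≠ 0) (p : E3) : sqRadius (powMap n p) = sqRadius p := by
  rw [← radius_sq, radius_powMap hn, radius_sq]

theorem cxCoord_rootPoint (n : ℕ) (s : ℝ) (q : E3) :
    cxCoord (rootPoint n s q) =
      (s * radius q : ℝ) * Complex.exp ((Complex.arg (cxCoord q) / n : ℝ) * Complex.I) := by
  rw [cxCoord_apply, cxCoord_apply]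
  unfold rootPoint
  generalize Complex.arg ⟨q 1, q 2⟩ / n = φ
  rw [Complex.exp_mul_I]
  apply Complex.ext
  · rw [Complex.re_ofReal_mul]; simp [Complex.cos_ofReal_re]
  · rw [Complex.im_ofReal_mul]; simp [Complex.sin_ofReal_re]

theorem rootPoint_zero_apply (n : ℕ) (s : ℝ) (q : E3) : rootPoint n s q 0 = q 0 := rfl

theorem radius_rootPoint (n : ℕ) {s : ℝ} (hs : 0 ≤ s) (q : E3) :
    radius (rootPoint n s q) = s * radius q := by
  rw [← norm_cxCoord, cxCoord_rootPoint, norm_mul, Complex.norm_exp_ofReal_mul_I, mul_one,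
    Complex.norm_real, Real.norm_of_nonneg (mul_nonneg hs (radius_nonneg q))]

theorem powMap_rootPoint {n : ℕ} (hn : n ≠ 0) (q : E3) : powMap n (rootPoint n 1 q) = q := by
  refine ext_cxCoord rfl ?_
  rw [cxCoord_powMap, radius_rootPoint n zero_le_one, cxCoord_rootPoint, one_mul, mul_pow,
    ← Complex.exp_nat_mul, ← mul_assoc, ← Complex.ofReal_pow, ← Complex.ofReal_mul]
  have e1 : (radius q ^ (n - 1))⁻¹ * radius q ^ n = ‖cxCoord q‖ := by
    rw [norm_cxCoord]
    rcases eq_or_ne (radius q) 0 with h | h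
    · simp [h, hn]
    · obtain ⟨k, rfl⟩ := Nat.exists_eq_succ_of_ne_zero hn
      simp only [Nat.succ_eq_add_one, Nat.add_sub_cancel, pow_succ]
      field_simp
  have e2 : (n : ℂ) * ((Complex.arg (cxCoord q) / n : ℝ) * Complex.I) =
      Complex.arg (cxCoord q) * Complex.I := by
    push_cast
    field_simp
  rw [e1, e2, Complex.norm_mul_exp_arg_mul_I]

theorem powMap_screw {n : ℕ} (hn : n ≠ 0) (m : ℝ) (k : ℕ) (p : E3) :
    powMap n (screw m (2 * Real.pi * k / n) p) = screw m 0 (powMap n p) := by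
  apply ext_cxCoord
  · simp only [powMap_zero_apply, screw_zero_apply]
  · rw [cxCoord_powMap, radius_screw, cxCoord_screw, cxCoord_screw, cxCoord_powMap, mul_pow,
      ← Complex.exp_nat_mul]
    have : (n : ℂ) * (((2 * Real.pi * k / n : ℝ) : ℂ) * Complex.I) =
        k * (2 * Real.pi * Complex.I) := by
      push_cast
      field_simp
    rw [this, Complex.exp_nat_mul_two_pi_mul_I]
    simp

/-- The fibres of the quotient map are orbits of the rotation group. -/
theorem exists_screw_of_powMap_eq {n : ℕ} (hn : n ≠ 0) {p q : E3} (h : powMap n p = powMap n q) :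
    ∃ k : ℕ, q = screw 0 (2 * Real.pi * k / n) p := by
  have h0 : p 0 = q 0 := by rw [← powMap_zero_apply n, h, powMap_zero_apply]
  have hr : radius p = radius q := by rw [← radius_powMap hn, h, radius_powMap hn]
  have hc := congrArg cxCoord h
  rw [cxCoord_powMap, cxCoord_powMap, hr] at hc
  rcases eq_or_ne (radius q) 0 with h1 | h1
  · refine ⟨0, ext_cxCoord (by simp [screw_zero_apply, h0]) ?_⟩
    rw [cxCoord_screw, radius_eq_zero.1 h1, radius_eq_zero.1 (hr.trans h1), mul_zero]
  · have hp : cxCoord p ≠ 0 := fun h2 => h1 (hr ▸ radius_eq_zero.2 h2)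
    have hc' : cxCoord p ^ n = cxCoord q ^ n :=
      mul_left_cancel₀ (by simpa using fun h3 => absurd h3 h1) hc
    have h1n : (cxCoord q / cxCoord p) ^ n = 1 := by
      rw [div_pow, hc', div_self]
      rw [← hc']; exact pow_ne_zero _ hp
    have : NeZero n := ⟨hn⟩
    obtain ⟨k, -, hk⟩ := (Complex.isPrimitiveRoot_exp n hn).eq_pow_of_pow_eq_one h1n
    refine ⟨k, ext_cxCoord (by simp [screw_zero_apply, h0]) ?_⟩
    rw [cxCoord_screw, (div_eq_iff hp).1 hk.symm, ← Complex.exp_nat_mul]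
    congr 2
    push_cast
    ring

/-- A map that preserves `z` and `r` is continuous at the points of the axis. -/
theorem continuousAt_of_radius_eq {f : E3 → E3} (h0 : ∀ q, f q 0 = q 0)
    (h : ∀ q, radius (f q) = radius q) {p : E3} (hp : radius p = 0) : ContinuousAt f p := by
  have hr : Tendsto radius (𝓝 p) (𝓝 0) := hp ▸ continuous_radius.continuousAt
  obtain ⟨h1, h2⟩ := radius_eq_zero'.1 ((h p).trans hp)
  have e1 (q : E3) : ‖f q 1‖ ≤ radius q := by
    rw [← h, ← norm_cxCoord, cxCoord_apply]
    exact Complex.abs_re_le_norm ⟨f q 1, f q 2⟩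
  have e2 (q : E3) : ‖f q 2‖ ≤ radius q := by
    rw [← h, ← norm_cxCoord, cxCoord_apply]
    exact Complex.abs_im_le_norm ⟨f q 1, f q 2⟩
  have hc : ContinuousAt (fun q i => f q i) p := by
    rw [continuousAt_pi]
    intro i
    fin_cases i
    · simp only [Fin.zero_eta, h0]
      exact (contDiff_coord 0).continuous.continuousAt
    · change Tendsto _ _ (𝓝 (f p 1))
      rw [h1]
      exact squeeze_zero_norm e1 hr
    · change Tendsto _ _ (𝓝 (f p 2))
      rw [h2]
      exact squeeze_zero_norm e2 hr
  exact (PiLp.continuous_toLp 2 _).continuousAt.comp hc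

theorem contDiffAt_powMap (n : ℕ) {p : E3} (hp : radius p ≠ 0) : ContDiffAt ℝ ∞ (powMap n) p := by
  have hs : ContDiffAt ℝ ∞ radius p := by
    refine ContDiffAt.sqrt contDiff_sqRadius.contDiffAt ?_
    exact fun h => hp (sqRadius_eq_zero.1 h)
  have hr : ContDiffAt ℝ ∞ (fun p => (radius p ^ (n - 1))⁻¹) p :=
    (hs.pow _).inv (pow_ne_zero _ hp)
  have hw : ContDiffAt ℝ ∞ (fun p => cxCoord p ^ n) p := (cxCoord.contDiff.pow n).contDiffAt
  rw [contDiffAt_piLp]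
  intro i
  fin_cases i
  · exact (contDiff_coord 0).contDiffAt
  · exact hr.mul (Complex.reCLM.contDiff.contDiffAt.comp p hw)
  · exact hr.mul (Complex.imCLM.contDiff.contDiffAt.comp p hw)

theorem continuous_powMap {n : ℕ} (hn : n ≠ 0) : Continuous (powMap n) := by
  rw [continuous_iff_continuousAt]
  intro p
  by_cases hp : radius p = 0
  · exact continuousAt_of_radius_eq (powMap_zero_apply n) (radius_powMap hn) hp
  · exact (contDiffAt_powMap n hp).continuousAt

/-- The quotient map multiplies `r² dθ` by `n` and preserves `dz` and `r dr`. -/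
theorem cylForm_powMap {n : ℕ} (hn : n ≠ 0) {p : E3} (hp : radius p ≠ 0) (a b e : ℝ) (v : E3) :
    cylForm a b e (powMap n p) (fderiv ℝ (powMap n) p v) = cylForm a (n * b) e p v := by
  have hF := contDiffAt_powMap n hp
  have hd : HasFDerivAt (powMap n) (fderiv ℝ (powMap n) p) p :=
    (hF.differentiableAt (by simp)).hasFDerivAt
  set D := fderiv ℝ (powMap n) p v with hD
  have d0 : D 0 = v 0 := by
    have h1 := (EuclideanSpace.proj (𝕜 := ℝ) (0 : Fin 3)).hasFDerivAt.comp p hd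
    have h2 := h1.unique (hasFDerivAt_coord 0 p)
    exact congrArg (fun L => L v) h2
  have dot : powMap n p 1 * D 1 + powMap n p 2 * D 2 = p 1 * v 1 + p 2 * v 2 := by
    have h1 := (contDiff_sqRadius.differentiable (by simp) (powMap n p)).hasFDerivAt.comp p hd
    have e : sqRadius ∘ powMap n = sqRadius := funext (sqRadius_powMap hn)
    rw [e] at h1
    have h2 := congrArg (fun L => L v)
      (h1.unique (contDiff_sqRadius.differentiable (by simp) p).hasFDerivAt)
    simp only [ContinuousLinearMap.comp_apply, fderiv_sqRadius] at h2
    linarith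
  have cross : powMap n p 1 * D 2 - powMap n p 2 * D 1 = n * (p 1 * v 2 - p 2 * v 1) := by
    have hs : ContDiffAt ℝ ∞ radius p := by
      refine ContDiffAt.sqrt contDiff_sqRadius.contDiffAt ?_
      exact fun h => hp (sqRadius_eq_zero.1 h)
    have hr : ContDiffAt ℝ ∞ (fun p => (radius p ^ (n - 1))⁻¹) p :=
      (hs.pow _).inv (pow_ne_zero _ hp)
    have h1 := cxCoord.hasFDerivAt.comp p hd
    have h2 := (hr.differentiableAt (by simp)).hasFDerivAt.smul
      (cxCoord.hasFDerivAt.pow (x := p) n)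
    have e : cxCoord ∘ powMap n = fun p => (radius p ^ (n - 1))⁻¹ • cxCoord p ^ n := by
      ext1 p
      rw [Function.comp_apply, cxCoord_powMap, Complex.real_smul]
    rw [e] at h1
    have h3 := congrArg (fun L => L v) (h1.unique h2)
    set g := (radius p ^ (n - 1))⁻¹ with hg
    set g' := fderiv ℝ (fun p => (radius p ^ (n - 1))⁻¹) p v
    have im (p v : E3) : p 1 * v 2 - p 2 * v 1 = ((starRingEnd ℂ) (cxCoord p) * cxCoord v).im := by
      rw [cxCoord_apply, cxCoord_apply]; simp; ring
    have h4 : cxCoord D = g * (n * cxCoord p ^ (n - 1) * cxCoord v) + g' * cxCoord p ^ n := by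
      simpa [hD, mul_assoc, mul_comm, mul_left_comm] using h3
    have hw : (starRingEnd ℂ) (cxCoord p) * cxCoord p = ((radius p ^ 2 : ℝ) : ℂ) := by
      rw [mul_comm, Complex.mul_conj, Complex.normSq_eq_norm_sq, norm_cxCoord]
    obtain ⟨k, rfl⟩ := Nat.exists_eq_succ_of_ne_zero hn
    simp only [Nat.succ_eq_add_one, Nat.add_sub_cancel] at *
    have hgr : g * g * (radius p ^ 2) ^ k = 1 := by
      rw [hg]; field_simp; ring
    have h5 : (starRingEnd ℂ) (cxCoord (powMap (k + 1) p)) * cxCoord D =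
        ((k + 1 : ℕ) : ℝ) * ((starRingEnd ℂ) (cxCoord p) * cxCoord v) +
          ((g * g' * (radius p ^ 2) ^ (k + 1) : ℝ) : ℂ) := by
      have hgr' : ((g : ℂ) * g * ((radius p ^ 2 : ℝ) : ℂ) ^ k) = 1 := by exact_mod_cast hgr
      rw [h4, cxCoord_powMap, Nat.add_sub_cancel, ← hg, map_mul, map_pow, Complex.conj_ofReal]
      rw [Complex.ofReal_mul, Complex.ofReal_pow _ (k + 1), Complex.ofReal_mul, ← hw]
      rw [← hw] at hgr'
      push_cast
      linear_combination ((k + 1 : ℂ) * ((starRingEnd ℂ) (cxCoord p) * cxCoord v)) * hgr'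
    rw [im, im, h5, Complex.add_im, Complex.ofReal_im, Complex.im_ofReal_mul, add_zero]
  rw [cylForm_apply, cylForm_apply, d0, dot, cross]
  ring

theorem injective_fderiv_powMap {n : ℕ} (hn : n ≠ 0) {p : E3} (hp : radius p ≠ 0) :
    Function.Injective (fderiv ℝ (powMap n) p) := by
  rw [injective_iff_map_eq_zero]
  intro v hv
  have key (a b e : ℝ) : cylForm a (n * b) e p v = 0 := by
    rw [← cylForm_powMap hn hp, hv, map_zero]
  simp only [cylForm_apply] at key
  have h0 : sqRadius p ≠ 0 := fun h => hp (sqRadius_eq_zero.1 h)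
  have hn' : (n : ℝ) ≠ 0 := by exact_mod_cast hn
  have e0 := key 1 0 0
  have e1 := key 0 (n : ℝ)⁻¹ 0
  have e2 := key 0 0 1
  rw [mul_inv_cancel₀ hn'] at e1
  unfold sqRadius at h0
  apply E3.ext
  · simpa using e0
  · refine (mul_eq_zero.1 ?_).resolve_left h0
    linear_combination p 1 * e2 - p 2 * e1
  · refine (mul_eq_zero.1 ?_).resolve_left h0
    linear_combination p 2 * e2 + p 1 * e1

/-- At points of the axis `rootPoint` has no jump. -/
theorem continuousAt_rootPoint {n : ℕ} {q : E3} (hq : radius q = 0) :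
    ContinuousAt (rootPoint n 1) q :=
  continuousAt_of_radius_eq (rootPoint_zero_apply n 1)
    (fun p => by rw [radius_rootPoint n zero_le_one, one_mul]) hq

/-- Dilation of the disc. -/
def dilation (s : ℝ) : E3 →L[ℝ] E3 :=
  LinearMap.toContinuousLinearMap
    { toFun := fun p => !₂[p 0, s * p 1, s * p 2]
      map_add' := fun p q => by apply E3.ext <;> simp <;> ring
      map_smul' := fun c p => by apply E3.ext <;> simp <;> ring }

theorem dilation_apply (s : ℝ) (p : E3) : dilation s p = !₂[p 0, s * p 1, s * p 2] := rfl

theorem cxCoord_dilation (s : ℝ) (p : E3) : cxCoord (dilation s p) = s * cxCoord p := by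
  rw [cxCoord_apply, cxCoord_apply]
  apply Complex.ext <;> simp [dilation_apply]

theorem sqRadius_dilation (s : ℝ) (p : E3) : sqRadius (dilation s p) = s ^ 2 * sqRadius p := by
  simp [sqRadius, dilation_apply]
  ring

theorem radius_dilation {s : ℝ} (hs : 0 ≤ s) (p : E3) : radius (dilation s p) = s * radius p := by
  rw [← norm_cxCoord, cxCoord_dilation, norm_mul, norm_cxCoord, Complex.norm_real,
    Real.norm_of_nonneg hs]

theorem injective_dilation {s : ℝ} (hs : s ≠ 0) : Function.Injective (dilation s) := by
  intro p q h
  apply ext_cxCoord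
  · simpa [dilation_apply] using congrArg (fun v : E3 => v 0) h
  · have := congrArg cxCoord h
    rw [cxCoord_dilation, cxCoord_dilation] at this
    exact mul_left_cancel₀ (by exact_mod_cast hs) this

theorem rootPoint_eq (n : ℕ) {s : ℝ} (hs : 0 < s) (q : E3) :
    rootPoint n s q = rootPoint n 1 (dilation s q) := by
  apply ext_cxCoord
  · simp [rootPoint_zero_apply, dilation_apply]
  · rw [cxCoord_rootPoint, cxCoord_rootPoint, radius_dilation hs.le, one_mul, cxCoord_dilation,
      Complex.arg_real_mul _ hs]

theorem cylForm_dilation (a b e s : ℝ) (p v : E3) :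
    cylForm a b e (dilation s p) (dilation s v) = cylForm a (s ^ 2 * b) (s ^ 2 * e) p v := by
  simp [cylForm_apply, dilation_apply]
  ring

theorem comap_cylPlane_dilation (a b e s : ℝ) (p : E3) :
    (cylPlane a b e (dilation s p)).comap (dilation s : E3 →ₗ[ℝ] E3) =
      cylPlane a (s ^ 2 * b) (s ^ 2 * e) p := by
  ext v
  rw [Submodule.mem_comap, mem_cylPlane, mem_cylPlane, ← cylForm_dilation]
  rfl

theorem comap_cylPlane_powMap {n : ℕ} (hn : n ≠ 0) {p : E3} (hp : radius p ≠ 0) (a b e : ℝ) :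
    (cylPlane a b e (powMap n p)).comap (fderiv ℝ (powMap n) p : E3 →ₗ[ℝ] E3) =
      cylPlane a (n * b) e p := by
  ext v
  rw [Submodule.mem_comap, mem_cylPlane, mem_cylPlane, ← cylForm_powMap hn hp]
  rfl

/-! ### The profile of a full Lutz twist -/

/-- The angle by which the twist has turned the contact planes at squared radius `s`; it grows from
`0` to `2π` for `a ≤ s ≤ b`. -/
def twistAngle (a b s : ℝ) : ℝ := 2 * Real.pi * Real.smoothTransition ((s - a) / (b - a))

/-- The coefficient of `dz`: the vector `(1, s)` is rotated by `twistAngle`. -/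
def twistA (a b s : ℝ) : ℝ :=
  Real.cos (twistAngle a b s) - s * Real.sin (twistAngle a b s)

/-- The coefficient of `r² dθ`. -/
def twistB (a b s : ℝ) : ℝ :=
  Real.cos (twistAngle a b s) + Real.sin (twistAngle a b s) / s

section

variable {a b : ℝ}

theorem contDiff_twistAngle : ContDiff ℝ ∞ (twistAngle a b) := by
  unfold twistAngle
  exact contDiff_const.mul (Real.smoothTransition.contDiff.comp
    ((contDiff_id.sub contDiff_const).div_const _))

theorem monotone_twistAngle (h : a < b) : Monotone (twistAngle a b) := by
  intro s t hst
  unfold twistAngle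
  have : 0 < b - a := sub_pos.2 h
  have := Real.smoothTransition.monotone
    (div_le_div_of_nonneg_right (sub_le_sub_right hst a) this.le)
  have := Real.pi_pos
  gcongr

theorem deriv_twistAngle_nonneg (h : a < b) (s : ℝ) : 0 ≤ deriv (twistAngle a b) s :=
  (monotone_twistAngle h).deriv_nonneg

theorem twistAngle_of_le (h : a < b) {s : ℝ} (hs : s ≤ a) : twistAngle a b s = 0 := by
  rw [twistAngle, Real.smoothTransition.zero_of_nonpos, mul_zero]
  exact div_nonpos_of_nonpos_of_nonneg (by linarith) (by linarith)

theorem twistAngle_of_ge (h : a < b) {s : ℝ} (hs : b ≤ s) : twistAngle a b s = 2 * Real.pi := by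
  rw [twistAngle, Real.smoothTransition.one_of_one_le, mul_one]
  rw [one_le_div (by linarith)]
  linarith

theorem twist_of_notMem (h : a < b) {s : ℝ} (hs : s ∉ Ioo a b) :
    twistA a b s = 1 ∧ twistB a b s = 1 := by
  rcases le_or_gt s a with h1 | h1
  · simp [twistA, twistB, twistAngle_of_le h h1]
  · have h2 : b ≤ s := by
      by_contra! h3
      exact hs ⟨h1, h3⟩
    simp [twistA, twistB, twistAngle_of_ge h h2]

theorem contDiff_twistA : ContDiff ℝ ∞ (twistA a b) := by
  unfold twistA
  exact contDiff_twistAngle.cos.sub (contDiff_id.mul contDiff_twistAngle.sin)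

theorem mul_twistB (ha : 0 < a) (h : a < b) (s : ℝ) :
    s * twistB a b s = s * Real.cos (twistAngle a b s) + Real.sin (twistAngle a b s) := by
  rcases eq_or_ne s 0 with rfl | h0
  · simp [twistAngle_of_le h ha.le]
  · unfold twistB
    field_simp

theorem contDiff_twistB (ha : 0 < a) (h : a < b) : ContDiff ℝ ∞ (twistB a b) := by
  rw [contDiff_iff_contDiffAt]
  intro s
  rcases lt_or_ge s a with h1 | h1
  · refine (contDiffAt_const (c := (1 : ℝ))).congr_of_eventuallyEq ?_
    filter_upwards [Iio_mem_nhds h1] with t ht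
    exact (twist_of_notMem h fun h2 => absurd h2.1 (not_lt.2 (mem_Iio.1 ht).le)).2
  · unfold twistB
    exact contDiff_twistAngle.cos.contDiffAt.add
      (contDiff_twistAngle.sin.contDiffAt.div contDiffAt_id (by simp; linarith))

/-- The curve `(A(s), s B(s))` turns counterclockwise. -/
theorem twist_turning (ha : 0 < a) (h : a < b) (s : ℝ) :
    twistA a b s * twistB a b s +
      s * (twistA a b s * deriv (twistB a b) s - deriv (twistA a b) s * twistB a b s) =
      1 + deriv (twistAngle a b) s * (1 + s ^ 2) := by
  have hψ := (contDiff_twistAngle (a := a) (b := b)).differentiable (by simp) s |>.hasDerivAt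
  have hA : HasDerivAt (twistA a b) _ s := hψ.cos.sub ((hasDerivAt_id s).mul hψ.sin)
  have hB := ((contDiff_twistB ha h).differentiable (by simp) s).hasDerivAt
  have hsB : HasDerivAt (fun s => s * twistB a b s) _ s := (hasDerivAt_id s).mul hB
  have hsB' := ((hasDerivAt_id s).mul hψ.cos).add hψ.sin
  have e0 : (fun s => s * twistB a b s) = _ := funext (mul_twistB ha h)
  rw [e0] at hsB
  have e := hsB.unique hsB'
  have e2 := mul_twistB ha h s
  have cs := Real.sin_sq_add_cos_sq (twistAngle a b s)
  rw [hA.deriv]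
  simp only [id_eq, one_mul] at e ⊢
  generalize deriv (twistAngle a b) s = ψ' at *
  generalize deriv (twistB a b) s = B' at *
  have eA : twistA a b s = Real.cos (twistAngle a b s) - s * Real.sin (twistAngle a b s) := rfl
  rw [eA]
  generalize twistB a b s = B at *
  generalize Real.cos (twistAngle a b s) = c at *
  generalize Real.sin (twistAngle a b s) = σ at *
  linear_combination (c - s * σ) * e + (σ * ψ' + (σ + s * (c * ψ'))) * e2 + (1 + ψ' * (1 + s^2)) * cs

theorem twist_turning_ne_zero (ha : 0 < a) (h : a < b) (s : ℝ) :
    twistA a b s * twistB a b s +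
      s * (twistA a b s * deriv (twistB a b) s - deriv (twistA a b) s * twistB a b s) ≠ 0 := by
  rw [twist_turning ha h]
  have := deriv_twistAngle_nonneg h s
  positivity

theorem twistA_sq_add (ha : 0 < a) (h : a < b) (s : ℝ) :
    twistA a b s ^ 2 + (s * twistB a b s) ^ 2 = 1 + s ^ 2 := by
  rw [mul_twistB ha h, twistA]
  linear_combination (1 + s ^ 2) * Real.sin_sq_add_cos_sq (twistAngle a b s)

/-- The argument of `(A(s), s B(s))`. -/
def twistArg (a b s : ℝ) : ℝ := Real.arctan s + twistAngle a b s

theorem strictMono_twistArg (h : a < b) : StrictMono (twistArg a b) :=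
  Real.arctan_strictMono.add_monotone (monotone_twistAngle h)

theorem mul_twistB_eq_zero (ha : 0 < a) (h : a < b) (s : ℝ) :
    s * twistB a b s = 0 ↔ Real.sin (twistArg a b s) = 0 := by
  have hc := Real.cos_arctan_pos s
  have : Real.sin (twistArg a b s) = Real.cos (Real.arctan s) * (s * twistB a b s) := by
    rw [mul_twistB ha h, twistArg, Real.sin_add]
    have : Real.sin (Real.arctan s) = Real.cos (Real.arctan s) * s := by
      rw [mul_comm, ← Real.tan_mul_cos hc.ne', Real.tan_arctan]
    rw [this]; ring
  rw [this, mul_eq_zero]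
  simp [hc.ne']

/-- In `(0, ∞)` the coefficient `s B(s)` vanishes exactly when the argument is `π` or `2π`. -/
theorem exists_zeros (ha : 0 < a) (h : a < b) : ∃ s₁ s₂, a < s₁ ∧ s₁ < s₂ ∧ s₂ < b ∧
    ∀ s, 0 < s → (s * twistB a b s = 0 ↔ s = s₁ ∨ s = s₂) := by
  have hmono := strictMono_twistArg h
  have hcont : Continuous (twistArg a b) :=
    Real.continuous_arctan.add contDiff_twistAngle.continuous
  have hpi := Real.pi_pos
  have h0a : twistArg a b a < Real.pi := by
    rw [twistArg, twistAngle_of_le h le_rfl]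
    linarith [Real.arctan_lt_pi_div_two a]
  have hb : 2 * Real.pi < twistArg a b b := by
    rw [twistArg, twistAngle_of_ge h le_rfl]
    linarith [Real.arctan_pos.2 (ha.trans h)]
  obtain ⟨s₁, hs₁, e₁⟩ := intermediate_value_Ioo h.le hcont.continuousOn
    (⟨h0a, by linarith⟩ : Real.pi ∈ Ioo (twistArg a b a) (twistArg a b b))
  obtain ⟨s₂, hs₂, e₂⟩ := intermediate_value_Ioo h.le hcont.continuousOn
    (⟨by linarith, hb⟩ : 2 * Real.pi ∈ Ioo (twistArg a b a) (twistArg a b b))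
  refine ⟨s₁, s₂, hs₁.1, hmono.lt_iff_lt.1 (by rw [e₁, e₂]; linarith), hs₂.2, fun s hs => ?_⟩
  rw [mul_twistB_eq_zero ha h]
  constructor
  · intro hsin
    obtain ⟨k, hk⟩ := Real.sin_eq_zero_iff.1 hsin
    have hpos : 0 < twistArg a b s := by
      have := hmono hs
      rwa [twistArg, twistAngle_of_le h ha.le, Real.arctan_zero, add_zero] at this
    have hlt : twistArg a b s < 3 * Real.pi := by
      have h1 := Real.arctan_lt_pi_div_two s
      have h2 : twistAngle a b s ≤ 2 * Real.pi := by
        unfold twistAngle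
        nlinarith [Real.smoothTransition.le_one ((s - a) / (b - a))]
      unfold twistArg
      linarith
    have k1 : 0 < k := by
      have : (0 : ℝ) < k := by
        by_contra! hh; nlinarith
      exact_mod_cast this
    have k2 : k < 3 := by
      have : (k : ℝ) < 3 := by
        by_contra! hh; nlinarith
      exact_mod_cast this
    obtain rfl | rfl : k = 1 ∨ k = 2 := by omega
    · left; apply hmono.injective; rw [e₁, ← hk]; simp
    · right; apply hmono.injective; rw [e₂, ← hk]; simp
  · rintro (rfl | rfl)
    · rw [e₁, Real.sin_pi]
    · rw [e₂, Real.sin_two_pi]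

end

/-- The functions `h₁ = A(r²)` and `h₂ = r² B(r²)` are the profile of a full Lutz twist. -/
theorem isFullLutzProfile {a b R : ℝ} (ha : 0 < a) (h : a < b) (hR : 0 < R) (hb : b < R ^ 2) :
    IsFullLutzProfile R (fun r => twistA a b (r ^ 2)) (fun r => r ^ 2 * twistB a b (r ^ 2)) := by
  have hsq : ContDiff ℝ ∞ fun r : ℝ => r ^ 2 := contDiff_id.pow 2
  have hsb : Real.sqrt b < R := (Real.sqrt_lt' hR).2 hb
  have hsa : 0 < Real.sqrt a := Real.sqrt_pos.2 ha
  have hsab : Real.sqrt a < Real.sqrt b := Real.sqrt_lt_sqrt ha.le h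
  refine ⟨contDiff_twistA.comp hsq, hsq.mul ((contDiff_twistB ha h).comp hsq), ?_, ?_, ?_⟩
  · refine ⟨min (Real.sqrt a) (R - Real.sqrt b), lt_min hsa (by linarith),
      (min_le_left _ _).trans_lt (by linarith), ?_⟩
    intro r hr
    have : r ^ 2 ∉ Ioo a b := by
      rintro ⟨h1, h2⟩
      rcases hr with hr | hr
      · have : r ≤ Real.sqrt a := hr.2.trans (min_le_left _ _)
        have := pow_le_pow_left₀ hr.1 this 2
        rw [Real.sq_sqrt ha.le] at this
        linarith
      · have : Real.sqrt b ≤ r := by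
          have := min_le_right (Real.sqrt a) (R - Real.sqrt b)
          linarith [hr.1]
        have := pow_le_pow_left₀ (Real.sqrt_nonneg b) this 2
        rw [Real.sq_sqrt (ha.trans h).le] at this
        linarith
    obtain ⟨h1, h2⟩ := twist_of_notMem h this
    simp only [h1, h2, mul_one, and_self]
  · intro r hr
    have hA := ((contDiff_twistA (a := a) (b := b)).differentiable (by simp) (r ^ 2)).hasDerivAt
    have hB := ((contDiff_twistB ha h).differentiable (by simp) (r ^ 2)).hasDerivAt
    have hs : HasDerivAt (fun r : ℝ => r ^ 2) (2 * r) r := by simpa using hasDerivAt_pow 2 r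
    have hA' : HasDerivAt (fun r => twistA a b (r ^ 2)) _ r :=
      HasDerivAt.comp (h := fun r => r ^ 2) r hA hs
    have hB' : HasDerivAt (fun r => r ^ 2 * twistB a b (r ^ 2)) _ r :=
      hs.mul (HasDerivAt.comp (h := fun r => r ^ 2) r hB hs)
    rw [hA'.deriv, hB'.deriv]
    have := mul_ne_zero (mul_ne_zero two_ne_zero hr.1.ne') (twist_turning_ne_zero ha h (r ^ 2))
    convert this using 1
    ring
  · obtain ⟨s₁, s₂, h1, h2, h3, h4⟩ := exists_zeros ha h
    have hs1 : 0 < s₁ := ha.trans h1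
    have hs2 : 0 < s₂ := hs1.trans h2
    have : {r | r ∈ Ioo 0 R ∧ r ^ 2 * twistB a b (r ^ 2) = 0} =
        {Real.sqrt s₁, Real.sqrt s₂} := by
      ext r
      simp only [mem_ofPred_eq, mem_insert_iff, mem_singleton_iff]
      constructor
      · rintro ⟨hr, h0⟩
        rw [h4 _ (pow_pos hr.1 2)] at h0
        rcases h0 with h0 | h0
        · left; rw [← h0, Real.sqrt_sq hr.1.le]
        · right; rw [← h0, Real.sqrt_sq hr.1.le]
      · rintro (rfl | rfl)
        · refine ⟨⟨Real.sqrt_pos.2 hs1, (Real.sqrt_lt' hR).2 (by linarith)⟩, ?_⟩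
          rw [Real.sq_sqrt hs1.le, h4 _ hs1]
          exact Or.inl rfl
        · refine ⟨⟨Real.sqrt_pos.2 hs2, (Real.sqrt_lt' hR).2 (by linarith)⟩, ?_⟩
          rw [Real.sq_sqrt hs2.le, h4 _ hs2]
          exact Or.inr rfl
    rw [this, ncard_pair]
    exact (Real.sqrt_lt_sqrt hs1.le h2).ne

section

/-! ### Orbifold charts and tubes -/

variable {X : Type*} [TopologicalSpace X]

theorem OrbChart.map_nhds (c : OrbChart X) {u : E3} (hu : u ∈ c.dom) :
    map c.proj (𝓝 u) = 𝓝 (c.proj u) := by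
  refine le_antisymm ((c.proj_continuousOn u hu).continuousAt (c.isOpen_dom.mem_nhds hu)) ?_
  intro W hW
  obtain ⟨V, hV, hVo, huV⟩ := mem_nhds_iff.1 (inter_mem (mem_map.1 hW) (c.isOpen_dom.mem_nhds hu))
  refine mem_of_superset ((c.isOpen_image V (fun y hy => (hV hy).2) hVo).mem_nhds
    (mem_image_of_mem _ huV)) ?_
  rintro _ ⟨y, hy, rfl⟩
  exact (hV hy).1

theorem OrbChart.contDiffAt_act (c : OrbChart X) (g : c.G) {u : E3} (hu : u ∈ c.dom) :
    ContDiffAt ℝ ∞ (c.act g) u :=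
  (c.act_smooth g).contDiffAt (c.isOpen_dom.mem_nhds hu)

theorem OrbChart.act_inv (c : OrbChart X) (g : c.G) {u : E3} (hu : u ∈ c.dom) :
    c.act g⁻¹ (c.act g u) = u := by
  rw [← c.act_mul _ _ u hu, inv_mul_cancel, c.act_one u hu]

theorem OrbChart.isChartEmbedding_id (c : OrbChart X) : IsChartEmbedding id c c where
  mapsTo := mapsTo_id _
  smooth := contDiffOn_id
  injOn := injOn_id _
  det_ne_zero p _ := by simp [ContinuousLinearMap.det]
  proj_comp _ _ := rfl

theorem OrbChart.isChartEmbedding_act (c : OrbChart X) (g : c.G) :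
    IsChartEmbedding (c.act g) c c where
  mapsTo := c.act_mapsTo g
  smooth := c.act_smooth g
  injOn u hu v hv h := by rw [← c.act_inv g hu, h, c.act_inv g hv]
  det_ne_zero u hu h := by
    have h1 := ((c.contDiffAt_act g⁻¹ (c.act_mapsTo g hu)).differentiableAt (by simp)).hasFDerivAt.comp
      u ((c.contDiffAt_act g hu).differentiableAt (by simp)).hasFDerivAt
    have h2 : HasFDerivAt (c.act g⁻¹ ∘ c.act g) (ContinuousLinearMap.id ℝ E3) u :=
      (hasFDerivAt_id u).congr_of_eventuallyEq (by
        filter_upwards [c.isOpen_dom.mem_nhds hu] with y hy using c.act_inv g hy)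
    have h3 := congrArg ContinuousLinearMap.det (h1.unique h2)
    have h4 : (ContinuousLinearMap.id ℝ E3).det = 1 := by simp [ContinuousLinearMap.det]
    rw [h4, ContinuousLinearMap.det, ContinuousLinearMap.toLinearMap_comp, LinearMap.det_comp] at h3
    unfold ContinuousLinearMap.det at h
    rw [h, mul_zero] at h3
    exact zero_ne_one h3
  proj_comp := c.proj_act g

theorem IsChartEmbedding.contDiffAt {j : E3 → E3} {c d : OrbChart X} (h : IsChartEmbedding j c d)
    {p : E3} (hp : p ∈ c.dom) : ContDiffAt ℝ ∞ j p :=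
  h.smooth.contDiffAt (c.isOpen_dom.mem_nhds hp)

theorem IsChartEmbedding.germEquiv {j : E3 → E3} {c d : OrbChart X} (h : IsChartEmbedding j c d)
    {p : E3} (hp : p ∈ c.dom) (A : Submodule ℝ E3) :
    GermEquiv c.proj p (A.comap (fderiv ℝ j p : E3 →ₗ[ℝ] E3)) d.proj (j p) A :=
  ⟨j, h.contDiffAt hp, injective_of_det_ne_zero (h.det_ne_zero p hp), rfl,
    by filter_upwards [c.isOpen_dom.mem_nhds hp] with y hy using h.proj_comp y hy, rfl⟩

/-- The planes of an invariant field at points over the same point of `X` correspond to each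
other. -/
theorem OrbAtlas.IsInvariant.germEquiv {O : OrbAtlas X} {ζ : OrbChart X → E3 → Submodule ℝ E3}
    (hζ : O.IsInvariant ζ) {c d : OrbChart X} (hc : c ∈ O.charts) (hd : d ∈ O.charts) {u w : E3}
    (hu : u ∈ c.dom) (hw : w ∈ d.dom) (h : c.proj u = d.proj w) :
    GermEquiv c.proj u (ζ c u) d.proj w (ζ d w) := by
  have act (c : OrbChart X) (hc : c ∈ O.charts) {u v : E3} (hu : u ∈ c.dom) (hv : v ∈ c.dom)
      (h : c.proj u = c.proj v) : GermEquiv c.proj u (ζ c u) c.proj v (ζ c v) := by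
    obtain ⟨g, rfl⟩ := c.exists_act_eq u hu v hv h
    have := (c.isChartEmbedding_act g).germEquiv hu (ζ c (c.act g u))
    rw [← hζ c hc c hc c _ _ c.isChartEmbedding_id (c.isChartEmbedding_act g) u hu] at this
    simpa using this
  obtain ⟨e, j₁, j₂, ⟨p, hp, hpx⟩, h₁, h₂⟩ := O.compatible c hc d hd (c.proj u)
    ⟨mem_image_of_mem _ hu, h ▸ mem_image_of_mem _ hw⟩
  have g₁ := h₁.germEquiv hp (ζ c (j₁ p))
  have g₂ := h₂.germEquiv hp (ζ d (j₂ p))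
  rw [hζ c hc d hd e j₁ j₂ h₁ h₂ p hp] at g₁
  exact ((act c hc hu (h₁.mapsTo hp) (by rw [h₁.proj_comp p hp, hpx])).trans g₁.symm).trans
    (g₂.trans (act d hd (h₂.mapsTo hp) hw (by rw [h₂.proj_comp p hp, hpx, h])))

/-- A finite group action is free near a point with trivial stabilizer. -/
theorem OrbChart.isParam (c : OrbChart X) {u : E3} (hu : u ∈ c.dom)
    (h : ∀ g : c.G, c.act g u = u → g = 1) : IsParam c.proj u := by
  refine ⟨c.map_nhds hu, ?_⟩
  have key (g : c.G) : ∀ᶠ y in 𝓝 u ×ˢ 𝓝 u, c.act g y.1 = y.2 → g = 1 := by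
    by_cases hg : g = 1
    · exact Eventually.of_forall fun _ _ => hg
    · have hne : c.act g u ≠ u := fun h' => hg (h g h')
      have h1 : Tendsto (fun y : E3 × E3 => c.act g y.1) (𝓝 u ×ˢ 𝓝 u) (𝓝 (c.act g u)) :=
        (c.contDiffAt_act g hu).continuousAt.tendsto.comp tendsto_fst
      have h2 := (h1.prodMk_nhds (tendsto_snd (f := 𝓝 u) (g := 𝓝 u))).eventually
        ((isOpen_ne_fun continuous_fst continuous_snd).mem_nhds hne)
      filter_upwards [h2] with y hy hy'
      exact absurd hy' hy
  have hall := (eventually_all.2 key)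
  obtain ⟨W, hW, hW'⟩ := eventually_prod_self_iff (r := fun y z => ∀ g : c.G, c.act g y = z → g = 1)
    |>.1 hall
  refine ⟨W ∩ c.dom, inter_mem hW (c.isOpen_dom.mem_nhds hu), ?_⟩
  rintro y ⟨hy, hyd⟩ z ⟨hz, hzd⟩ hyz
  obtain ⟨g, hg⟩ := c.exists_act_eq y hyd z hzd hyz
  have := hW' y hy z hz g hg
  rw [← hg, this, c.act_one y hyd]

namespace Tube

variable {O : OrbAtlas X} (T : Tube O)

theorem n_ne_zero : T.n ≠ 0 := by have := T.two_le; omega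

theorem map_screw {p : E3} (hp : p ∈ solidTube T.R) (m : ℤ) (k : ℕ) :
    T.map (screw m (2 * Real.pi * k / T.n) p) = T.map p := by
  refine ((T.map_eq_iff p hp _ ?_).2 ⟨m, k, rfl⟩).symm
  rw [mem_solidTube, radius_screw]
  exact hp

/-- Two maps into the solid torus that agree in the quotient differ at each point, to first order in
each direction, by an element of the group: one element occurs infinitely often along a sequence of
points that converges to the given one. -/
theorem exists_screw {f g : E3 → E3} {p : E3} (hf : DifferentiableAt ℝ f p)
    (hg : DifferentiableAt ℝ g p) (hfp : f p ∈ solidTube T.R) (hgp : g p ∈ solidTube T.R)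
    (h : ∀ᶠ y in 𝓝 p, T.map (f y) = T.map (g y)) (v : E3) :
    ∃ m a : ℝ, g p = screw m a (f p) ∧ fderiv ℝ g p v = rotation a (fderiv ℝ f p v) := by
  set γ : ℝ → E3 := fun t => p + t • v with hγ
  have hγ' : HasDerivAt γ v 0 := by
    have := ((hasDerivAt_id (0 : ℝ)).smul_const v).const_add p
    rw [one_smul] at this
    exact this
  have γ0 : γ 0 = p := by simp [hγ]
  have hγc : Tendsto γ (𝓝[≠] 0) (𝓝 p) := by
    have := hγ'.continuousAt.tendsto
    rw [γ0] at this
    exact this.mono_left nhdsWithin_le_nhds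
  set S : Set (ℤ × ℕ) := Icc ⌊g p 0 - f p 0 - 1⌋ ⌈g p 0 - f p 0 + 1⌉ ×ˢ Iio T.n
  have hS : S.Finite := (finite_Icc _ _).prod (finite_Iio _)
  have hdc : ContinuousAt (fun y => g y 0 - f y 0) p :=
    ((contDiff_coord 0).continuous.continuousAt.comp hg.continuousAt).sub
      ((contDiff_coord 0).continuous.continuousAt.comp hf.continuousAt)
  have hev : ∀ᶠ t in 𝓝[≠] (0 : ℝ), ∃ x ∈ S,
      g (γ t) = screw x.1 (2 * Real.pi * x.2 / T.n) (f (γ t)) := by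
    have hb := hdc.eventually (Ioo_mem_nhds (sub_one_lt (g p 0 - f p 0)) (lt_add_one (g p 0 - f p 0)))
    filter_upwards [hγc.eventually h, hγc.eventually hb,
      hγc.eventually (hf.continuousAt.eventually ((isOpen_solidTube _).mem_nhds hfp)),
      hγc.eventually (hg.continuousAt.eventually ((isOpen_solidTube _).mem_nhds hgp))]
      with t h1 h2 h3 h4
    obtain ⟨m, k, hmk⟩ := (T.map_eq_iff _ h3 _ h4).1 h1
    refine ⟨(m, k % T.n), ⟨⟨?_, ?_⟩, Nat.mod_lt _ (Nat.pos_of_ne_zero T.n_ne_zero)⟩, ?_⟩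
    · have e : g (γ t) 0 - f (γ t) 0 = m := by rw [hmk, screw_zero_apply]; ring
      rw [e] at h2
      exact Int.cast_le (R := ℝ).1 ((Int.floor_le _).trans h2.1.le)
    · have e : g (γ t) 0 - f (γ t) 0 = m := by rw [hmk, screw_zero_apply]; ring
      rw [e] at h2
      exact Int.cast_le (R := ℝ).1 (h2.2.le.trans (Int.le_ceil _))
    · rw [hmk]
      apply ext_cxCoord
      · simp only [screw_zero_apply]
      · have hn : (T.n : ℂ) ≠ 0 := by exact_mod_cast T.n_ne_zero
        rw [cxCoord_screw, cxCoord_screw]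
        congr 1
        rw [Complex.exp_eq_exp_iff_exists_int]
        obtain ⟨d, hd⟩ : ∃ d, k / T.n = d := ⟨_, rfl⟩
        refine ⟨d, ?_⟩
        have : (k : ℂ) = (T.n : ℂ) * d + (k % T.n : ℕ) := by
          rw [← hd]
          exact_mod_cast (Nat.div_add_mod k T.n).symm
        push_cast
        rw [this]
        field_simp
        ring
  obtain ⟨x, hx⟩ : ∃ x : ℤ × ℕ, ∃ᶠ t in 𝓝[≠] (0 : ℝ),
      g (γ t) = screw x.1 (2 * Real.pi * x.2 / T.n) (f (γ t)) := by
    by_contra! hc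
    have : ∀ᶠ t in 𝓝[≠] (0 : ℝ), ∀ x ∈ S,
        ¬ g (γ t) = screw x.1 (2 * Real.pi * x.2 / T.n) (f (γ t)) :=
      (eventually_all_finite hS).2 fun x _ => hc x
    obtain ⟨t, ⟨x, hxS, hx⟩, ht⟩ := (hev.and this).exists
    exact ht x hxS hx
  refine ⟨(x.1 : ℤ), 2 * Real.pi * x.2 / T.n, ?_⟩
  set m : ℝ := ((x.1 : ℤ) : ℝ)
  set a : ℝ := 2 * Real.pi * x.2 / T.n
  have hd : HasDerivAt (fun t => g (γ t) - screw m a (f (γ t)))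
      (fderiv ℝ g p v - rotation a (fderiv ℝ f p v)) 0 := by
    have h1 : HasDerivAt (fun t => g (γ t)) (fderiv ℝ g p v) 0 :=
      HasFDerivAt.comp_hasDerivAt_of_eq 0 hg.hasFDerivAt hγ' γ0.symm
    have h2 : HasDerivAt (fun t => f (γ t)) (fderiv ℝ f p v) 0 :=
      HasFDerivAt.comp_hasDerivAt_of_eq 0 hf.hasFDerivAt hγ' γ0.symm
    exact h1.sub ((hasFDerivAt_screw m a _).comp_hasDerivAt 0 h2)
  have hx' : ∃ᶠ t in 𝓝[≠] (0 : ℝ), g (γ t) - screw m a (f (γ t)) = 0 :=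
    hx.mono fun t ht => sub_eq_zero.2 ht
  constructor
  · by_contra hne
    have h0 : g (γ 0) - screw m a (f (γ 0)) ≠ 0 := by rw [γ0]; exact sub_ne_zero.2 hne
    exact hx' ((hd.continuousAt.eventually_ne h0).filter_mono nhdsWithin_le_nhds)
  · by_contra hne
    exact hx' (hd.eventually_ne (sub_ne_zero.2 hne))

/-- A field of subspaces on Euclidean space is invariant under screw motions. -/
def _root_.CyclicOrbifold.ScrewInvariant (η : E3 → Submodule ℝ E3) : Prop :=
  ∀ m a p v, rotation a v ∈ η (screw m a p) ↔ v ∈ η p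

/-- A screw-invariant field has the same pullback under any two coordinate expressions of the same
map, so it describes a plane field on the quotient. -/
theorem comap_eq {η : E3 → Submodule ℝ E3} (hη : ScrewInvariant η) {f g : E3 → E3} {p : E3}
    (hf : DifferentiableAt ℝ f p) (hg : DifferentiableAt ℝ g p) (hfp : f p ∈ solidTube T.R)
    (hgp : g p ∈ solidTube T.R) (h : ∀ᶠ y in 𝓝 p, T.map (f y) = T.map (g y)) :
    (η (f p)).comap (fderiv ℝ f p : E3 →ₗ[ℝ] E3) =
      (η (g p)).comap (fderiv ℝ g p : E3 →ₗ[ℝ] E3) := by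
  ext v
  obtain ⟨m, a, h1, h2⟩ := T.exists_screw hf hg hfp hgp h v
  change fderiv ℝ f p v ∈ η (f p) ↔ fderiv ℝ g p v ∈ η (g p)
  rw [h1, h2, hη]

/-- The local smoothness of a tube, from the lifts to the charts. -/
theorem exists_germEquiv {p : E3} (hp : p ∈ solidTube T.R) {c : OrbChart X} (hc : c ∈ O.charts)
    {u : E3} (hu : u ∈ c.dom) (h : c.proj u = T.map p) :
    GermEquiv c.proj u ⊤ T.map p ⊤ := by
  obtain ⟨l, V, hpV, hV, rfl, hl⟩ := T.exists_lift p hp c hc u hu h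
  refine GermEquiv.symm ⟨l, hl.smooth.contDiffAt (hl.isOpen.mem_nhds hpV),
    injective_of_det_ne_zero (hl.det_ne_zero p hpV), rfl, ?_, by simp⟩
  filter_upwards [hl.isOpen.mem_nhds hpV] with y hy using hl.proj_comp y hy

/-- The same, carrying `ζ` to the standard contact structure. -/
theorem IsStandard.germEquiv {T : Tube O} {ζ : OrbChart X → E3 → Submodule ℝ E3}
    (hT : T.IsStandard ζ) {p : E3} (hp : p ∈ solidTube T.R) {c : OrbChart X} (hc : c ∈ O.charts)
    {u : E3} (hu : u ∈ c.dom) (h : c.proj u = T.map p) :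
    GermEquiv c.proj u (ζ c u) T.map p (stdPlane p) := by
  obtain ⟨l, V, hpV, hV, rfl, hl⟩ := T.exists_lift p hp c hc u hu h
  refine GermEquiv.symm ⟨l, hl.smooth.contDiffAt (hl.isOpen.mem_nhds hpV),
    injective_of_det_ne_zero (hl.det_ne_zero p hpV), rfl, ?_, (hT c hc l V hV hl p hpV).symm⟩
  filter_upwards [hl.isOpen.mem_nhds hpV] with y hy using hl.proj_comp y hy

theorem map_nhds {p : E3} (hp : p ∈ solidTube T.R) : Filter.map T.map (𝓝 p) = 𝓝 (T.map p) := by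
  obtain ⟨c, hc, u, hu, h⟩ := O.cover (T.map p)
  exact (T.exists_germEquiv hp hc hu h).symm.map_nhds (c.map_nhds hu)

theorem continuousOn_map : ContinuousOn T.map (solidTube T.R) := fun _ hp =>
  ContinuousAt.continuousWithinAt (T.map_nhds hp).le

theorem isOpen_image : IsOpen T.image := by
  rw [isOpen_iff_mem_nhds]
  rintro _ ⟨p, hp, rfl⟩
  rw [← T.map_nhds hp]
  exact image_mem_map ((isOpen_solidTube _).mem_nhds hp)

/-- Smaller closed tubes are closed: by periodicity in `z` they are images of compact cylinders. -/
theorem isClosed_image_radius_le [T2Space X] {r : ℝ} (hr : r < T.R) :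
    IsClosed (T.map '' {p | radius p ≤ r}) := by
  have hcpt : IsCompact {p : E3 | radius p ≤ r ∧ 0 ≤ p 0 ∧ p 0 ≤ 1} := by
    refine Metric.isCompact_of_isClosed_isBounded ?_ ?_
    · exact (isClosed_le continuous_radius continuous_const).inter
        ((isClosed_le continuous_const (contDiff_coord 0).continuous).inter
          (isClosed_le (contDiff_coord 0).continuous continuous_const))
    · refine (Metric.isBounded_closedBall (x := (0 : E3)) (r := Real.sqrt (1 + r ^ 2))).subset ?_
      rintro p ⟨h1, h2, h3⟩
      rw [mem_closedBall_zero_iff, EuclideanSpace.norm_eq]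
      refine Real.sqrt_le_sqrt ?_
      have h4 := pow_le_pow_left₀ (radius_nonneg p) h1 2
      rw [radius_sq, sqRadius] at h4
      simp only [Fin.sum_univ_three, Real.norm_eq_abs, sq_abs]
      nlinarith
  have heq : T.map '' {p | radius p ≤ r} = T.map '' {p : E3 | radius p ≤ r ∧ 0 ≤ p 0 ∧ p 0 ≤ 1} := by
    refine Subset.antisymm ?_ (image_mono fun p hp => hp.1)
    rintro _ ⟨p, hp, rfl⟩
    refine ⟨screw ((-⌊p 0⌋ : ℤ) : ℝ) (2 * Real.pi * (0 : ℕ) / T.n) p,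
      ⟨by rw [radius_screw]; exact hp, ?_, ?_⟩, T.map_screw (lt_of_le_of_lt hp hr) _ _⟩
    · rw [screw_zero_apply]; push_cast; linarith [Int.floor_le (p 0)]
    · rw [screw_zero_apply]; push_cast; linarith [Int.lt_floor_add_one (p 0)]
  rw [heq]
  exact (hcpt.image_of_continuousOn (T.continuousOn_map.mono
    fun p hp => lt_of_le_of_lt hp.1 hr)).isClosed

end Tube

end

section

/-! ### Changing an orbifold plane field inside a tube -/

variable {X : Type*} [TopologicalSpace X]

namespace Tube

variable {O : OrbAtlas X} (T : Tube O)

/-- The germ of `σ` at `u` expresses the orbifold chart `c` through the coordinates of the tube.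
Differentiability is required at `u` only. -/
def IsColift (c : OrbChart X) (u : E3) (σ : E3 → E3) : Prop :=
  DifferentiableAt ℝ σ u ∧ σ u ∈ solidTube T.R ∧ ∀ᶠ y in 𝓝 u, T.map (σ y) = c.proj y

open Classical in
/-- The family of plane fields that is given by `η` in the coordinates of the tube, and agrees with
`ζ` outside the tube. -/
def tubeField (η : E3 → Submodule ℝ E3) (ζ : OrbChart X → E3 → Submodule ℝ E3) (c : OrbChart X)
    (u : E3) : Submodule ℝ E3 :=
  if h : ∃ σ, T.IsColift c u σ then (η (h.choose u)).comap (fderiv ℝ h.choose u : E3 →ₗ[ℝ] E3)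
  else ζ c u

variable {T} {η : E3 → Submodule ℝ E3} {ζ : OrbChart X → E3 → Submodule ℝ E3} {c : OrbChart X}
  {u : E3}

/-- The value does not depend on the chosen lift. -/
theorem tubeField_eq (hη : ScrewInvariant η) {σ : E3 → E3} (hσ : T.IsColift c u σ) :
    T.tubeField η ζ c u = (η (σ u)).comap (fderiv ℝ σ u : E3 →ₗ[ℝ] E3) := by
  have h : ∃ σ, T.IsColift c u σ := ⟨σ, hσ⟩
  rw [tubeField, dif_pos h]
  obtain ⟨h1, h2, h3⟩ := h.choose_spec
  refine T.comap_eq hη h1 hσ.1 h2 hσ.2.1 ?_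
  filter_upwards [h3, hσ.2.2] with y hy hy'
  rw [hy, hy']

theorem tubeField_of_notMem (h : c.proj u ∉ T.image) : T.tubeField η ζ c u = ζ c u := by
  rw [tubeField, dif_neg]
  rintro ⟨σ, h1, h2, h3⟩
  exact h ⟨σ u, h2, h3.self_of_nhds⟩

/-- Inside the tube the field is, near each point, the pullback of `η` under one local
diffeomorphism. -/
theorem exists_eventually_tubeField_eq {p : E3} (hp : p ∈ solidTube T.R) (hc : c ∈ O.charts)
    (hu : u ∈ c.dom) (h : c.proj u = T.map p) :
    ∃ σ : E3 → E3, ContDiffAt ℝ ∞ σ u ∧ Function.Injective (fderiv ℝ σ u) ∧ σ u = p ∧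
      (∀ᶠ y in 𝓝 u, T.map (σ y) = c.proj y) ∧
      ∀ᶠ y in 𝓝 u, ∀ (η : E3 → Submodule ℝ E3), ScrewInvariant η →
        T.tubeField η ζ c y = (η (σ y)).comap (fderiv ℝ σ y : E3 →ₗ[ℝ] E3) := by
  obtain ⟨σ, h1, h2, h3, h4, -⟩ := T.exists_germEquiv hp hc hu h
  refine ⟨σ, h1, h2, h3, h4, ?_⟩
  filter_upwards [eventually_injective_fderiv h1 h2, h4.eventually_nhds,
    h1.continuousAt.eventually ((isOpen_solidTube _).mem_nhds (h3 ▸ hp))] with y hy hy' hy'' η hη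
  exact tubeField_eq hη ⟨hy.1, hy'', hy'⟩

theorem tubeField_germEquiv (hη : ScrewInvariant η) {p : E3} (hp : p ∈ solidTube T.R)
    (hc : c ∈ O.charts) (hu : u ∈ c.dom) (h : c.proj u = T.map p) :
    GermEquiv c.proj u (T.tubeField η ζ c u) T.map p (η p) := by
  obtain ⟨σ, h1, h2, h3, h4, h5⟩ := exists_eventually_tubeField_eq (ζ := ζ) hp hc hu h
  exact ⟨σ, h1, h2, h3, h4, h3 ▸ h5.self_of_nhds η hη⟩

theorem isInvariant_tubeField (hη : ScrewInvariant η) (hζ : O.IsInvariant ζ) :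
    O.IsInvariant (T.tubeField η ζ) := by
  intro c hc d hd e j₁ j₂ h₁ h₂ p hp
  by_cases h : e.proj p ∈ T.image
  · obtain ⟨q, hq, hqe⟩ := h
    have e₁ : c.proj (j₁ p) = T.map q := by rw [h₁.proj_comp p hp, hqe]
    have e₂ : d.proj (j₂ p) = T.map q := by rw [h₂.proj_comp p hp, hqe]
    obtain ⟨σ₁, a1, a2, a3, a4, a5⟩ :=
      exists_eventually_tubeField_eq (ζ := ζ) hq hc (h₁.mapsTo hp) e₁
    obtain ⟨σ₂, b1, b2, b3, b4, b5⟩ :=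
      exists_eventually_tubeField_eq (ζ := ζ) hq hd (h₂.mapsTo hp) e₂
    have d₁ := h₁.contDiffAt hp
    have d₂ := h₂.contDiffAt hp
    have a1' := a1.differentiableAt (by simp)
    have b1' := b1.differentiableAt (by simp)
    have d₁' := d₁.differentiableAt (by simp)
    have d₂' := d₂.differentiableAt (by simp)
    rw [a5.self_of_nhds η hη, b5.self_of_nhds η hη]
    have := T.comap_eq (f := σ₁ ∘ j₁) (g := σ₂ ∘ j₂) (p := p) hη (a1'.comp p d₁')
      (b1'.comp p d₂') (by rw [Function.comp_apply, a3]; exact hq)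
      (by rw [Function.comp_apply, b3]; exact hq) (by
        filter_upwards [d₁.continuousAt.eventually a4, d₂.continuousAt.eventually b4,
          e.isOpen_dom.mem_nhds hp] with y h1 h2 h3
        rw [Function.comp_apply, Function.comp_apply, h1, h2, h₁.proj_comp y h3,
          h₂.proj_comp y h3])
    rw [fderiv_comp p a1' d₁', fderiv_comp p b1' d₂'] at this
    exact this
  · rw [tubeField_of_notMem (by rwa [h₁.proj_comp p hp]),
      tubeField_of_notMem (by rwa [h₂.proj_comp p hp])]
    exact hζ c hc d hd e j₁ j₂ h₁ h₂ p hp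

theorem screwInvariant_cylPlane (a b e : ℝ → ℝ) :
    ScrewInvariant fun p => cylPlane (a (sqRadius p)) (b (sqRadius p)) (e (sqRadius p)) p := by
  intro m φ p v
  rw [mem_cylPlane, mem_cylPlane, cylForm_screw, sqRadius_screw]

/-- Where `η` is the standard plane, nothing is changed. -/
theorem tubeField_eq_self (hT : T.IsStandard ζ) (hη : ScrewInvariant η) (hc : c ∈ O.charts)
    (hu : u ∈ c.dom) (h : ∀ p ∈ solidTube T.R, c.proj u = T.map p → η p = stdPlane p) :
    T.tubeField η ζ c u = ζ c u := by
  by_cases hi : c.proj u ∈ T.image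
  · obtain ⟨p, hp, hpu⟩ := hi
    obtain ⟨σ, s1, s2, s3, s4, s5⟩ := hT.germEquiv hp hc hu hpu.symm
    rw [tubeField_eq hη ⟨s1.differentiableAt (by simp), s3 ▸ hp, s4⟩, s5, s3, h p hp hpu.symm]
  · exact tubeField_of_notMem hi

/-- Near points outside the tube nothing is changed, if `η` is standard outside a smaller tube. -/
theorem eventually_tubeField_eq_self [T2Space X] (hT : T.IsStandard ζ) {r : ℝ} (hr : r < T.R)
    (hc : c ∈ O.charts) (hu : u ∈ c.dom) (h : c.proj u ∉ T.image) :
    ∀ᶠ y in 𝓝 u, ∀ (η : E3 → Submodule ℝ E3), ScrewInvariant η →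
      (∀ p, r < radius p → η p = stdPlane p) → T.tubeField η ζ c y = ζ c y := by
  have hcont : ContinuousAt c.proj u := (c.map_nhds hu).le
  have hmem : c.proj u ∉ T.map '' {p | radius p ≤ r} := fun ⟨p, hp, hpu⟩ =>
    h ⟨p, lt_of_le_of_lt hp hr, hpu⟩
  filter_upwards [c.isOpen_dom.mem_nhds hu,
    hcont.eventually ((T.isClosed_image_radius_le hr).isOpen_compl.mem_nhds hmem)] with y hy hy' η hη hst
  refine tubeField_eq_self hT hη hc hy fun p hp hpy => hst p ?_
  by_contra! hle
  exact hy' ⟨p, hle, hpy.symm⟩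

end Tube

/-! ### The twist and the homotopy in a tube -/

/-- A smooth function that is positive on `(a, b)` and vanishes elsewhere. -/
def bump (a b s : ℝ) : ℝ := expNegInvGlue (s - a) * expNegInvGlue (b - s)

theorem contDiff_bump (a b : ℝ) : ContDiff ℝ ∞ (bump a b) :=
  (expNegInvGlue.contDiff.comp (contDiff_id.sub contDiff_const)).mul
    (expNegInvGlue.contDiff.comp (contDiff_const.sub contDiff_id))

theorem bump_of_notMem {a b s : ℝ} (h : s ∉ Ioo a b) : bump a b s = 0 := by
  rw [mem_Ioo, not_and_or, not_lt, not_lt] at h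
  rcases h with h | h
  · rw [bump, expNegInvGlue.zero_of_nonpos (by linarith), zero_mul]
  · rw [bump, expNegInvGlue.zero_of_nonpos (x := b - s) (by linarith), mul_zero]

theorem bump_pos {a b s : ℝ} (h : s ∈ Ioo a b) : 0 < bump a b s :=
  mul_pos (expNegInvGlue.pos_of_pos (by linarith [h.1])) (expNegInvGlue.pos_of_pos (by linarith [h.2]))

/-- The one-form of the homotopy at time `t`: the linear interpolation between `dz + r² dθ` and the
twisted form, with a multiple of `r dr` added in order that it does not vanish where these point in
opposite directions. The number `n` is the order of the rotation group: the profile is prescribed on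
the quotient, where the squared radius is `s / n`. -/
def homotopyForm (n a b t : ℝ) (p : E3) : E3 →L[ℝ] ℝ :=
  cylForm ((1 - t) + t * twistA a b (sqRadius p / n)) ((1 - t) + t * twistB a b (sqRadius p / n))
    (t * (1 - t) * bump a b (sqRadius p / n)) p

/-- The kernel of `homotopyForm`. -/
def homotopyPlane (n a b t : ℝ) (p : E3) : Submodule ℝ E3 :=
  LinearMap.ker (homotopyForm n a b t p : E3 →ₗ[ℝ] ℝ)

section

variable {n a b : ℝ}

theorem contDiff_homotopyForm (ha : 0 < a) (h : a < b) :
    ContDiff ℝ ∞ fun y : ℝ × E3 => homotopyForm n a b y.1 y.2 := by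
  have hs : ContDiff ℝ ∞ fun y : ℝ × E3 => sqRadius y.2 / n :=
    (contDiff_sqRadius.comp contDiff_snd).div_const _
  have hA := (contDiff_twistA (a := a) (b := b)).comp hs
  have hB := (contDiff_twistB ha h).comp hs
  have hc := (contDiff_bump a b).comp hs
  have ht : ContDiff ℝ ∞ fun y : ℝ × E3 => 1 - y.1 := contDiff_const.sub contDiff_fst
  rw [contDiff_iff_contDiffAt]
  intro y
  exact contDiffAt_cylForm (ht.add (contDiff_fst.mul hA)).contDiffAt
    (ht.add (contDiff_fst.mul hB)).contDiffAt ((contDiff_fst.mul ht).mul hc).contDiffAt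
    contDiff_snd.contDiffAt

theorem homotopyForm_of_notMem (h : a < b) {t : ℝ} {p : E3} (hp : sqRadius p / n ∉ Ioo a b) :
    homotopyForm n a b t p = cylForm 1 1 0 p := by
  rw [homotopyForm, (twist_of_notMem h hp).1, (twist_of_notMem h hp).2, bump_of_notMem hp]
  congr 1 <;> ring

theorem homotopyForm_ne_zero (ha : 0 < a) (h : a < b) {t : ℝ} (ht : t ∈ Icc (0 : ℝ) 1) (p : E3) :
    homotopyForm n a b t p ≠ 0 := by
  by_cases hp : sqRadius p / n ∈ Ioo a b
  · have hs : 0 < sqRadius p / n := ha.trans hp.1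
    have hs' : sqRadius p ≠ 0 := by
      rintro h0
      rw [h0, zero_div] at hs
      exact hs.false
    refine cylForm_ne_zero ?_
    rcases eq_or_ne t 0 with rfl | h0
    · simp
    rcases eq_or_ne t 1 with rfl | h1
    · simp only [sub_self, zero_add, one_mul, zero_mul, ne_eq, not_true_eq_false, or_false]
      by_contra! hc
      obtain ⟨c1, c2⟩ := hc
      have c3 : twistB a b (sqRadius p / n) = 0 := by
        by_contra c4; exact hs' (c2 c4)
      have := twistA_sq_add ha h (sqRadius p / n)
      rw [c1, c3] at this
      nlinarith [sq_nonneg (sqRadius p / n)]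
    · refine Or.inr ⟨Or.inr ?_, hs'⟩
      exact mul_ne_zero (mul_ne_zero h0 (sub_ne_zero.2 (Ne.symm h1))) (bump_pos hp).ne'
  · rw [homotopyForm_of_notMem h hp]
    exact cylForm_ne_zero (Or.inl one_ne_zero)

theorem screwInvariant_homotopyPlane (t : ℝ) : ScrewInvariant (homotopyPlane n a b t) :=
  Tube.screwInvariant_cylPlane (fun s => (1 - t) + t * twistA a b (s / n))
    (fun s => (1 - t) + t * twistB a b (s / n)) (fun s => t * (1 - t) * bump a b (s / n))

theorem homotopyPlane_of_notMem (h : a < b) {t : ℝ} {p : E3} (hp : sqRadius p / n ∉ Ioo a b) :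
    homotopyPlane n a b t p = stdPlane p := by
  rw [homotopyPlane, homotopyForm_of_notMem h hp, stdPlane_eq_cylPlane, cylPlane]

theorem homotopyPlane_zero (p : E3) : homotopyPlane n a b 0 p = stdPlane p := by
  rw [homotopyPlane, homotopyForm, stdPlane_eq_cylPlane, cylPlane]
  simp

theorem homotopyPlane_one (p : E3) : homotopyPlane n a b 1 p =
    cylPlane (twistA a b (sqRadius p / n)) (twistB a b (sqRadius p / n)) 0 p := by
  rw [homotopyPlane, homotopyForm, cylPlane]
  simp

/-- The twisted contact structure, upstairs for `k = 1` and on the quotient for `k = 1 / n`. -/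
theorem isContactAt_twist (ha : 0 < a) (h : a < b) {k : ℝ} (hk : k ≠ 0) (p : E3) :
    IsContactAt (fun q => cylPlane (twistA a b (sqRadius q / n))
      (k * twistB a b (sqRadius q / n)) 0 q) p := by
  have hd : ContDiff ℝ ∞ fun s : ℝ => s / n := contDiff_id.div_const n
  have hB : ContDiff ℝ ∞ fun s => k * twistB a b (s / n) :=
    contDiff_const.mul ((contDiff_twistB ha h).comp hd)
  refine isContactAt_cylPlane (A := fun s => twistA a b (s / n)) (contDiff_twistA.comp hd) hB ?_
  set s := sqRadius p
  have hs : HasDerivAt (fun s : ℝ => s / n) (1 / n) s := (hasDerivAt_id s).div_const n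
  have dA : HasDerivAt (fun s => twistA a b (s / n)) _ s :=
    HasDerivAt.comp (h := fun s => s / n) s
      ((contDiff_twistA (a := a) (b := b)).differentiable (by simp) (s / n)).hasDerivAt hs
  have dB : HasDerivAt (fun s => k * twistB a b (s / n)) _ s :=
    (HasDerivAt.comp (h := fun s => s / n) s
      ((contDiff_twistB ha h).differentiable (by simp) (s / n)).hasDerivAt hs).const_mul k
  rw [dA.deriv, dB.deriv]
  convert mul_ne_zero hk (twist_turning_ne_zero ha h (s / n)) using 1
  ring

end

namespace Tube

variable {O : OrbAtlas X} {T : Tube O} {ζ : OrbChart X → E3 → Submodule ℝ E3}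

/-- A plane field with a joint local form depending on a parameter. -/
theorem isPlaneFieldOn_of_family {Z : ℝ → E3 → Submodule ℝ E3} {U : Set E3} {t : ℝ}
    (h : ∀ p ∈ U, ∃ α : ℝ × E3 → (E3 →L[ℝ] ℝ), ContDiffAt ℝ ∞ α (t, p) ∧
      ∀ᶠ y in 𝓝 (t, p), y.1 ∈ Icc (0 : ℝ) 1 →
        α y ≠ 0 ∧ Z y.1 y.2 = LinearMap.ker (α y : E3 →ₗ[ℝ] ℝ)) (ht : t ∈ Icc (0 : ℝ) 1) :
    IsPlaneFieldOn U (Z t) := by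
  intro p hp
  obtain ⟨α, h1, h2⟩ := h p hp
  have hc : ContDiffAt ℝ ∞ (fun q : E3 => (t, q)) p := contDiffAt_const.prodMk contDiffAt_id
  refine ⟨fun q => α (t, q), h1.comp p hc, ?_⟩
  filter_upwards [hc.continuousAt.eventually h2] with q hq using hq ht

theorem sqrt_lt_R {b : ℝ} (hb : T.n * b < T.R ^ 2) : Real.sqrt (T.n * b) < T.R :=
  (Real.sqrt_lt' T.pos).2 hb

theorem homotopyPlane_eq_stdPlane_of_lt {a b : ℝ} (h : a < b) {t : ℝ} {p : E3}
    (hp : Real.sqrt (T.n * b) < radius p) :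
    homotopyPlane T.n a b t p = stdPlane p := by
  refine homotopyPlane_of_notMem h fun h1 => ?_
  have hn : (0 : ℝ) < T.n := by exact_mod_cast Nat.pos_of_ne_zero T.n_ne_zero
  have h2 := (div_lt_iff₀ hn).1 h1.2
  have h3 : T.n * b < radius p ^ 2 := (Real.sqrt_lt' ((Real.sqrt_nonneg _).trans_lt hp)).1 hp
  rw [radius_sq] at h3
  linarith

/-- The twist is a homotopy of orbifold plane fields. -/
theorem isHomotopic_tubeField [T2Space X] {a b : ℝ} (ha : 0 < a) (h : a < b)
    (hb : T.n * b < T.R ^ 2) (hT : T.IsStandard ζ) (hζ : O.IsContact ζ) :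
    O.IsHomotopic ζ (T.tubeField (homotopyPlane T.n a b 1) ζ) := by
  have hform : ∀ c ∈ O.charts, ∀ t ∈ Icc (0 : ℝ) 1, ∀ p ∈ c.dom, ∃ α : ℝ × E3 → (E3 →L[ℝ] ℝ),
      ContDiffAt ℝ ∞ α (t, p) ∧
      ∀ᶠ y in 𝓝 (t, p), y.1 ∈ Icc (0 : ℝ) 1 →
        α y ≠ 0 ∧ T.tubeField (homotopyPlane T.n a b y.1) ζ c y.2 =
          LinearMap.ker (α y : E3 →ₗ[ℝ] ℝ) := by
    intro c hc t ht u hu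
    have hsnd : Tendsto (Prod.snd : ℝ × E3 → E3) (𝓝 (t, u)) (𝓝 u) := continuousAt_snd
    by_cases hi : c.proj u ∈ T.image
    · obtain ⟨p, hp, hpu⟩ := hi
      obtain ⟨σ, s1, s2, s3, s4, s5⟩ :=
        exists_eventually_tubeField_eq (ζ := ζ) hp hc hu hpu.symm
      refine ⟨fun y => (homotopyForm T.n a b y.1 (σ y.2)).comp (fderiv ℝ σ y.2), ?_, ?_⟩
      · have e1 : ContDiffAt ℝ ∞ (fun y : ℝ × E3 => (y.1, σ y.2)) (t, u) :=
          contDiffAt_fst.prodMk (s1.comp (t, u) contDiffAt_snd)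
        have e2 : ContDiffAt ℝ ∞ (fun y : ℝ × E3 => fderiv ℝ σ y.2) (t, u) :=
          (s1.fderiv_right (m := ∞) (by simp)).comp (t, u) contDiffAt_snd
        exact ((contDiff_homotopyForm ha h).contDiffAt.comp (t, u) e1).clm_comp e2
      · filter_upwards [hsnd.eventually s5, hsnd.eventually (eventually_injective_fderiv s1 s2)]
          with y hy hy' hyt
        refine ⟨comp_ne_zero_of_injective (homotopyForm_ne_zero ha h hyt (σ y.2)) hy'.2, ?_⟩
        rw [hy _ (screwInvariant_homotopyPlane y.1)]
        rfl
    · obtain ⟨α, ⟨h1, h2⟩, -⟩ := hζ.1 c hc u hu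
      refine ⟨fun y => α y.2, h1.comp (t, u) contDiffAt_snd, ?_⟩
      filter_upwards [hsnd.eventually h2, hsnd.eventually
        (eventually_tubeField_eq_self hT (sqrt_lt_R hb) hc hu hi)] with y hy hy' hyt
      rw [hy' _ (screwInvariant_homotopyPlane y.1)
        (fun p hp => homotopyPlane_eq_stdPlane_of_lt h hp)]
      exact hy
  refine ⟨fun t => T.tubeField (homotopyPlane T.n a b t) ζ, ?_, hform, ?_⟩
  · intro t ht
    refine ⟨fun c hc => ?_, isInvariant_tubeField (screwInvariant_homotopyPlane t) hζ.2⟩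
    exact isPlaneFieldOn_of_family (Z := fun t => T.tubeField (homotopyPlane T.n a b t) ζ c)
      (fun p hp => hform c hc t ht p hp) ht
  · intro c hc p hp
    refine ⟨tubeField_eq_self hT (screwInvariant_homotopyPlane 0) hc hp
      fun q _ _ => homotopyPlane_zero q, rfl⟩

/-- The twist of an orbifold contact structure is again one: the contact condition passes to charts by
pullback, and near the boundary of the tube nothing has changed. -/
theorem isContact_tubeField [T2Space X] {a b : ℝ} (ha : 0 < a) (h : a < b)
    (hb : T.n * b < T.R ^ 2) (hT : T.IsStandard ζ) (hζ : O.IsContact ζ) :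
    O.IsContact (T.tubeField (homotopyPlane T.n a b 1) ζ) := by
  refine ⟨fun c hc u hu => ?_, isInvariant_tubeField (screwInvariant_homotopyPlane 1) hζ.2⟩
  by_cases hi : c.proj u ∈ T.image
  · obtain ⟨p, hp, hpu⟩ := hi
    obtain ⟨σ, s1, s2, s3, s4, s5⟩ :=
      exists_eventually_tubeField_eq (ζ := ζ) hp hc hu hpu.symm
    have hcont := (isContactAt_twist (n := T.n) ha h one_ne_zero (σ u)).comap s1 s2
    refine hcont.congr ?_
    filter_upwards [s5] with y hy
    rw [hy _ (screwInvariant_homotopyPlane 1), homotopyPlane_one, one_mul]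
  · refine IsContactAt.congr (hζ.1 c hc u hu) ?_
    filter_upwards [eventually_tubeField_eq_self hT (sqrt_lt_R hb) hc hu hi] with y hy
    exact hy _ (screwInvariant_homotopyPlane 1)
      (fun p hp => homotopyPlane_eq_stdPlane_of_lt h hp)

end Tube

end

section

/-! ### The underlying manifold -/

variable {X : Type*} [TopologicalSpace X]

namespace Tube

variable {O : OrbAtlas X} (T : Tube O)

theorem rootPoint_mem {q : E3} (hq : q ∈ solidTube T.R) : rootPoint T.n 1 q ∈ solidTube T.R := by
  rwa [mem_solidTube, radius_rootPoint _ zero_le_one, one_mul]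

theorem powMap_mem {p : E3} (hp : p ∈ solidTube T.R) : powMap T.n p ∈ solidTube T.R := by
  rwa [mem_solidTube, radius_powMap T.n_ne_zero]

/-- The projection of the tube is `powMap` followed by the coordinates of the quotient. -/
theorem quotientCoord_powMap {p : E3} (hp : p ∈ solidTube T.R) :
    T.quotientCoord 1 (powMap T.n p) = T.map p := by
  obtain ⟨k, hk⟩ := exists_screw_of_powMap_eq T.n_ne_zero
    (powMap_rootPoint T.n_ne_zero (powMap T.n p)).symm
  rw [quotientCoord, hk]
  simpa using T.map_screw hp 0 k

theorem quotientCoord_eq_iff {q q' : E3} (hq : q ∈ solidTube T.R) (hq' : q' ∈ solidTube T.R) :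
    T.quotientCoord 1 q = T.quotientCoord 1 q' ↔ ∃ m : ℤ, q' = screw m 0 q := by
  have hn := T.n_ne_zero
  rw [quotientCoord, quotientCoord, T.map_eq_iff _ (T.rootPoint_mem hq) _ (T.rootPoint_mem hq')]
  constructor
  · rintro ⟨m, k, h⟩
    refine ⟨m, ?_⟩
    have := congrArg (powMap T.n) h
    rwa [powMap_screw hn, powMap_rootPoint hn, powMap_rootPoint hn] at this
  · rintro ⟨m, rfl⟩
    refine ⟨m, 0, ?_⟩
    apply ext_cxCoord
    · simp only [screw_zero_apply, rootPoint_zero_apply]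
    · rw [cxCoord_screw, cxCoord_rootPoint, cxCoord_rootPoint, radius_screw, cxCoord_screw]
      simp

/-- Off the axis, `powMap` is the smooth change of coordinates from the tube to its quotient. -/
theorem germEquiv_quotientCoord {p : E3} (hp : p ∈ solidTube T.R) (h0 : radius p ≠ 0)
    (B : Submodule ℝ E3) :
    GermEquiv T.map p (B.comap (fderiv ℝ (powMap T.n) p : E3 →ₗ[ℝ] E3))
      (T.quotientCoord 1) (powMap T.n p) B := by
  refine ⟨powMap T.n, contDiffAt_powMap T.n h0, injective_fderiv_powMap T.n_ne_zero h0, rfl, ?_,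
    rfl⟩
  filter_upwards [(isOpen_solidTube T.R).mem_nhds hp] with y hy using T.quotientCoord_powMap hy

theorem germEquiv_translate {q : E3} (hq : q ∈ solidTube T.R) (m : ℤ) (B : Submodule ℝ E3) :
    GermEquiv (T.quotientCoord 1) q B (T.quotientCoord 1) (screw m 0 q) B := by
  have hd : fderiv ℝ (screw m 0) q = ContinuousLinearMap.id ℝ E3 := by
    rw [(hasFDerivAt_screw m 0 q).fderiv]
    ext1 v
    exact rotation_zero v
  refine ⟨screw m 0, (contDiff_screw m 0).contDiffAt, ?_, rfl, ?_, ?_⟩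
  · rw [hd]; exact Function.injective_id
  · filter_upwards [(isOpen_solidTube T.R).mem_nhds hq] with y hy
    exact ((T.quotientCoord_eq_iff hy (by rwa [mem_solidTube, radius_screw])).2 ⟨m, rfl⟩).symm
  · rw [hd]; ext; simp

/-- On the axis the rotations make the projection of the tube fail to be injective. -/
theorem not_isParam_map {p : E3} (hp : p ∈ axis) : ¬ IsParam T.map p := by
  rintro ⟨-, U, hU, hinj⟩
  have hn : (2 : ℝ) ≤ T.n := by exact_mod_cast T.two_le
  set φ : ℝ := 2 * Real.pi * (1 : ℕ) / T.n with hφ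
  have hfix : screw 0 φ p = p := by
    apply ext_cxCoord
    · simp [screw_zero_apply]
    · rw [cxCoord_screw, radius_eq_zero.1 hp, mul_zero]
  have hsc : Tendsto (screw 0 φ) (𝓝 p) (𝓝 p) := by
    have := (contDiff_screw 0 φ).continuous.continuousAt (x := p)
    rwa [ContinuousAt, hfix] at this
  have hγ : Tendsto (fun t : ℝ => p + t • (!₂[0, 1, 0] : E3)) (𝓝[≠] 0) (𝓝 p) := by
    have : ContinuousAt (fun t : ℝ => p + t • (!₂[0, 1, 0] : E3)) 0 := by fun_prop
    have h2 := this.tendsto.mono_left (nhdsWithin_le_nhds (s := {0}ᶜ))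
    simpa using h2
  have hR : ∀ᶠ y in 𝓝 p, y ∈ solidTube T.R :=
    (isOpen_solidTube _).mem_nhds (axis_subset_solidTube T.pos hp)
  obtain ⟨t, ⟨⟨h1, h2⟩, h3⟩, ht⟩ := ((hγ.eventually ((hR.and hU).and (hsc.eventually hU))).and
    self_mem_nhdsWithin).exists
  have e := hinj h3 h2 (by simpa [hφ] using T.map_screw h1 0 1)
  have e' := congrArg cxCoord e
  rw [cxCoord_screw] at e'
  have hne : cxCoord (p + t • (!₂[0, 1, 0] : E3)) ≠ 0 := by
    rw [map_add, radius_eq_zero.1 hp, zero_add, map_smul, cxCoord_apply]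
    intro h0
    have := congrArg Complex.re h0
    simp at this
    exact ht this
  have hexp : Complex.exp (φ * Complex.I) = 1 := mul_right_cancel₀ hne (e'.trans (one_mul _).symm)
  obtain ⟨k, hk⟩ := Complex.exp_eq_one_iff.1 hexp
  have hk' : φ = k * (2 * Real.pi) := by
    have h3 := congrArg Complex.im hk
    simpa using h3
  rw [hφ] at hk'
  have hpi := Real.pi_pos
  have h5 : (k : ℝ) * T.n = 1 := by
    field_simp at hk'
    push_cast at hk'
    linarith
  have h6 : k * (T.n : ℤ) = 1 := by exact_mod_cast h5
  have h7 := Int.eq_one_or_neg_one_of_mul_eq_one' h6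
  have := T.two_le
  omega

end Tube

namespace TubeSystem

variable {O : OrbAtlas X} (T : TubeSystem O)

theorem mem_singularLocus_iff {x : X} : x ∈ O.singularLocus ↔ ∃ K, x ∈ (T.tube K).core := by
  constructor
  · intro hx
    refine ⟨⟨connectedComponentIn O.singularLocus x, x, hx, rfl⟩, ?_⟩
    rw [T.core_eq]
    exact mem_connectedComponentIn hx
  · rintro ⟨⟨K, y, hy, rfl⟩, hx⟩
    rw [T.core_eq] at hx
    exact connectedComponentIn_subset _ _ hx

theorem map_mem_singularLocus_iff {K : O.singularComponents} {p : E3}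
    (hp : p ∈ solidTube (T.tube K).R) :
    (T.tube K).map p ∈ O.singularLocus ↔ radius p = 0 := by
  rw [T.mem_singularLocus_iff]
  constructor
  · rintro ⟨L, q, hq, hqp⟩
    have hq' := axis_subset_solidTube (T.tube L).pos hq
    obtain rfl : L = K := by
      by_contra hne
      exact disjoint_left.1 (T.disjoint L K hne) ⟨q, hq', hqp⟩ ⟨p, hp, rfl⟩
    obtain ⟨m, k, rfl⟩ := ((T.tube L).map_eq_iff q hq' p hp).1 hqp
    rw [radius_screw]
    exact hq
  · intro h
    exact ⟨K, p, h, rfl⟩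

/-- A chart is injective near a point exactly when the point is nonsingular. -/
theorem isParam_iff (T : TubeSystem O) {c : OrbChart X} (hc : c ∈ O.charts) {u : E3} (hu : u ∈ c.dom) :
    IsParam c.proj u ↔ c.proj u ∉ O.singularLocus := by
  constructor
  · intro h hs
    obtain ⟨K, p, hp, hpu⟩ := T.mem_singularLocus_iff.1 hs
    exact (T.tube K).not_isParam_map hp (((T.tube K).exists_germEquiv
      (axis_subset_solidTube (T.tube K).pos hp) hc hu hpu.symm).symm.isParam h)
  · intro h
    refine c.isParam hu fun g hg => ?_
    by_contra hne
    exact h ⟨c, hc, u, hu, rfl, g, hne, hg⟩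

/-- The part of a chart over the nonsingular points. -/
def regularDom (c : OrbChart X) : Set E3 := {u | u ∈ c.dom ∧ c.proj u ∉ O.singularLocus}

theorem isOpen_regularDom (T : TubeSystem O) {c : OrbChart X} (hc : c ∈ O.charts) :
    IsOpen (regularDom (O := O) c) := by
  rw [isOpen_iff_mem_nhds]
  rintro u ⟨hu, hs⟩
  obtain ⟨-, U, hU, hinj⟩ := (T.isParam_iff hc hu).2 hs
  filter_upwards [c.isOpen_dom.mem_nhds hu, eventually_mem_nhds_iff.2 hU] with y hy hyU
  exact ⟨hy, (T.isParam_iff hc hy).1 ⟨c.map_nhds hy, U, hyU, hinj⟩⟩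

/-- The coordinates `(z, r, n θ)` are topological coordinates on the quotient, across the axis as
well. Continuity of `rootPoint` fails along the cut of the argument, but off the axis `powMap` is a
local diffeomorphism and on the axis `rootPoint` is continuous. -/
theorem isParam_quotientCoord (K : O.singularComponents) {q : E3}
    (hq : q ∈ solidTube (T.tube K).R) : IsParam ((T.tube K).quotientCoord 1) q := by
  have hn := (T.tube K).n_ne_zero
  have hr := (T.tube K).rootPoint_mem hq
  have hpow := powMap_rootPoint hn q
  by_cases h0 : radius q = 0
  · refine ⟨?_, Metric.ball q (1 / 2) ∩ solidTube (T.tube K).R, inter_mem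
      (Metric.ball_mem_nhds _ (by norm_num)) ((isOpen_solidTube _).mem_nhds hq), ?_⟩
    · refine le_antisymm ?_ ?_
      · exact ContinuousAt.comp (g := (T.tube K).map) (f := rootPoint (T.tube K).n 1)
          ((T.tube K).map_nhds hr).le (continuousAt_rootPoint h0)
      · have h1 := (T.tube K).map_nhds hr
        have h2 : (T.tube K).map =ᶠ[𝓝 (rootPoint (T.tube K).n 1 q)]
            (T.tube K).quotientCoord 1 ∘ powMap (T.tube K).n := by
          filter_upwards [(isOpen_solidTube _).mem_nhds hr] with y hy
          exact ((T.tube K).quotientCoord_powMap hy).symm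
        have h3 : Tendsto (powMap (T.tube K).n) (𝓝 (rootPoint (T.tube K).n 1 q)) (𝓝 q) := by
          have := (continuous_powMap hn).continuousAt (x := rootPoint (T.tube K).n 1 q)
          rwa [ContinuousAt, hpow] at this
        rw [Tube.quotientCoord, ← h1, map_congr h2, ← map_map]
        exact map_mono h3
    -- A ball of radius `1 / 2` contains no two points that differ by a period.
    · rintro y ⟨hy, hyR⟩ z ⟨hz, hzR⟩ hyz
      obtain ⟨m, rfl⟩ := ((T.tube K).quotientCoord_eq_iff hyR hzR).1 hyz
      have hd : dist y (screw m 0 y) < 1 := by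
        rw [Metric.mem_ball] at hy hz
        linarith [dist_triangle_right y (screw m 0 y) q]
      have h1 : |(m : ℝ)| < 1 := by
        refine lt_of_le_of_lt ?_ hd
        have := PiLp.norm_apply_le (screw m 0 y - y) (0 : Fin 3)
        rw [dist_comm, dist_eq_norm]
        simpa [screw_zero_apply] using this
      have h2 : m = 0 := by
        have : |m| < 1 := by exact_mod_cast h1
        exact Int.abs_lt_one_iff.1 this
      rw [h2, Int.cast_zero, screw_zero_zero]
  · have h1 : radius (rootPoint (T.tube K).n 1 q) ≠ 0 := by
      rwa [radius_rootPoint _ zero_le_one, one_mul]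
    obtain ⟨c, hc, u, hu, hcu⟩ := O.cover ((T.tube K).map (rootPoint (T.tube K).n 1 q))
    have h2 : IsParam c.proj u := (T.isParam_iff hc hu).2 fun hs =>
      h1 ((T.map_mem_singularLocus_iff hr).1 (hcu ▸ hs))
    have h3 := ((T.tube K).exists_germEquiv hr hc hu hcu).symm.isParam h2
    have h4 := ((T.tube K).germEquiv_quotientCoord hr h1 ⊤).symm.isParam h3
    rwa [hpow] at h4

/-- The parametrizations of the underlying manifold: the charts over the nonsingular points, and the
quotients of the tubes. -/
def paramMap : O.charts ⊕ O.singularComponents → E3 → X :=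
  Sum.elim (fun c => c.1.proj) fun K => (T.tube K).quotientCoord 1

/-- The domains of the parametrizations. -/
def paramDom : O.charts ⊕ O.singularComponents → Set E3 :=
  Sum.elim (fun c => regularDom (O := O) c.1) fun K => solidTube (T.tube K).R

/-- An orbifold plane field together with plane fields on the quotients of the tubes. -/
def paramField (ζ : OrbChart X → E3 → Submodule ℝ E3)
    (β : O.singularComponents → E3 → Submodule ℝ E3) :
    O.charts ⊕ O.singularComponents → E3 → Submodule ℝ E3 :=
  Sum.elim (fun c => ζ c.1) β

/-- Away from the axis of the tubes, the fields `β` on the quotients pull back to `ζ`. -/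
def IsCompatible (ζ : OrbChart X → E3 → Submodule ℝ E3)
    (β : O.singularComponents → E3 → Submodule ℝ E3) : Prop :=
  (∀ K (m : ℤ) q, β K (screw m 0 q) = β K q) ∧
  ∀ K, ∀ p ∈ solidTube (T.tube K).R, radius p ≠ 0 → ∀ c ∈ O.charts, ∀ u ∈ c.dom,
    c.proj u = (T.tube K).map p → GermEquiv c.proj u (ζ c u) (T.tube K).map p
      ((β K (powMap (T.tube K).n p)).comap (fderiv ℝ (powMap (T.tube K).n) p : E3 →ₗ[ℝ] E3))

variable {T}

theorem IsCompatible.germEquiv_aux {ζ : OrbChart X → E3 → Submodule ℝ E3}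
    {β : O.singularComponents → E3 → Submodule ℝ E3} (h : T.IsCompatible ζ β)
    {c : OrbChart X} (hc : c ∈ O.charts) {u : E3} (hu : u ∈ regularDom (O := O) c)
    {K : O.singularComponents} {q : E3} (hq : q ∈ solidTube (T.tube K).R)
    (he : c.proj u = (T.tube K).quotientCoord 1 q) :
    GermEquiv c.proj u (ζ c u) ((T.tube K).quotientCoord 1) q (β K q) := by
  have hr := (T.tube K).rootPoint_mem hq
  have h1 : radius (rootPoint (T.tube K).n 1 q) ≠ 0 := fun h0 =>
    hu.2 (he ▸ (T.map_mem_singularLocus_iff hr).2 h0)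
  have := (h.2 K _ hr h1 c hc u hu.1 he).trans ((T.tube K).germEquiv_quotientCoord hr h1 _)
  rwa [powMap_rootPoint (T.tube K).n_ne_zero] at this

/-- Compatible fields are related by smooth changes of coordinates, wherever two parametrizations
have a point of `X` in common. -/
theorem IsCompatible.germEquiv {ζ : OrbChart X → E3 → Submodule ℝ E3}
    {β : O.singularComponents → E3 → Submodule ℝ E3} (h : T.IsCompatible ζ β)
    (hζ : O.IsInvariant ζ) (i : O.charts ⊕ O.singularComponents) (p : E3) (hp : p ∈ T.paramDom i)
    (j : O.charts ⊕ O.singularComponents) (q : E3) (hq : q ∈ T.paramDom j)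
    (he : T.paramMap i p = T.paramMap j q) :
    GermEquiv (T.paramMap i) p (paramField ζ β i p) (T.paramMap j) q (paramField ζ β j q) := by
  rcases i with ⟨c, hc⟩ | K <;> rcases j with ⟨d, hd⟩ | L
  · exact hζ.germEquiv hc hd hp.1 hq.1 he
  · exact h.germEquiv_aux hc hp hq he
  · exact (h.germEquiv_aux hd hq hp he.symm).symm
  · obtain rfl : K = L := by
      by_contra hne
      exact disjoint_left.1 (T.disjoint K L hne) ⟨_, (T.tube K).rootPoint_mem hp, rfl⟩
        ⟨_, (T.tube L).rootPoint_mem hq, he.symm⟩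
    obtain ⟨m, rfl⟩ := ((T.tube K).quotientCoord_eq_iff hp hq).1 he
    have := (T.tube K).germEquiv_translate hp m (β K p)
    -- The field on the quotient is periodic along the axis.
    rw [← h.1 K m p] at this
    nth_rewrite 1 [h.1 K m p] at this
    exact this

variable (T)

/-- For the trivial fields, compatibility says that the parametrizations change smoothly. -/
theorem isCompatible_top : T.IsCompatible (fun _ _ => ⊤) fun _ _ => ⊤ :=
  ⟨fun _ _ _ => rfl, fun K _ hp _ _ hc _ hu h => by
    simpa using (T.tube K).exists_germEquiv hp hc hu h⟩

/-- The smooth structure on the underlying space. -/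
def paramFamily : ParamFamily X (O.charts ⊕ O.singularComponents) where
  P := T.paramMap
  U := T.paramDom
  isOpen := by
    rintro (⟨c, hc⟩ | K)
    · exact T.isOpen_regularDom hc
    · exact isOpen_solidTube _
  param := by
    rintro (⟨c, hc⟩ | K) p hp
    · exact (T.isParam_iff hc hp.1).2 hp.2
    · exact T.isParam_quotientCoord K hp
  cover x := by
    by_cases hx : x ∈ O.singularLocus
    · obtain ⟨K, p, hp, rfl⟩ := T.mem_singularLocus_iff.1 hx
      have hp' := axis_subset_solidTube (T.tube K).pos hp
      exact ⟨Sum.inr K, powMap (T.tube K).n p, (T.tube K).powMap_mem hp',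
        (T.tube K).quotientCoord_powMap hp'⟩
    · obtain ⟨c, hc, u, hu, rfl⟩ := O.cover x
      exact ⟨Sum.inl ⟨c, hc⟩, u, ⟨hu, hx⟩, rfl⟩
  compat i p hp j q hq h := by
    exact (T.isCompatible_top.germEquiv (fun _ _ _ _ _ _ _ _ _ _ _ => rfl) i p hp j q hq h).top

theorem isUnderlyingManifold :
    letI := T.paramFamily.chartedSpace
    IsUnderlyingManifold T :=
  letI := T.paramFamily.chartedSpace
  ⟨fun c hc _ hu hs => T.paramFamily.isLocalDiffeomorphAt (i := Sum.inl ⟨c, hc⟩) ⟨hu, hs⟩,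
    fun K _ hq => T.paramFamily.isLocalDiffeomorphAt (i := Sum.inr K) hq⟩

/-- An invariant contact structure with a smooth contact extension over the quotients of the tubes
induces a contact structure on the underlying manifold. -/
theorem exists_induced {ζ : OrbChart X → E3 → Submodule ℝ E3}
    {β : O.singularComponents → E3 → Submodule ℝ E3} (h : T.IsCompatible ζ β)
    (hζ : O.IsContact ζ) (hβ : ∀ K q, IsContactAt (β K) q) :
    letI := T.paramFamily.chartedSpace
    ∃ ξ : ∀ x : X, Submodule ℝ (TangentSpace 𝓘(ℝ, E3) x), IsContactManifold ξ ∧ Induces O ζ ξ ∧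
      ∀ K, ∀ q ∈ solidTube (T.tube K).R, pullback ((T.tube K).quotientCoord 1) ξ q = β K q := by
  let _ := T.paramFamily.chartedSpace
  obtain ⟨ξ, hξ⟩ := T.paramFamily.exists_field (paramField ζ β) (h.germEquiv hζ.2)
  refine ⟨ξ, T.paramFamily.isContactManifold hξ ?_, ?_, ?_⟩
  · rintro (⟨c, hc⟩ | K) p hp
    · exact hζ.1 c hc p hp.1
    · exact hβ K p
  · intro c hc u hu hs
    exact (hξ (Sum.inl ⟨c, hc⟩) u ⟨hu, hs⟩).symm
  · intro K q hq
    exact hξ (Sum.inr K) q hq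

end TubeSystem

end

/-! ### The overtwisted disc -/

/-- The paraboloid `z = r² - ρ²` over the disc of radius `ρ`, parametrized by the unit disc. The flat
disc `z = 0` would be tangent to the contact planes all along its boundary; bending it leaves the
centre as the only singular point. -/
def paraboloid (ρ : ℝ) (u : E2) : E3 :=
  !₂[ρ ^ 2 * (u 0 ^ 2 + u 1 ^ 2 - 1), ρ * u 0, ρ * u 1]

/-- The derivative of `paraboloid`. -/
def paraboloidDeriv (ρ : ℝ) (u : E2) : E2 →L[ℝ] E3 :=
  LinearMap.toContinuousLinearMap
    { toFun := fun w => !₂[2 * ρ ^ 2 * (u 0 * w 0 + u 1 * w 1), ρ * w 0, ρ * w 1]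
      map_add' := fun p q => by apply E3.ext <;> simp <;> ring
      map_smul' := fun c p => by apply E3.ext <;> simp <;> ring }

theorem paraboloidDeriv_apply (ρ : ℝ) (u w : E2) : paraboloidDeriv ρ u w =
    !₂[2 * ρ ^ 2 * (u 0 * w 0 + u 1 * w 1), ρ * w 0, ρ * w 1] := rfl

theorem hasFDerivAt_paraboloid (ρ : ℝ) (u : E2) :
    HasFDerivAt (paraboloid ρ) (paraboloidDeriv ρ u) u := by
  have h (i : Fin 2) : HasFDerivAt (fun u : E2 => u i) (EuclideanSpace.proj i : E2 →L[ℝ] ℝ) u :=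
    (EuclideanSpace.proj (𝕜 := ℝ) i).hasFDerivAt
  rw [← hasFDerivWithinAt_univ, hasFDerivWithinAt_euclidean]
  intro i
  rw [hasFDerivWithinAt_univ]
  fin_cases i
  · refine HasFDerivAt.congr_fderiv (((((h 0).pow 2).add ((h 1).pow 2)).sub_const 1).const_mul
      (ρ ^ 2)) ?_
    ext1 w
    simp [paraboloidDeriv_apply]
    ring
  · refine HasFDerivAt.congr_fderiv ((h 0).const_mul ρ) ?_
    ext1 w
    simp [paraboloidDeriv_apply]
  · refine HasFDerivAt.congr_fderiv ((h 1).const_mul ρ) ?_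
    ext1 w
    simp [paraboloidDeriv_apply]

theorem injective_paraboloidDeriv {ρ : ℝ} (hρ : ρ ≠ 0) (u : E2) :
    Function.Injective (paraboloidDeriv ρ u) := by
  intro w w' h
  have h1 := congrArg (fun v : E3 => v 1) h
  have h2 := congrArg (fun v : E3 => v 2) h
  simp [paraboloidDeriv_apply, hρ] at h1 h2
  ext i
  fin_cases i
  · exact h1
  · exact h2

theorem contDiff_paraboloid (ρ : ℝ) : ContDiff ℝ ∞ (paraboloid ρ) := by
  have h (i : Fin 2) : ContDiff ℝ ∞ fun u : E2 => u i :=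
    (EuclideanSpace.proj (𝕜 := ℝ) i).contDiff
  rw [contDiff_piLp]
  intro i
  fin_cases i
  · exact contDiff_const.mul ((((h 0).pow 2).add ((h 1).pow 2)).sub contDiff_const)
  · exact contDiff_const.mul (h 0)
  · exact contDiff_const.mul (h 1)

theorem E2.norm_sq (u : E2) : ‖u‖ ^ 2 = u 0 ^ 2 + u 1 ^ 2 := by
  rw [EuclideanSpace.norm_sq_eq, Fin.sum_univ_two]
  simp

theorem sqRadius_paraboloid (ρ : ℝ) (u : E2) : sqRadius (paraboloid ρ u) = ρ ^ 2 * ‖u‖ ^ 2 := by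
  rw [E2.norm_sq]
  simp [sqRadius, paraboloid]
  ring

theorem cylForm_paraboloid (a b ρ : ℝ) (u w : E2) :
    cylForm a b 0 (paraboloid ρ u) (paraboloidDeriv ρ u w) =
      ρ ^ 2 * (2 * a * (u 0 * w 0 + u 1 * w 1) + b * (u 0 * w 1 - u 1 * w 0)) := by
  simp [cylForm_apply, paraboloid, paraboloidDeriv_apply]
  ring

section Manifold

variable {X : Type*} [TopologicalSpace X] [ChartedSpace E3 X]

/-- If the contact planes are horizontal at the radius `ρ`, then the paraboloid over the disc of that
radius is an overtwisted disc. -/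
theorem isOvertwistedDisc_paraboloid [IsManifold 𝓘(ℝ, E3) ∞ X]
    {ξ : ∀ x : X, Submodule ℝ (TangentSpace 𝓘(ℝ, E3) x)} {K : Set X} {R ρ : ℝ} {P : E3 → X}
    {A B : ℝ → ℝ} (hP : IsTubularCoord K R P)
    (hξ : ∀ q ∈ solidTube R, pullback P ξ q = cylPlane (A (sqRadius q)) (B (sqRadius q)) 0 q)
    (hAB : ∀ s, A s ≠ 0 ∨ B s ≠ 0) (hA0 : A 0 ≠ 0) (hρ : 0 < ρ) (hρR : ρ < R)
    (hB : B (ρ ^ 2) = 0) : IsOvertwistedDisc ξ (P ∘ paraboloid ρ) := by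
  obtain ⟨hR, hloc, hinj, -⟩ := hP
  have hmem {u : E2} (hu : ρ * ‖u‖ < R) : paraboloid ρ u ∈ solidTube R := by
    rw [mem_solidTube_iff_sq hR, sqRadius_paraboloid, ← mul_pow]
    exact pow_lt_pow_left₀ hu (by positivity) two_ne_zero
  have hball {u : E2} (hu : u ∈ Metric.closedBall (0 : E2) 1) : ρ * ‖u‖ < R := by
    rw [mem_closedBall_zero_iff] at hu
    nlinarith
  have hd {u : E2} (hu : u ∈ Metric.closedBall (0 : E2) 1) (w : E2) :
      mfderiv 𝓘(ℝ, E2) 𝓘(ℝ, E3) (P ∘ paraboloid ρ) u w =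
        mfderiv 𝓘(ℝ, E3) 𝓘(ℝ, E3) P (paraboloid ρ u) (paraboloidDeriv ρ u w) := by
    rw [mfderiv_comp u ((hloc _ (hmem (hball hu))).mdifferentiableAt (by simp))
      (hasFDerivAt_paraboloid ρ u).differentiableAt.mdifferentiableAt, mfderiv_eq_fderiv,
      (hasFDerivAt_paraboloid ρ u).fderiv]
    rfl
  have hb {u : E2} (hu : u ∈ Metric.closedBall (0 : E2) 1) :=
    mfderiv_bijective (hloc _ (hmem (hball hu)))
  have hξ' {u : E2} (hu : u ∈ Metric.closedBall (0 : E2) 1) (w : E3) :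
      mfderiv 𝓘(ℝ, E3) 𝓘(ℝ, E3) P (paraboloid ρ u) w ∈ ξ (P (paraboloid ρ u)) ↔
        cylForm (A (ρ ^ 2 * ‖u‖ ^ 2)) (B (ρ ^ 2 * ‖u‖ ^ 2)) 0 (paraboloid ρ u) w = 0 := by
    have := hξ _ (hmem (hball hu))
    rw [sqRadius_paraboloid] at this
    rw [← mem_cylPlane, ← this]
    rfl
  have hsph {u : E2} (hu : u ∈ Metric.sphere (0 : E2) 1) :
      u ∈ Metric.closedBall (0 : E2) 1 ∧ ‖u‖ = 1 ∧ u 0 ^ 2 + u 1 ^ 2 = 1 := by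
    have h1 : ‖u‖ = 1 := by simpa using hu
    exact ⟨Metric.sphere_subset_closedBall hu, h1, by rw [← E2.norm_sq, h1]; norm_num⟩
  have hsm : ContMDiffOn 𝓘(ℝ, E3) 𝓘(ℝ, E3) ∞ P (solidTube R) := fun q hq =>
    (hloc q hq).contMDiffAt.contMDiffWithinAt
  refine ⟨⟨{u | ρ * ‖u‖ < R}, isOpen_lt (by fun_prop) continuous_const, fun u hu => hball hu,
    hsm.comp (contDiff_paraboloid ρ).contMDiff.contMDiffOn fun u hu => hmem hu⟩, ?_, ?_, ?_, ?_, ?_⟩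
  · intro u hu w hw h
    obtain ⟨m, hm⟩ := (hinj _ (hmem (hball hu)) _ (hmem (hball hw))).1 h
    have h1 := congrArg (fun v : E3 => v 1) hm
    have h2 := congrArg (fun v : E3 => v 2) hm
    simp [paraboloid, screw, hρ.ne'] at h1 h2
    ext i
    fin_cases i
    · exact h1.symm
    · exact h2.symm
  · intro u hu w w' h
    exact injective_paraboloidDeriv hρ.ne' u
      ((hb hu).1 ((hd hu w).symm.trans (h.trans (hd hu w'))))
  · intro u hu
    obtain ⟨h1, h2, h3⟩ := hsph hu
    rw [hd h1]
    refine (hξ' h1 _).2 ?_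
    rw [cylForm_paraboloid, h2, one_pow, mul_one, hB]
    simp [circleTangent]
    ring_nf
    tauto
  · -- The horizontal radial vectors are tangent to the contact planes; tilting them gives the radial
    -- vectors of the paraboloid.
    set W : ℝ × E2 → E3 := fun y => !₂[2 * ρ ^ 2 * y.1, ρ * y.2 0, ρ * y.2 1] with hW
    refine ⟨fun t u => mfderiv 𝓘(ℝ, E3) 𝓘(ℝ, E3) P (paraboloid ρ u) (W (t, u)), ?_, ?_⟩
    · have hWc : Continuous W := by
        refine (PiLp.continuous_toLp 2 _).comp (continuous_pi fun i => ?_)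
        have h (i : Fin 2) : Continuous fun y : ℝ × E2 => y.2 i :=
          (EuclideanSpace.proj (𝕜 := ℝ) i).continuous.comp continuous_snd
        fin_cases i
        · exact continuous_const.mul continuous_fst
        · exact continuous_const.mul (h 0)
        · exact continuous_const.mul (h 1)
      have hc1 : Continuous fun y : ℝ × E2 =>
          (⟨paraboloid ρ y.2, W y⟩ : TangentBundle 𝓘(ℝ, E3) E3) :=
        (tangentBundleModelSpaceHomeomorph 𝓘(ℝ, E3)).symm.continuous.comp
          (((contDiff_paraboloid ρ).continuous.comp continuous_snd).prodMk hWc)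
      have hc2 := hsm.continuousOn_tangentMapWithin (by simp)
        (isOpen_solidTube R).uniqueMDiffOn
      refine (hc2.comp hc1.continuousOn (s := Icc (0 : ℝ) 1 ×ˢ Metric.sphere (0 : E2) 1)
        fun y hy => hmem (hball (hsph hy.2).1)).congr fun y hy => ?_
      have := tangentMapWithin_eq_tangentMap (I := 𝓘(ℝ, E3)) (I' := 𝓘(ℝ, E3)) (f := P)
        (s := solidTube R) (p := (⟨paraboloid ρ y.2, W y⟩ : TangentBundle 𝓘(ℝ, E3) E3))
        ((isOpen_solidTube R).uniqueMDiffOn _ (hmem (hball (hsph hy.2).1)))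
        ((hloc _ (hmem (hball (hsph hy.2).1))).mdifferentiableAt (by simp))
      exact this.symm
    · intro u hu
      obtain ⟨h1, h2, h3⟩ := hsph hu
      refine ⟨fun t _ => ?_, ?_, ?_⟩
      · rw [LinearIndependent.pair_iff]
        intro s s' hs
        rw [hd h1] at hs
        have hs : s • paraboloidDeriv ρ u (circleTangent u) + s' • W (t, u) = 0 := by
          set L : E3 →L[ℝ] E3 := mfderiv 𝓘(ℝ, E3) 𝓘(ℝ, E3) P (paraboloid ρ u) with hL
          have hLi : Function.Injective L := (hb h1).1
          refine hLi ?_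
          rw [map_add, map_smul, map_smul, map_zero]
          exact hs
        have e1 := congrArg (fun v : E3 => v 1) hs
        have e2 := congrArg (fun v : E3 => v 2) hs
        simp [hW, paraboloidDeriv_apply, circleTangent] at e1 e2
        constructor
        · refine (mul_eq_zero.1 ?_).resolve_left hρ.ne'
          linear_combination u 0 * e2 - u 1 * e1 - ρ * s * h3
        · refine (mul_eq_zero.1 ?_).resolve_left hρ.ne'
          linear_combination u 0 * e1 + u 1 * e2 - ρ * s' * h3
      · refine (hξ' h1 _).2 ?_
        simp [cylForm_apply, paraboloid, hW]
        right
        ring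
      · refine ⟨u, ?_⟩
        change mfderiv 𝓘(ℝ, E2) 𝓘(ℝ, E3) (P ∘ paraboloid ρ) u u = _
        rw [hd h1]
        congr 1
        apply E3.ext
        · simp [paraboloidDeriv_apply, hW]
          linear_combination 2 * ρ ^ 2 * h3
        · simp [paraboloidDeriv_apply, hW]
        · simp [paraboloidDeriv_apply, hW]
  · have hsing {u : E2} (hu : u ∈ Metric.closedBall (0 : E2) 1) :
        LinearMap.range (mfderiv 𝓘(ℝ, E2) 𝓘(ℝ, E3) (P ∘ paraboloid ρ) u).toLinearMap =
          ξ ((P ∘ paraboloid ρ) u) ↔ u = 0 := by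
      constructor
      · intro h
        have key (w : E2) := (hξ' hu (paraboloidDeriv ρ u w)).1 (by
          rw [← hd hu]
          exact h.le ⟨w, rfl⟩)
        simp only [cylForm_paraboloid] at key
        have k1 := key u
        have k2 := key (circleTangent u)
        have c0 : circleTangent u 0 = -u 1 := rfl
        have c1 : circleTangent u 1 = u 0 := rfl
        rw [c0, c1] at k2
        by_contra hne
        have hpos : u 0 ^ 2 + u 1 ^ 2 ≠ 0 := by
          rw [← E2.norm_sq]
          simpa using hne
        have hρ2 : ρ ^ 2 ≠ 0 := by positivity
        rcases hAB (ρ ^ 2 * ‖u‖ ^ 2) with h0 | h0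
        · refine mul_ne_zero (mul_ne_zero hρ2 h0) hpos ?_
          linear_combination k1 / 2
        · refine mul_ne_zero (mul_ne_zero hρ2 h0) hpos ?_
          linear_combination k2
      · rintro rfl
        have key (w : E2) : mfderiv 𝓘(ℝ, E2) 𝓘(ℝ, E3) (P ∘ paraboloid ρ) 0 w ∈
            ξ (P (paraboloid ρ 0)) := by
          rw [hd hu]
          refine (hξ' hu _).2 ?_
          rw [cylForm_paraboloid]
          simp
        have h00 : A (ρ ^ 2 * ‖(0 : E2)‖ ^ 2) = A 0 := by simp
        refine le_antisymm ?_ ?_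
        · rintro _ ⟨w, rfl⟩
          exact key w
        · intro v hv
          obtain ⟨w, rfl⟩ := (hb hu).2 v
          replace hw := (hξ' hu w).1 hv
          replace hw : cylForm (A 0) (B (ρ ^ 2 * ‖(0 : E2)‖ ^ 2)) 0 (paraboloid ρ 0) w = 0 := h00 ▸ hw
          change E3 at w
          simp [cylForm_apply, paraboloid, hA0] at hw
          refine ⟨!₂[w 1 / ρ, w 2 / ρ], ?_⟩
          change mfderiv 𝓘(ℝ, E2) 𝓘(ℝ, E3) (P ∘ paraboloid ρ) 0 _ = _
          rw [hd hu]
          congr 1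
          apply E3.ext
          · simp [paraboloidDeriv_apply, hw]
          · simp [paraboloidDeriv_apply, mul_div_cancel₀, hρ.ne']
          · simp [paraboloidDeriv_apply, mul_div_cancel₀, hρ.ne']
    refine ⟨0, ⟨by simp, (hsing (by simp)).2 rfl⟩, ?_⟩
    rintro u ⟨hu, h⟩
    exact (hsing (Metric.ball_subset_closedBall hu)).1 h

end Manifold

section

/-! ### The Lutz twist along a component of the singular locus -/

variable {X : Type*} [TopologicalSpace X]

namespace Tube

variable {O : OrbAtlas X} (T : Tube O)

theorem sqrt_n_pos : 0 < Real.sqrt T.n :=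
  Real.sqrt_pos.2 (by exact_mod_cast Nat.pos_of_ne_zero T.n_ne_zero)

theorem quotientCoord_sqrt :
    T.quotientCoord (Real.sqrt T.n) = T.quotientCoord 1 ∘ dilation (Real.sqrt T.n) := by
  ext1 q
  rw [quotientCoord, rootPoint_eq _ T.sqrt_n_pos]
  rfl

theorem dilation_mem_iff {q : E3} :
    dilation (Real.sqrt T.n) q ∈ solidTube T.R ↔ q ∈ solidTube (T.R / Real.sqrt T.n) := by
  rw [mem_solidTube, mem_solidTube, radius_dilation T.sqrt_n_pos.le, lt_div_iff₀ T.sqrt_n_pos,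
    mul_comm]

theorem exists_dilation_eq (p : E3) : ∃ q, dilation (Real.sqrt T.n) q = p := by
  obtain ⟨e, he⟩ := exists_continuousLinearEquiv (injective_dilation T.sqrt_n_pos.ne')
  exact ⟨e.symm p, by rw [← he]; simp⟩

theorem image_quotientCoord :
    T.quotientCoord (Real.sqrt T.n) '' solidTube (T.R / Real.sqrt T.n) = T.image := by
  rw [quotientCoord_sqrt, image_comp]
  ext x
  constructor
  · rintro ⟨_, ⟨q, hq, rfl⟩, rfl⟩
    exact ⟨_, T.rootPoint_mem (T.dilation_mem_iff.2 hq), rfl⟩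
  · rintro ⟨p, hp, rfl⟩
    obtain ⟨q, hq⟩ := T.exists_dilation_eq (powMap T.n p)
    have hq' := T.powMap_mem hp
    rw [← hq, T.dilation_mem_iff] at hq'
    exact ⟨_, ⟨q, hq', hq⟩, T.quotientCoord_powMap hp⟩

theorem image_axis_quotientCoord : T.quotientCoord (Real.sqrt T.n) '' axis = T.core := by
  refine image_congr fun q hq => ?_
  rw [quotientCoord]
  congr 1
  refine ext_cxCoord rfl ?_
  rw [cxCoord_rootPoint, mem_axis.1 hq, radius_eq_zero.1 hq]
  simp

theorem quotientCoord_sqrt_eq_iff {p q : E3} (hp : p ∈ solidTube (T.R / Real.sqrt T.n))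
    (hq : q ∈ solidTube (T.R / Real.sqrt T.n)) :
    T.quotientCoord (Real.sqrt T.n) p = T.quotientCoord (Real.sqrt T.n) q ↔
      ∃ m : ℤ, q = screw m 0 p := by
  have hd (m : ℝ) : dilation (Real.sqrt T.n) (screw m 0 p) =
      screw m 0 (dilation (Real.sqrt T.n) p) := by
    apply E3.ext <;> simp [screw, dilation_apply]
  rw [quotientCoord_sqrt, Function.comp_apply, Function.comp_apply,
    T.quotientCoord_eq_iff (T.dilation_mem_iff.2 hp) (T.dilation_mem_iff.2 hq)]
  refine exists_congr fun m => ?_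
  rw [← hd, (injective_dilation T.sqrt_n_pos.ne').eq_iff]

end Tube

namespace TubeSystem

variable {O : OrbAtlas X} (T : TubeSystem O)

theorem isLocalDiffeomorphAt_quotientCoord (K : O.singularComponents) {q : E3}
    (hq : q ∈ solidTube ((T.tube K).R / Real.sqrt (T.tube K).n)) :
    letI := T.paramFamily.chartedSpace
    IsLocalDiffeomorphAt 𝓘(ℝ, E3) 𝓘(ℝ, E3) ∞
      ((T.tube K).quotientCoord (Real.sqrt (T.tube K).n)) q := by
  let _ := T.paramFamily.chartedSpace
  obtain ⟨e, he⟩ := exists_continuousLinearEquiv (injective_dilation (T.tube K).sqrt_n_pos.ne')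
  have h1 : IsLocalDiffeomorphAt 𝓘(ℝ, E3) 𝓘(ℝ, E3) ∞ (dilation (Real.sqrt (T.tube K).n)) q := by
    rw [← he]
    exact e.toDiffeomorph.isLocalDiffeomorph q
  rw [(T.tube K).quotientCoord_sqrt]
  exact h1.comp (hg := T.isUnderlyingManifold.2 K _ ((T.tube K).dilation_mem_iff.2 hq))

theorem isTubularCoord (K : O.singularComponents) :
    letI := T.paramFamily.chartedSpace
    IsTubularCoord (K : Set X) ((T.tube K).R / Real.sqrt (T.tube K).n)
      ((T.tube K).quotientCoord (Real.sqrt (T.tube K).n)) :=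
  letI := T.paramFamily.chartedSpace
  ⟨div_pos (T.tube K).pos (T.tube K).sqrt_n_pos,
    fun _ hq => T.isLocalDiffeomorphAt_quotientCoord K hq,
    fun _ hp _ hq => (T.tube K).quotientCoord_sqrt_eq_iff hp hq,
    (T.tube K).image_axis_quotientCoord.trans (T.core_eq K)⟩

/-- The change from the coordinates `(z, r, n θ)` to `(z, r / √n, n θ)` on the quotient. -/
theorem pullback_quotientCoord (K : O.singularComponents) {q : E3}
    (hq : q ∈ solidTube ((T.tube K).R / Real.sqrt (T.tube K).n)) {a b : ℝ} :
    letI := T.paramFamily.chartedSpace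
    ∀ {ξ : ∀ x : X, Submodule ℝ (TangentSpace 𝓘(ℝ, E3) x)},
      pullback ((T.tube K).quotientCoord 1) ξ (dilation (Real.sqrt (T.tube K).n) q) =
        cylPlane a (((T.tube K).n : ℝ)⁻¹ * b) 0 (dilation (Real.sqrt (T.tube K).n) q) →
      pullback ((T.tube K).quotientCoord (Real.sqrt (T.tube K).n)) ξ q = cylPlane a b 0 q := by
  let _ := T.paramFamily.chartedSpace
  intro ξ h
  have hn : ((T.tube K).n : ℝ) ≠ 0 := by exact_mod_cast (T.tube K).n_ne_zero
  have h1 := T.isUnderlyingManifold.2 K _ ((T.tube K).dilation_mem_iff.2 hq)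
  rw [(T.tube K).quotientCoord_sqrt, pullback_comp (h1.mdifferentiableAt (by simp))
    (dilation _).differentiableAt, h, ContinuousLinearMap.fderiv, comap_cylPlane_dilation,
    Real.sq_sqrt (Nat.cast_nonneg _), mul_zero, mul_inv_cancel_left₀ hn]

/-- The induced plane fields on the quotients of the tubes, in the coordinates `(z, r, n θ)`: with
`φ = n θ` one has `r² dθ = (1 / n) r² dφ`. -/
def quotientStd (K : O.singularComponents) (q : E3) : Submodule ℝ E3 :=
  cylPlane 1 (((T.tube K).n : ℝ)⁻¹ * 1) 0 q

open Classical in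
/-- The plane fields on the quotients of the tubes after a Lutz twist along `K`. -/
def quotientTwist (K : O.singularComponents) (a b : ℝ) (L : O.singularComponents) (q : E3) :
    Submodule ℝ E3 :=
  if L = K then cylPlane (twistA a b (sqRadius q / (T.tube K).n))
    (((T.tube K).n : ℝ)⁻¹ * twistB a b (sqRadius q / (T.tube K).n)) 0 q
  else T.quotientStd L q

theorem quotientTwist_self (K : O.singularComponents) (a b : ℝ) :
    T.quotientTwist K a b K = fun q => cylPlane (twistA a b (sqRadius q / (T.tube K).n))
      (((T.tube K).n : ℝ)⁻¹ * twistB a b (sqRadius q / (T.tube K).n)) 0 q :=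
  funext fun _ => if_pos rfl

theorem quotientTwist_of_ne {K L : O.singularComponents} (h : L ≠ K) (a b : ℝ) :
    T.quotientTwist K a b L = T.quotientStd L := funext fun _ => if_neg h

theorem cylPlane_screw (a b : ℝ) (m : ℝ) (q : E3) :
    cylPlane a b 0 (screw m 0 q) = cylPlane a b 0 q := by
  ext v
  rw [mem_cylPlane, mem_cylPlane, ← cylForm_screw a b 0 m 0 q v, rotation_zero]

variable {T}

theorem comap_powMap {K : O.singularComponents} {p : E3} (h0 : radius p ≠ 0) (a b : ℝ) :
    (cylPlane a (((T.tube K).n : ℝ)⁻¹ * b) 0 (powMap (T.tube K).n p)).comap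
      (fderiv ℝ (powMap (T.tube K).n) p : E3 →ₗ[ℝ] E3) = cylPlane a b 0 p := by
  rw [comap_cylPlane_powMap (T.tube K).n_ne_zero h0, mul_inv_cancel_left₀]
  exact_mod_cast (T.tube K).n_ne_zero

theorem isCompatible_std {ζ : OrbChart X → E3 → Submodule ℝ E3}
    (hT : ∀ K, (T.tube K).IsStandard ζ) : T.IsCompatible ζ T.quotientStd := by
  refine ⟨fun K m q => cylPlane_screw _ _ _ _, fun K p hp h0 c hc u hu h => ?_⟩
  have := (hT K).germEquiv hp hc hu h
  rwa [stdPlane_eq_cylPlane, ← comap_powMap (T := T) (K := K) h0] at this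

theorem isCompatible_twist {ζ : OrbChart X → E3 → Submodule ℝ E3}
    (hT : ∀ K, (T.tube K).IsStandard ζ) (K : O.singularComponents) (a b : ℝ) :
    T.IsCompatible ((T.tube K).tubeField (homotopyPlane (T.tube K).n a b 1) ζ)
      (T.quotientTwist K a b) := by
  constructor
  · intro L m q
    by_cases hL : L = K
    · subst hL
      rw [quotientTwist_self]
      beta_reduce
      rw [sqRadius_screw]
      exact cylPlane_screw _ _ _ _
    · rw [T.quotientTwist_of_ne hL]
      exact cylPlane_screw _ _ _ _
  · intro L p hp h0 c hc u hu h
    by_cases hL : L = K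
    · subst hL
      have := Tube.tubeField_germEquiv (ζ := ζ) (screwInvariant_homotopyPlane
        (n := (T.tube L).n) (a := a) (b := b) 1) hp hc hu h
      rw [homotopyPlane_one, ← comap_powMap (T := T) (K := L) h0,
        ← sqRadius_powMap (T.tube L).n_ne_zero] at this
      rwa [quotientTwist_self]
    · rw [T.quotientTwist_of_ne hL, Tube.tubeField_of_notMem]
      · exact (isCompatible_std hT).2 L p hp h0 c hc u hu h
      · intro hK
        exact disjoint_left.1 (T.disjoint L K hL) ⟨p, hp, h.symm⟩ hK

theorem isContactAt_quotientStd (K : O.singularComponents) (q : E3) :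
    IsContactAt (T.quotientStd K) q := by
  have hn : ((T.tube K).n : ℝ) ≠ 0 := by exact_mod_cast (T.tube K).n_ne_zero
  exact isContactAt_cylPlane (A := fun _ => 1) (B := fun _ => ((T.tube K).n : ℝ)⁻¹ * 1) contDiff_const
    contDiff_const (by simpa using hn)

theorem isContactAt_quotientTwist {K : O.singularComponents} {a b : ℝ} (ha : 0 < a) (h : a < b)
    (L : O.singularComponents) (q : E3) : IsContactAt (T.quotientTwist K a b L) q := by
  by_cases hL : L = K
  · subst hL
    have hn : ((T.tube L).n : ℝ) ≠ 0 := by exact_mod_cast (T.tube L).n_ne_zero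
    rw [quotientTwist_self]
    exact isContactAt_twist ha h (inv_ne_zero hn) q
  · rw [T.quotientTwist_of_ne hL]
    exact isContactAt_quotientStd L q

end TubeSystem

end

end CyclicOrbifold

end

open CyclicOrbifold
theorem mainTheorem3 {X : Type*} [TopologicalSpace X] [CompactSpace X] [T2Space X]
    (O : OrbAtlas X) (hO : O.IsCyclicOrbifold)
    (o : OrbChart X → ℤˣ) (ho : O.IsOrientation o)
    (T : TubeSystem O) (ζ : OrbChart X → E3 → Submodule ℝ E3)
    (hζ : O.IsContact ζ) (hT : ∀ K, (T.tube K).IsStandard ζ) :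
    ∃ (_ : ChartedSpace E3 X) (_ : IsManifold 𝓘(ℝ, E3) ∞ X),
      IsUnderlyingManifold T ∧
      ∃ ξ : ∀ x : X, Submodule ℝ (TangentSpace 𝓘(ℝ, E3) x),
        IsContactManifold ξ ∧ Induces O ζ ξ ∧
        ∀ K : O.singularComponents,
          ∃ ζ' : OrbChart X → E3 → Submodule ℝ E3,
            O.IsContact ζ' ∧ O.IsHomotopic ζ ζ' ∧
            ∃ ξ' : ∀ x : X, Submodule ℝ (TangentSpace 𝓘(ℝ, E3) x),
              IsContactManifold ξ' ∧ Induces O ζ' ξ' ∧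
              IsFullLutzTwist (K : Set X) ((T.tube K).R / Real.sqrt (T.tube K).n)
                ((T.tube K).quotientCoord (Real.sqrt (T.tube K).n)) ξ ξ' ∧
              ∃ f : E2 → X, IsOvertwistedDisc ξ' f ∧
                (f '' Metric.closedBall 0 1 ∩ K).Nonempty := by
  let _ := T.paramFamily.chartedSpace
  have hM : IsManifold 𝓘(ℝ, E3) ∞ X := T.paramFamily.isManifold
  refine ⟨T.paramFamily.chartedSpace, hM, T.isUnderlyingManifold, ?_⟩
  obtain ⟨ξ, hξ, hξζ, hξT⟩ :=
    T.exists_induced (TubeSystem.isCompatible_std hT) hζ TubeSystem.isContactAt_quotientStd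
  refine ⟨ξ, hξ, hξζ, fun K => ?_⟩
  have hδ : 0 < (T.tube K).R / Real.sqrt (T.tube K).n :=
    div_pos (T.tube K).pos (T.tube K).sqrt_n_pos
  have hn : ((T.tube K).n : ℝ) ≠ 0 := by exact_mod_cast (T.tube K).n_ne_zero
  have hn0 : (0 : ℝ) < (T.tube K).n := lt_of_le_of_ne (Nat.cast_nonneg _) hn.symm
  set δ := (T.tube K).R / Real.sqrt (T.tube K).n with hδ'
  -- The angle grows where the squared radius lies between `a` and `b`.
  obtain ⟨a, ha, haδ⟩ := exists_between (pow_pos hδ 2)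
  obtain ⟨b, hab, hb⟩ := exists_between haδ
  have hbR : (T.tube K).n * b < (T.tube K).R ^ 2 := by
    rw [hδ', div_pow, Real.sq_sqrt hn0.le, lt_div_iff₀ hn0] at hb
    linarith
  have hζ' := Tube.isContact_tubeField ha hab hbR (hT K) hζ
  obtain ⟨ξ', hξ', hξζ', hξT'⟩ := T.exists_induced (TubeSystem.isCompatible_twist hT K a b) hζ'
    (TubeSystem.isContactAt_quotientTwist ha hab)
  have hpull (q : E3) (hq : q ∈ solidTube δ) :
      pullback ((T.tube K).quotientCoord (Real.sqrt (T.tube K).n)) ξ' q =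
        cylPlane (twistA a b (sqRadius q)) (twistB a b (sqRadius q)) 0 q := by
    refine T.pullback_quotientCoord K hq ?_
    rw [hξT' K _ ((T.tube K).dilation_mem_iff.2 hq), T.quotientTwist_self]
    beta_reduce
    rw [sqRadius_dilation, Real.sq_sqrt hn0.le, mul_div_cancel_left₀ _ hn]
  have htub := T.isTubularCoord K
  refine ⟨_, hζ', Tube.isHomotopic_tubeField ha hab hbR (hT K) hζ, ξ', hξ', hξζ',
    ⟨htub, fun q hq => ?_, ⟨_, _, isFullLutzProfile ha hab hδ hb, fun q hq => ?_⟩,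
      fun x hx => ?_⟩, ?_⟩
  · rw [stdPlane_eq_cylPlane]
    exact T.pullback_quotientCoord K hq (hξT K _ ((T.tube K).dilation_mem_iff.2 hq))
  · rw [hpull q hq, eq_comm]
    refine rotPlane_eq_cylPlane ?_ ?_ <;> simp only [radius_sq]
  · rw [hδ', (T.tube K).image_quotientCoord] at hx
    obtain ⟨i, p, hp, rfl⟩ := T.paramFamily.cover x
    refine eq_of_pullback_eq (T.paramFamily.isLocalDiffeomorphAt hp) ?_
    rcases i with ⟨c, hc⟩ | L
    · refine (hξζ' c hc p hp.1 hp.2).symm.trans (Eq.trans ?_ (hξζ c hc p hp.1 hp.2))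
      exact Tube.tubeField_of_notMem hx
    · refine (hξT' L p hp).trans (Eq.trans ?_ (hξT L p hp).symm)
      rw [T.quotientTwist_of_ne]
      rintro rfl
      exact hx ⟨_, (T.tube L).rootPoint_mem hp, rfl⟩
  · -- The disc is bounded by the circle on which the contact planes are horizontal for the first
    -- time.
    obtain ⟨s₁, s₂, h1, h12, h2, hz⟩ := exists_zeros ha hab
    have hs : 0 < s₁ := ha.trans h1
    refine ⟨_, isOvertwistedDisc_paraboloid (ρ := Real.sqrt s₁) htub hpull (fun s => ?_) ?_
      (Real.sqrt_pos.2 hs) ((Real.sqrt_lt' hδ).2 (by linarith)) ?_, ?_⟩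
    · by_contra! hc
      have := twistA_sq_add ha hab s
      rw [hc.1, hc.2] at this
      nlinarith [sq_nonneg s]
    · rw [(twist_of_notMem hab fun h => absurd h.1 (not_lt.2 ha.le)).1]
      exact one_ne_zero
    · rw [Real.sq_sqrt hs.le]
      exact (mul_eq_zero.1 ((hz s₁ hs).2 (Or.inl rfl))).resolve_left hs.ne'
    · refine ⟨_, mem_image_of_mem _ (Metric.mem_closedBall_self zero_le_one), ?_⟩
      rw [← htub.2.2.2]
      refine mem_image_of_mem _ ?_
      rw [mem_axis, ← sqRadius_eq_zero, sqRadius_paraboloid]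
      simp
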